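/- **Theorem (Lower bounds for zeroth-order optimization with Markovian noise).** *Setting.* Let $d,\tau\ge 1$ be integers and $L,\mu,\sigma_1,\sigma_2>0$. A problem instance consists of a stationary Markov chain $Z_0,Z_1,\dots$ on a complete separable metric space $\mathsf Z$ with kernel $Q$ and unique invariant distribution $\pi$, and an oracle $F:\mathbb R^d\times\mathsf Z\to\mathbb R$; the objective is $f(x)=\mathbb E_{Z\sim\pi}F(x,Z)$. It has mixing time $\tau$ if $\sup_{z,z'}\tfrac12\|Q^k(z,\cdot)-Q^k(z',\cdot)\|_{TV}\le(1/4)^{\lfloor k/\tau\rfloor}$ for all $k\in\mathbb N$. A (possibly randomized, adaptive) algorithm makes one oracle call per step of the chain: its $n$-th query may depend on internal randomness, independent of the chain, and on all earlier answers, and $x^N$ is its output after $N$ calls. With one-point feedback a query $x$ is answered by $F(x,Z_n)$; with two-point feedback a query $(x,y)$ is answered by $(F(x,Z_n),F(y,Z_n))$. The state $Z_n$ itself is not observed. * *One-point class* ($L\ge 3\mu$): mixing time $\tau$; $f$ is $L$-smooth, continuously differentiable and $\mu$-strongly convex; and for all $x$ either (M1) $\mathbb E_\pi|F(x,Z)-f(x)|^2<\sigma_1^2$,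 or (U1) $|F(x,z)-f(x)|^2\le\sigma_1^2$ for all $z\in\mathsf Z$. * *Two-point class* ($L\ge\mu$): mixing time $\tau$; every $F(\cdot,z)$ is $L$-smooth; $f$ is continuously differentiable and $\mu$-strongly convex; $\mathbb E_\pi\nabla F(x,Z)=\nabla f(x)$; and for all $x$ either (M2) $\mathbb E_\pi\|\nabla F(x,Z)-\nabla f(x)\|^2<\sigma_2^2$, or (U2) $\|\nabla F(x,z)-\nabla f(x)\|^2\le\sigma_2^2$ for all $z\in\mathsf Z$. *Claim.* There is a universal constant $c>0$ such that the following holds for all such parameters. In each case below, for all sufficiently large $N$ (with a threshold depending only on $d,\tau,L,\mu$ and $\sigma_1$ or $\sigma_2$) and for every algorithm, there is an instance of the class, whose minimizer $x^*$ lies in the unit ball, on which the stated bound holds: * one-point, (M1): $\displaystyle \mathbb E\|x^N-x^*\|^2\ge c\,\frac{\sqrt{d(d+\tau)\sigma_1^2}}{\mu\sqrt N}$; * one-point, (U1): $\displaystyle \mathbb E\|x^N-x^*\|^2\ge c\,\frac{\sqrt{d(d+\tau)\sigma_1^2}}{\mu\sqrt N\,\log N}$; * two-point, (M2): $\displaystyle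 \mathbb E\|x^N-x^*\|^2\ge c\,\frac{(d+\tau)\sigma_2^2}{\mu^2N}$; * two-point, (U2): $\displaystyle \mathbb E\|x^N-x^*\|^2\ge c\,\frac{(d+\tau)\sigma_2^2}{\mu^2N\log^2N}$. Correspondingly, for all sufficiently small $\varepsilon>0$ (with a threshold depending on the same parameters) an algorithm needs at least the following number of oracle calls to guarantee $\mathbb E\|x^N-x^*\|^2\le\varepsilon$: for every algorithm and every $N$ strictly smaller than the given quantity there is an instance of the class, with minimizer in the unit ball, on which $\mathbb E\|x^N-x^*\|^2>\varepsilon$: * one-point: $\displaystyle c\,\frac{d(d+\tau)\sigma_1^2}{\mu^2\varepsilon^2}$ under (M1), and $\displaystyle c\,\frac{d(d+\tau)\sigma_1^2}{\mu^2\varepsilon^2\log^2(1/\varepsilon)}$ under (U1); * two-point: $\displaystyle c\,\frac{(d+\tau)\sigma_2^2}{\mu^2\varepsilon}$ under (M2), and $\displaystyle c\,\frac{(d+\tau)\sigma_2^2}{\mu^2\varepsilon\log^2(1/\varepsilon)}$ under (U2). -/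

import Mathlib

open MeasureTheory ProbabilityTheory Filter Topology
open scoped ENNReal InnerProductSpace Gradient

universe u

noncomputable section

/-- `ℝ^d` with its Euclidean norm. -/
abbrev Euc (d : ℕ) : Type := EuclideanSpace ℝ (Fin d)

/-- `f` is differentiable and its gradient is `L`-Lipschitz on `ℝ^d`. -/
def IsLSmooth {d : ℕ} (L : ℝ) (f : Euc d → ℝ) : Prop :=
  Differentiable ℝ f ∧ ∀ x y : Euc d, ‖∇ f x - ∇ f y‖ ≤ L * ‖x - y‖

/-- `f` is continuously differentiable and `μ`-strongly convex on `ℝ^d`. -/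
def IsStronglyConvex {d : ℕ} (μ : ℝ) (f : Euc d → ℝ) : Prop :=
  ContDiff ℝ 1 f ∧
    ∀ x y : Euc d, μ / 2 * ‖x - y‖ ^ 2 ≤ f x - f y - ⟪∇ f y, x - y⟫_ℝ

/-- The Dobrushin coefficient of a Markov kernel: the supremum over `z, z'` of
`(1/2) ‖κ(z, ·) - κ(z', ·)‖_TV`, where half the total variation norm of the difference of two
probability measures is written as the supremum of `|κ(z, A) - κ(z', A)|` over measurable `A`. -/
def dobrushin {S : Type*} [MeasurableSpace S] (κ : Kernel S S) : ℝ≥0∞ :=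
  ⨆ (z : S) (z' : S) (A : Set S) (_ : MeasurableSet A),
    ENNReal.ofReal |(κ z).real A - (κ z').real A|

/-- `Z` is a stationary Markov chain with transition kernel `Q` and unique invariant distribution
`stat`, and `Q` is uniformly geometrically ergodic with mixing time `τ`.  The exponent `k / τ` is
the integer part of the quotient. -/
structure IsMixingChain {S Ω : Type*} [MeasurableSpace S] [MeasurableSpace Ω]
    (Q : Kernel S S) (stat : Measure S) (P : Measure Ω) (Z : ℕ → Ω → S) (τ : ℕ) : Prop where
  measurable : ∀ n, Measurable (Z n)
  law_zero : P.map (Z 0) = stat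
  markov : ∀ n : ℕ,
    P.map (fun ω => ((fun i : Fin (n + 1) => Z i ω), Z (n + 1) ω)) =
      (P.map (fun ω => fun i : Fin (n + 1) => Z i ω)) ⊗ₘ
        (Q.comap (fun h : Fin (n + 1) → S => h (Fin.last n)) (measurable_pi_apply _))
  invariant : Q.Invariant stat
  unique : ∀ ν : Measure S, IsProbabilityMeasure ν → Q.Invariant ν → ν = stat
  mixing : ∀ k : ℕ, dobrushin (Q ^ k) ≤ ENNReal.ofReal ((1 / 4 : ℝ) ^ (k / τ))

/-- The data of a stochastic optimization problem on `ℝ^d` with Markovian noise: the (Polish)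
state space, the transition kernel `Q`, the distribution `stat`, the noise sequence
`Z 0, Z 1, ...` on a probability space `(Ω, P)`, and the oracle `F (x, z)`.
What is required of these data is stated by the predicates below. -/
structure MarkovProblem (d : ℕ) where
  State : Type
  [topState : TopologicalSpace State]
  [polishState : PolishSpace State]
  [measState : MeasurableSpace State]
  [borelState : BorelSpace State]
  Q : Kernel State State
  [markovQ : IsMarkovKernel Q]
  stat : Measure State
  [probStat : IsProbabilityMeasure stat]
  Ω : Type
  [measΩ : MeasurableSpace Ω]
  P : Measure Ω
  [probP : IsProbabilityMeasure P]
  Z : ℕ → Ω → State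
  F : Euc d → State → ℝ

namespace MarkovProblem

attribute [instance] topState polishState measState borelState markovQ probStat measΩ probP

variable {d : ℕ}

/-- The objective `f(x) = E_{z ∼ stat} F(x, z)`. -/
def f (p : MarkovProblem d) (x : Euc d) : ℝ := ∫ z, p.F x z ∂p.stat

/-- Standing assumptions for one-point feedback, apart from the size of the noise: Markovian noise
with mixing time `τ`, an `L`-smooth and `μ`-strongly convex objective `f(x) = E F(x, Z)`. -/
structure OnePoint (p : MarkovProblem d) (L μ : ℝ) (τ : ℕ) : Prop where
  chain : IsMixingChain p.Q p.stat p.P p.Z τ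
  measurable_F : Measurable (Function.uncurry p.F)
  integrable_F : ∀ x, Integrable (p.F x) p.stat
  smooth : IsLSmooth L p.f
  convex : IsStronglyConvex μ p.f

/-- Standing assumptions for two-point feedback, apart from the size of the noise: moreover every
`F(·, z)` is `L`-smooth and `∇F(x, Z)` is an unbiased estimator of `∇f(x)`. -/
structure TwoPoint (p : MarkovProblem d) (L μ : ℝ) (τ : ℕ) : Prop where
  chain : IsMixingChain p.Q p.stat p.P p.Z τ
  measurable_F : Measurable (Function.uncurry p.F)
  integrable_F : ∀ x, Integrable (p.F x) p.stat
  smooth : ∀ z, IsLSmooth L (fun x => p.F x z)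
  convex : IsStronglyConvex μ p.f
  integrable_grad : ∀ x, Integrable (fun z => ∇ (fun y => p.F y z) x) p.stat
  unbiased_grad : ∀ x, ∫ z, ∇ (fun y => p.F y z) x ∂p.stat = ∇ p.f x

/-- `E |F(x, Z) - f(x)|² < σ²` for all `x`. -/
def ValueNoiseMoment (p : MarkovProblem d) (σ : ℝ) : Prop :=
  ∀ x, ∫⁻ z, ENNReal.ofReal (|p.F x z - p.f x| ^ 2) ∂p.stat < ENNReal.ofReal (σ ^ 2)

/-- `|F(x, z) - f(x)|² ≤ σ²` for all `x` and `z`. -/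
def ValueNoiseUniform (p : MarkovProblem d) (σ : ℝ) : Prop :=
  ∀ x z, |p.F x z - p.f x| ^ 2 ≤ σ ^ 2

/-- `E ‖∇F(x, Z) - ∇f(x)‖² < σ²` for all `x`. -/
def GradNoiseMoment (p : MarkovProblem d) (σ : ℝ) : Prop :=
  ∀ x, ∫⁻ z, ENNReal.ofReal (‖∇ (fun y => p.F y z) x - ∇ p.f x‖ ^ 2) ∂p.stat <
    ENNReal.ofReal (σ ^ 2)

/-- `‖∇F(x, z) - ∇f(x)‖² ≤ σ²` for all `x` and `z`. -/
def GradNoiseUniform (p : MarkovProblem d) (σ : ℝ) : Prop :=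
  ∀ x z, ‖∇ (fun y => p.F y z) x - ∇ p.f x‖ ^ 2 ≤ σ ^ 2

/-- One-point oracle: the query `x` in noise state `z` is answered by `F(x, z)`. -/
def oracle₁ (p : MarkovProblem d) (x : Euc d) (z : p.State) : ℝ := p.F x z

/-- Two-point oracle: the query `(x, y)` in noise state `z` is answered by
`(F(x, z), F(y, z))`. -/
def oracle₂ (p : MarkovProblem d) (q : Euc d × Euc d) (z : p.State) : ℝ × ℝ :=
  (p.F q.1 z, p.F q.2 z)

end MarkovProblem

/-- A randomized adaptive algorithm with queries in `A`, oracle answers in `B` and outputs in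
`ℝ^d`.  All internal randomness is contained in a seed; query number `n` is a measurable function of
the seed and the first `n` answers, and `output N` is the estimate `x^N` formed from the seed and
the first `N` answers. -/
structure Algorithm (A B : Type) [MeasurableSpace A] [MeasurableSpace B] (d : ℕ) where
  Seed : Type u
  [measSeed : MeasurableSpace Seed]
  law : Measure Seed
  [probLaw : IsProbabilityMeasure law]
  query : (n : ℕ) → Seed → (Fin n → B) → A
  measurable_query : ∀ n, Measurable (fun q : Seed × (Fin n → B) => query n q.1 q.2)
  output : (N : ℕ) → Seed → (Fin N → B) → Euc d
  measurable_output : ∀ N, Measurable (fun q : Seed × (Fin N → B) => output N q.1 q.2)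

namespace Algorithm

attribute [instance] measSeed probLaw

variable {A B : Type} [MeasurableSpace A] [MeasurableSpace B] {d : ℕ}

/-- The first `n` answers obtained by the algorithm with seed `r` when the `i`-th oracle call is
made in noise state `z i`. -/
def answers {S : Type} (a : Algorithm.{u} A B d) (oracle : A → S → B) (r : a.Seed) (z : ℕ → S) :
    (n : ℕ) → (Fin n → B)
  | 0 => Fin.elim0
  | n + 1 => Fin.snoc (α := fun _ => B) (a.answers oracle r z n)
      (oracle (a.query n r (a.answers oracle r z n)) (z n))

/-- The mean square error `E ‖x^N - y‖²` after `N` oracle calls on the problem `p`; the seed is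
independent of the noise sequence. -/
def error (a : Algorithm.{u} A B d) (p : MarkovProblem d) (oracle : A → p.State → B) (N : ℕ)
    (y : Euc d) : ℝ≥0∞ :=
  ∫⁻ q : a.Seed × p.Ω,
    ENNReal.ofReal (‖a.output N q.1 (a.answers oracle q.1 (fun i => p.Z i q.2) N) - y‖ ^ 2)
    ∂(a.law.prod p.P)

end Algorithm

/-- Algorithms with one-point feedback. -/
abbrev OnePointAlgorithm (d : ℕ) : Type (u + 1) := Algorithm.{u} (Euc d) ℝ d

/-- Algorithms with two-point feedback. -/
abbrev TwoPointAlgorithm (d : ℕ) : Type (u + 1) := Algorithm.{u} (Euc d × Euc d) (ℝ × ℝ) d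

end

/-! The proof reduces optimization to testing. The minimizer is hidden among the points `ρ • signVec
s`, with `s` ranging over the sign vectors. By Assouad's lemma
(`exists_le_lintegral_of_sum_klDiv_le`), for some `s` every estimator errs by at least `ρ² d / 8` in
mean square, provided that the law of the data at each `s` has total Kullback-Leibler divergence at
most `d / 4` from the laws at its `d` neighbours. With `ρ² d` proportional to the accuracy `ε`, the
question is how much `N` answers can reveal. Since `d + τ ≤ 2 max(d, τ)`, one family of instances
for `d` and one for `τ` suffice.

Dimension. The noise is independent and Gaussian, and the chain rule along the transcript bounds the
information by `N` times that of the best single query. With two-point feedback the objective is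
quadratic with a Gaussian linear term. Two values of it see only the projection of the mean to a
plane, and the projections of the `d` basis vectors to a plane have total squared length at most 2
(`sum_klDiv_quad_gauss_le`). With one-point feedback a quadratic is perturbed by sines of scale `e`,
where `e²` is of order `ε / d`. They move the minimizer by order `e` in each coordinate, yet a sign
flip changes no value by more than `2 μ e²`, of order `μ ε / d`.

Mixing. The chain holds its state with probability `1 - p` and otherwise redraws it, with `p ≤ 2 /
τ`. The state consists of `d` coins of bias `η` towards `s`, and the oracle divides the coins by
`η`, so that it does not depend on `s`. Hence even seeing all states is of little use: `N` states
carry the information of about `1 + N p` draws, each of order `η²` per sign (`klDiv_prefixLaw_le`,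
`exists_le_error_coin`). The noise level dictates how small `η` may be.

Uniform noise. The coin instances have bounded noise. What they lose compared with the claimed rate
is a factor depending on `d` and `τ` only, and the logarithm exceeds it for large `N` or small `ε`.
-/

noncomputable section

/-! ### Kullback-Leibler divergence: chain rule, products, tests, Gaussians -/

section Divergence

open InformationTheory

variable {X Y : Type*} [MeasurableSpace X] [MeasurableSpace Y]

section Kernels

variable [MeasurableSpace.CountableOrCountablyGenerated X Y] {κ η : Kernel X Y}
  [IsMarkovKernel κ] [IsMarkovKernel η]

lemma klDiv_kernel_eq_lintegral (hac : ∀ x, κ x ≪ η x) (x : X) :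
    klDiv (κ x) (η x) =
      ∫⁻ y, ENNReal.ofReal (klFun (Kernel.rnDeriv κ η x y).toReal) ∂(η x) := by
  rw [klDiv_eq_lintegral_klFun_of_ac (hac x)]
  refine lintegral_congr_ae ?_
  filter_upwards [Kernel.rnDeriv_eq_rnDeriv_measure (κ := κ) (η := η) (a := x)] with y hy
  rw [hy]

lemma measurable_klDiv_kernel (hac : ∀ x, κ x ≪ η x) :
    Measurable fun x => klDiv (κ x) (η x) := by
  simp_rw [klDiv_kernel_eq_lintegral hac]
  refine Measurable.lintegral_kernel_prod_right' (κ := η)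
    (f := fun p : X × Y => ENNReal.ofReal (klFun (Kernel.rnDeriv κ η p.1 p.2).toReal)) ?_
  exact (measurable_klFun.comp (Kernel.measurable_rnDeriv κ η).ennreal_toReal).ennreal_ofReal

/-- The conditional Kullback-Leibler divergence as an integral. -/
lemma klDiv_compProd_right (μ : Measure X) [IsFiniteMeasure μ] (hac : ∀ x, κ x ≪ η x) :
    klDiv (μ ⊗ₘ κ) (μ ⊗ₘ η) = ∫⁻ x, klDiv (κ x) (η x) ∂μ := by
  have hmeas : Measurable fun p : X × Y => Kernel.rnDeriv κ η p.1 p.2 :=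
    Kernel.measurable_rnDeriv κ η
  have hdens : μ ⊗ₘ κ = (μ ⊗ₘ η).withDensity fun p => Kernel.rnDeriv κ η p.1 p.2 := by
    ext s hs
    rw [Measure.compProd_apply hs, withDensity_apply _ hs, ← lintegral_indicator hs,
      Measure.lintegral_compProd (hmeas.indicator hs)]
    refine lintegral_congr fun x => ?_
    have hx : MeasurableSet (Prod.mk x ⁻¹' s) := measurable_prodMk_left hs
    rw [← Kernel.setLIntegral_rnDeriv (hac x) hx, ← lintegral_indicator hx]
    rfl
  have hrn : (μ ⊗ₘ κ).rnDeriv (μ ⊗ₘ η) =ᵐ[μ ⊗ₘ η] fun p => Kernel.rnDeriv κ η p.1 p.2 := by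
    rw [hdens]
    exact Measure.rnDeriv_withDensity _ hmeas
  rw [klDiv_eq_lintegral_klFun_of_ac
    (Measure.AbsolutelyContinuous.compProd_right (ae_of_all _ hac))]
  calc ∫⁻ p, ENNReal.ofReal (klFun ((μ ⊗ₘ κ).rnDeriv (μ ⊗ₘ η) p).toReal) ∂(μ ⊗ₘ η)
      = ∫⁻ p, ENNReal.ofReal (klFun (Kernel.rnDeriv κ η p.1 p.2).toReal) ∂(μ ⊗ₘ η) := by
        refine lintegral_congr_ae ?_
        filter_upwards [hrn] with p hp
        rw [hp]
    _ = ∫⁻ x, klDiv (κ x) (η x) ∂μ := by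
        have hm : Measurable fun p : X × Y =>
            ENNReal.ofReal (klFun (Kernel.rnDeriv κ η p.1 p.2).toReal) :=
          (measurable_klFun.comp hmeas.ennreal_toReal).ennreal_ofReal
        rw [Measure.lintegral_compProd hm]
        exact lintegral_congr fun x => (klDiv_kernel_eq_lintegral hac x).symm

/-- The chain rule for the Kullback-Leibler divergence in integral form. -/
lemma klDiv_compProd_eq_add_lintegral (μ ν : Measure X) [IsFiniteMeasure μ] [IsFiniteMeasure ν]
    (hac : ∀ x, κ x ≪ η x) :
    klDiv (μ ⊗ₘ κ) (ν ⊗ₘ η) = klDiv μ ν + ∫⁻ x, klDiv (κ x) (η x) ∂μ := by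
  rw [klDiv_compProd_eq_add, klDiv_compProd_right μ hac]

end Kernels

lemma absolutelyContinuous_of_klDiv_ne_top {μ ν : Measure X} (h : klDiv μ ν ≠ ∞) : μ ≪ ν :=
  (klDiv_ne_top_iff.1 h).1

/-- In the chain rule the conditional term compares two products with the same first factor.
Swapping the factors makes the common one a common kernel, which contributes no divergence. -/
lemma klDiv_prod_le (μ ν : Measure X) (μ' ν' : Measure Y) [IsProbabilityMeasure μ]
    [IsProbabilityMeasure ν] [IsProbabilityMeasure μ'] [IsProbabilityMeasure ν'] :
    klDiv (μ.prod μ') (ν.prod ν') ≤ klDiv μ ν + klDiv μ' ν' := by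
  rw [← Measure.compProd_const, ← Measure.compProd_const, klDiv_compProd_eq_add,
    Measure.compProd_const, Measure.compProd_const]
  gcongr
  calc klDiv (μ.prod μ') (μ.prod ν')
      = klDiv ((μ'.prod μ).map Prod.swap) ((ν'.prod μ).map Prod.swap) := by
        rw [Measure.prod_swap, Measure.prod_swap]
    _ ≤ klDiv (μ'.prod μ) (ν'.prod μ) := klDiv_map_le _ _ measurable_swap
    _ = klDiv μ' ν' := by
        rw [← Measure.compProd_const, ← Measure.compProd_const, klDiv_compProd_left]

lemma klDiv_pi_le {X : Type*} [MeasurableSpace X] {d : ℕ} (P Q : Fin d → Measure X)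
    [∀ i, IsProbabilityMeasure (P i)] [∀ i, IsProbabilityMeasure (Q i)] :
    klDiv (Measure.pi P) (Measure.pi Q) ≤ ∑ i, klDiv (P i) (Q i) := by
  induction d with
  | zero =>
    rw [Measure.pi_of_empty P, Measure.pi_of_empty Q, klDiv_self]
    exact zero_le
  | succ d ih =>
    have hP := (measurePreserving_piFinSuccAbove P 0).symm
    have hQ := (measurePreserving_piFinSuccAbove Q 0).symm
    rw [← hP.map_eq, ← hQ.map_eq, Fin.sum_univ_succ]
    refine (klDiv_map_le _ _ (MeasurableEquiv.measurable _)).trans ((klDiv_prod_le _ _ _ _).trans ?_)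
    gcongr
    exact ih (fun i => P (Fin.succ i)) (fun i => Q (Fin.succ i))

/-- The two error probabilities of a test between `P` and `Q` are bounded below in terms of the
Kullback-Leibler divergence. -/
lemma half_le_add_klDiv (P Q : Measure X) [IsProbabilityMeasure P] [IsProbabilityMeasure Q]
    {A : Set X} (hA : MeasurableSet A) : 1 / 2 ≤ P A + Q Aᶜ + klDiv P Q := by
  by_cases hac : P ≪ Q
  swap
  · rw [klDiv_of_not_ac hac]; simp
  -- Fenchel-Young inequality `x y ≤ klFun x + exp y - 1` at `y = log 2`. Applied to the density of
  -- `P` and integrated over `Aᶜ`, it bounds `P Aᶜ` by `Q Aᶜ` and the divergence.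
  have hfen : ∀ x : ℝ, 0 ≤ x → x * Real.log 2 ≤ klFun x + 1 := by
    intro x hx
    rcases hx.eq_or_lt with rfl | hx
    · simp [klFun_zero]
    have h := Real.add_one_le_exp (Real.log 2 - Real.log x)
    rw [Real.exp_sub, Real.exp_log two_pos, Real.exp_log hx, le_div_iff₀ hx] at h
    rw [klFun_apply]
    linarith
  have hlog : (1 / 2 : ℝ) ≤ Real.log 2 := by linarith [Real.log_two_gt_d9]
  have hkey : ENNReal.ofReal (1 / 2) * P Aᶜ ≤ klDiv P Q + Q Aᶜ := by
    calc ENNReal.ofReal (1 / 2) * P Aᶜ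
        = ∫⁻ x in Aᶜ, ENNReal.ofReal (1 / 2) * P.rnDeriv Q x ∂Q := by
          rw [lintegral_const_mul _ (Measure.measurable_rnDeriv P Q),
            Measure.setLIntegral_rnDeriv hac]
      _ ≤ ∫⁻ x in Aᶜ, (ENNReal.ofReal (klFun (P.rnDeriv Q x).toReal) + 1) ∂Q := by
          refine lintegral_mono_ae (ae_restrict_of_ae ?_)
          filter_upwards [P.rnDeriv_ne_top Q] with x hx
          rw [← ENNReal.ofReal_one, ← ENNReal.ofReal_add (klFun_nonneg ENNReal.toReal_nonneg)
            zero_le_one]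
          conv_lhs => rw [← ENNReal.ofReal_toReal hx]
          rw [← ENNReal.ofReal_mul (by norm_num)]
          refine ENNReal.ofReal_le_ofReal ?_
          have h0 : 0 ≤ (P.rnDeriv Q x).toReal := ENNReal.toReal_nonneg
          nlinarith [hfen _ h0]
      _ ≤ klDiv P Q + Q Aᶜ := by
          rw [lintegral_add_right _ measurable_const, setLIntegral_one,
            klDiv_eq_lintegral_klFun_of_ac hac]
          gcongr
          exact Measure.restrict_le_self
  have hone : P A + P Aᶜ = 1 := by rw [measure_add_measure_compl hA, measure_univ]
  have hhalf : ENNReal.ofReal (1 / 2) = 1 / 2 := by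
    rw [ENNReal.ofReal_div_of_pos two_pos]; simp
  rw [hhalf] at hkey
  have hh : (1 / 2 : ℝ≥0∞) ≤ 1 := by
    rw [← hhalf]; exact ENNReal.ofReal_le_one.2 (by norm_num)
  calc (1 / 2 : ℝ≥0∞) = 1 / 2 * (P A + P Aᶜ) := by rw [hone, mul_one]
    _ = 1 / 2 * P A + 1 / 2 * P Aᶜ := mul_add _ _ _
    _ ≤ 1 * P A + (klDiv P Q + Q Aᶜ) := by gcongr
    _ = P A + Q Aᶜ + klDiv P Q := by rw [one_mul, add_comm (klDiv P Q), add_assoc]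

/-- For equal variances the log-likelihood ratio is affine in `x`, so its expectation needs only the
mean. -/
lemma klDiv_gaussianReal_le (m m' : ℝ) {v : NNReal} (hv : v ≠ 0) :
    klDiv (gaussianReal m v) (gaussianReal m' v) ≤ ENNReal.ofReal ((m - m') ^ 2 / (2 * v)) := by
  have hv' : (0 : ℝ) < v := by positivity
  have hac : gaussianReal m v ≪ gaussianReal m' v :=
    (gaussianReal_absolutelyContinuous m hv).trans (gaussianReal_absolutelyContinuous' m' hv)
  have hllr : llr (gaussianReal m v) (gaussianReal m' v) =ᵐ[gaussianReal m v]
      fun x => ((x - m') ^ 2 - (x - m) ^ 2) / (2 * v) := by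
    have h1 : (gaussianReal m v).rnDeriv (gaussianReal m' v) =ᵐ[volume]
        fun x => (gaussianPDF m' v x)⁻¹ * gaussianPDF m v x := by
      have h := Measure.rnDeriv_withDensity_right (gaussianReal m v) volume
        (f := gaussianPDF m' v) (measurable_gaussianPDF m' v).aemeasurable
        (ae_of_all _ fun x => (gaussianPDF_pos m' hv x).ne')
        (ae_of_all _ fun x => gaussianPDF_ne_top)
      rw [← gaussianReal_of_var_ne_zero m' hv] at h
      filter_upwards [h, rnDeriv_gaussianReal m v] with x hx hx'
      rw [hx, hx']
    filter_upwards [(gaussianReal_absolutelyContinuous m hv).ae_le h1] with x hx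
    have hp := gaussianPDFReal_pos m v x hv
    have hp' := gaussianPDFReal_pos m' v x hv
    have hc : (0 : ℝ) < (√(2 * Real.pi * v))⁻¹ := by positivity
    rw [llr, hx, ENNReal.toReal_mul, ENNReal.toReal_inv, toReal_gaussianPDF, toReal_gaussianPDF,
      Real.log_mul (by positivity) hp.ne', Real.log_inv, gaussianPDFReal, gaussianPDFReal,
      Real.log_mul hc.ne' (Real.exp_pos _).ne', Real.log_mul hc.ne' (Real.exp_pos _).ne',
      Real.log_exp, Real.log_exp]
    field_simp
    ring
  have hlin : (fun x : ℝ => ((x - m') ^ 2 - (x - m) ^ 2) / (2 * v)) =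
      fun x => (m - m') / v * x + (m' ^ 2 - m ^ 2) / (2 * v) := by
    ext x; field_simp; ring
  have hid : Integrable (fun x : ℝ => x) (gaussianReal m v) :=
    (memLp_id_gaussianReal 1).integrable le_rfl
  have hint : Integrable (llr (gaussianReal m v) (gaussianReal m' v)) (gaussianReal m v) := by
    rw [integrable_congr hllr, hlin]
    exact (hid.const_mul _).add (integrable_const _)
  rw [klDiv_of_ac_of_integrable hac hint, integral_congr_ae hllr, hlin,
    integral_add (hid.const_mul _) (integrable_const _), integral_const_mul,
    integral_id_gaussianReal]
  refine ENNReal.ofReal_le_ofReal (le_of_eq ?_)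
  simp
  field_simp
  ring

end Divergence

/-! ### The sticky chain: mixing time and information in its path -/

section StickyChain

open InformationTheory

variable {S : Type*} [MeasurableSpace S]

/-- The transition kernel which holds the current state with probability `1 - p` and draws a new
one from `π` with probability `p`. -/
def stickyKernel (π : Measure S) (p : unitInterval) : Kernel S S where
  toFun z := ENNReal.ofReal (1 - (p : ℝ)) • Measure.dirac z + ENNReal.ofReal (p : ℝ) • π
  measurable' := by
    refine Measure.measurable_of_measurable_coe _ fun s hs => ?_
    simp only [Measure.coe_add, Measure.coe_smul, Pi.add_apply, Pi.smul_apply, smul_eq_mul]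
    exact ((Measure.measurable_coe hs).comp Measure.measurable_dirac).const_mul _ |>.add_const _

lemma stickyKernel_apply (π : Measure S) (p : unitInterval) (z : S) :
    stickyKernel π p z =
      ENNReal.ofReal (1 - (p : ℝ)) • Measure.dirac z + ENNReal.ofReal (p : ℝ) • π := rfl

lemma ofReal_one_sub_add {p : ℝ} (h0 : 0 ≤ p) (h1 : p ≤ 1) :
    ENNReal.ofReal (1 - p) + ENNReal.ofReal p = 1 := by
  rw [← ENNReal.ofReal_add (by linarith) h0]; simp

instance (π : Measure S) [IsProbabilityMeasure π] (p : unitInterval) :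
    IsMarkovKernel (stickyKernel π p) :=
  ⟨fun z => ⟨by simp [stickyKernel_apply, ofReal_one_sub_add p.2.1 p.2.2]⟩⟩

lemma stickyKernel_one (π : Measure S) : stickyKernel π 1 = Kernel.const S π := by
  ext z : 1
  simp [stickyKernel_apply]

lemma bind_stickyKernel (π ν : Measure S) [IsProbabilityMeasure ν] (p : unitInterval) :
    ν.bind (stickyKernel π p) =
      ENNReal.ofReal (1 - (p : ℝ)) • ν + ENNReal.ofReal (p : ℝ) • π := by
  ext s hs
  rw [Measure.bind_apply hs (Kernel.aemeasurable _)]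
  simp only [stickyKernel_apply, Measure.coe_add, Measure.coe_smul, Pi.add_apply, Pi.smul_apply,
    smul_eq_mul]
  have hm : Measurable fun z : S => Measure.dirac z s :=
    (Measure.measurable_coe hs).comp Measure.measurable_dirac
  rw [lintegral_add_right _ measurable_const, lintegral_const_mul _ hm, lintegral_const,
    measure_univ, mul_one]
  congr 2
  simp_rw [Measure.dirac_apply' _ hs]
  rw [lintegral_indicator_one hs]

lemma stickyKernel_invariant (π : Measure S) [IsProbabilityMeasure π] (p : unitInterval) :
    (stickyKernel π p).Invariant π := by
  rw [Kernel.Invariant, bind_stickyKernel, ← add_smul, ofReal_one_sub_add p.2.1 p.2.2, one_smul]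

lemma stickyKernel_invariant_unique (π ν : Measure S) [IsProbabilityMeasure π]
    [IsProbabilityMeasure ν] (p : unitInterval) (hp : 0 < p)
    (hν : (stickyKernel π p).Invariant ν) : ν = π := by
  rw [Kernel.Invariant, bind_stickyKernel] at hν
  have hp0 : ENNReal.ofReal (p : ℝ) ≠ 0 := by
    rw [Ne, ENNReal.ofReal_eq_zero, not_le]; exact hp
  ext s hs
  have h := congrArg (fun m : Measure S => m s) hν
  simp only [Measure.coe_add, Measure.coe_smul, Pi.add_apply, Pi.smul_apply, smul_eq_mul] at h
  have h1 : ν s = ENNReal.ofReal (1 - (p : ℝ)) * ν s + ENNReal.ofReal (p : ℝ) * ν s := by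
    rw [← add_mul, ofReal_one_sub_add p.2.1 p.2.2, one_mul]
  have h2 := h.trans h1
  rw [ENNReal.add_right_inj (ENNReal.mul_ne_top ENNReal.ofReal_ne_top (measure_ne_top _ _)),
    ENNReal.mul_right_inj hp0 ENNReal.ofReal_ne_top] at h2
  exact h2.symm

/-- After `k` steps either no refresh has happened, with probability `(1 - p)^k`, or the state is a
draw from `π` that has forgotten `z`. Only the first part distinguishes starting points, whence the
Dobrushin bound. -/
lemma stickyKernel_pow_apply (π : Measure S) [IsProbabilityMeasure π] (p : unitInterval) (k : ℕ)
    (z : S) :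
    (stickyKernel π p ^ k) z =
      ENNReal.ofReal ((1 - (p : ℝ)) ^ k) • Measure.dirac z +
        ENNReal.ofReal (1 - (1 - (p : ℝ)) ^ k) • π := by
  have hp0 : 0 ≤ 1 - (p : ℝ) := by linarith [p.2.2]
  have hp1 : 1 - (p : ℝ) ≤ 1 := by linarith [p.2.1]
  induction k with
  | zero =>
    rw [pow_zero]
    change Kernel.id z = _
    simp [Kernel.id_apply]
  | succ k ih =>
    have hprob : IsProbabilityMeasure ((stickyKernel π p ^ k) z) := by
      rw [ih]
      refine ⟨?_⟩
      have := ofReal_one_sub_add (p := (1 - (p : ℝ)) ^ k) (pow_nonneg hp0 k)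
        (pow_le_one₀ hp0 hp1)
      simp only [Measure.coe_add, Measure.coe_smul, Pi.add_apply, Pi.smul_apply, measure_univ,
        smul_eq_mul, mul_one]
      rwa [add_comm]
    have hb : (stickyKernel π p ^ (k + 1)) z =
        ((stickyKernel π p ^ k) z).bind (stickyKernel π p) := by
      ext s hs
      rw [Kernel.pow_succ_apply_eq_lintegral _ _ _ hs,
        Measure.bind_apply hs (Kernel.aemeasurable _)]
    have hk0 := pow_nonneg hp0 k
    have hk1 := pow_le_one₀ (n := k) hp0 hp1
    rw [hb, bind_stickyKernel, ih, smul_add, smul_smul, smul_smul, add_assoc, ← add_smul,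
      ← ENNReal.ofReal_mul hp0, ← ENNReal.ofReal_mul hp0, ← ENNReal.ofReal_add
        (mul_nonneg hp0 (by linarith)) p.2.1]
    congr 3 <;> ring

lemma dobrushin_stickyKernel_pow_le (π : Measure S) [IsProbabilityMeasure π] (p : unitInterval)
    (k : ℕ) : dobrushin (stickyKernel π p ^ k) ≤ ENNReal.ofReal ((1 - (p : ℝ)) ^ k) := by
  have hk0 : 0 ≤ (1 - (p : ℝ)) ^ k := pow_nonneg (by linarith [p.2.2]) k
  have hreal : ∀ (z : S) (A : Set S), MeasurableSet A → ((stickyKernel π p ^ k) z).real A =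
      (1 - (p : ℝ)) ^ k * A.indicator 1 z +
        (ENNReal.ofReal (1 - (1 - (p : ℝ)) ^ k) * π A).toReal := by
    intro z A hA
    rw [stickyKernel_pow_apply, Measure.real]
    simp only [Measure.coe_add, Measure.coe_smul, Pi.add_apply, Pi.smul_apply, smul_eq_mul]
    rw [ENNReal.toReal_add (ENNReal.mul_ne_top ENNReal.ofReal_ne_top (measure_ne_top _ _))
      (ENNReal.mul_ne_top ENNReal.ofReal_ne_top (measure_ne_top _ _)),
      ENNReal.toReal_mul, ENNReal.toReal_ofReal hk0, Measure.dirac_apply' _ hA]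
    congr 2
    by_cases h : z ∈ A <;> simp [h]
  refine iSup_le fun z => iSup_le fun z' => iSup_le fun A => iSup_le fun hA =>
    ENNReal.ofReal_le_ofReal ?_
  rw [hreal z A hA, hreal z' A hA, add_sub_add_right_eq_sub, ← mul_sub, abs_mul, abs_of_nonneg hk0]
  refine mul_le_of_le_one_right hk0 ?_
  by_cases h : z ∈ A <;> by_cases h' : z' ∈ A <;> simp [h, h']

/-- The law of the Markov chain with initial distribution `π` and transition kernel `Q`. -/
def chainLaw (π : Measure S) (Q : Kernel S S) [IsMarkovKernel Q] : Measure (ℕ → S) :=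
  Kernel.trajMeasure (X := fun _ => S) π fun n =>
    Q.comap (fun h : (Finset.Iic n → S) => h ⟨n, Finset.mem_Iic.2 le_rfl⟩) (measurable_pi_apply _)

instance (π : Measure S) [IsProbabilityMeasure π] (Q : Kernel S S) [IsMarkovKernel Q] :
    IsProbabilityMeasure (chainLaw π Q) := by
  unfold chainLaw; infer_instance

lemma map_compProd_comap {X Y Z : Type*} [MeasurableSpace X] [MeasurableSpace Y]
    [MeasurableSpace Z] (μ : Measure X) [SFinite μ] (κ : Kernel Y Z) [IsSFiniteKernel κ]
    {g : X → Y} (hg : Measurable g) :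
    (μ ⊗ₘ κ.comap g hg).map (Prod.map g id) = μ.map g ⊗ₘ κ := by
  ext s hs
  have hm : Measurable (Prod.map g (id : Z → Z)) := hg.prodMap measurable_id
  rw [Measure.map_apply hm hs, Measure.compProd_apply (hm hs), Measure.compProd_apply hs,
    lintegral_map (Kernel.measurable_kernel_prodMk_left hs) hg]
  rfl

lemma chainLaw_map_zero (π : Measure S) [IsProbabilityMeasure π] (Q : Kernel S S)
    [IsMarkovKernel Q] : (chainLaw π Q).map (fun ω => ω 0) = π := by
  have h0 : (chainLaw π Q).map (Preorder.frestrictLe (π := fun _ => S) 0) =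
      π.map (MeasurableEquiv.piUnique fun _ : Finset.Iic 0 => S).symm := by
    unfold chainLaw Kernel.trajMeasure
    rw [Measure.map_comp _ _ (by fun_prop), Kernel.traj_map_frestrictLe, Kernel.partialTraj_self,
      Measure.id_comp]
  have h1 : (fun ω : ℕ → S => ω 0) =
      (fun h : Finset.Iic 0 → S => h ⟨0, Finset.mem_Iic.2 le_rfl⟩) ∘
        Preorder.frestrictLe (π := fun _ => S) 0 := rfl
  rw [h1, ← Measure.map_map (measurable_pi_apply _) (by fun_prop), h0,
    Measure.map_map (measurable_pi_apply _) (by fun_prop)]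
  exact Measure.map_id

lemma chainLaw_markov (π : Measure S) [IsProbabilityMeasure π] (Q : Kernel S S)
    [IsMarkovKernel Q] (n : ℕ) :
    (chainLaw π Q).map (fun ω => ((fun i : Fin (n + 1) => ω i), ω (n + 1))) =
      ((chainLaw π Q).map fun ω => fun i : Fin (n + 1) => ω i) ⊗ₘ
        (Q.comap (fun h : Fin (n + 1) → S => h (Fin.last n)) (measurable_pi_apply _)) := by
  let g : (Finset.Iic n → S) → (Fin (n + 1) → S) :=
    fun h i => h ⟨i, Finset.mem_Iic.2 (Nat.lt_succ_iff.1 i.2)⟩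
  have hg : Measurable g := measurable_pi_lambda _ fun i => measurable_pi_apply _
  have h := Kernel.map_frestrictLe_trajMeasure_compProd_eq_map_trajMeasure
    (X := fun _ => S) (μ₀ := π) (a := n) (κ := fun n => Q.comap
      (fun h : (Finset.Iic n → S) => h ⟨n, Finset.mem_Iic.2 le_rfl⟩) (measurable_pi_apply _))
  change (chainLaw π Q).map _ ⊗ₘ _ = (chainLaw π Q).map _ at h
  have h1 : (fun ω : ℕ → S => ((fun i : Fin (n + 1) => ω i), ω (n + 1))) =
      Prod.map g id ∘ fun ω => (Preorder.frestrictLe (π := fun _ => S) n ω, ω (n + 1)) := rfl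
  have h2 : (fun ω : ℕ → S => fun i : Fin (n + 1) => ω i) =
      g ∘ Preorder.frestrictLe (π := fun _ => S) n := rfl
  rw [h1, ← Measure.map_map (hg.prodMap measurable_id) (by fun_prop), ← h, h2,
    ← Measure.map_map hg (by fun_prop), ← map_compProd_comap _ _ hg]
  rfl

/-- Contraction by `1 / 4` over one block of length `τ` is enough, since `k` steps contain `k / τ`
full blocks. -/
lemma isMixingChain_sticky (π : Measure S) [IsProbabilityMeasure π] (p : unitInterval) (τ : ℕ)
    (hp : 0 < p) (hτ : (1 - (p : ℝ)) ^ τ ≤ 1 / 4) :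
    IsMixingChain (stickyKernel π p) π (chainLaw π (stickyKernel π p)) (fun n ω => ω n) τ where
  measurable n := measurable_pi_apply n
  law_zero := chainLaw_map_zero π _
  markov n := chainLaw_markov π _ n
  invariant := stickyKernel_invariant π p
  unique ν _ hν := stickyKernel_invariant_unique π ν p hp hν
  mixing k := by
    have hp0 : 0 ≤ 1 - (p : ℝ) := by linarith [p.2.2]
    have hp1 : 1 - (p : ℝ) ≤ 1 := by linarith [p.2.1]
    refine (dobrushin_stickyKernel_pow_le π p k).trans (ENNReal.ofReal_le_ofReal ?_)
    calc (1 - (p : ℝ)) ^ k ≤ (1 - (p : ℝ)) ^ (τ * (k / τ)) :=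
          pow_le_pow_of_le_one hp0 hp1 (Nat.mul_div_le k τ)
      _ = ((1 - (p : ℝ)) ^ τ) ^ (k / τ) := pow_mul _ _ _
      _ ≤ (1 / 4 : ℝ) ^ (k / τ) := pow_le_pow_left₀ (pow_nonneg hp0 _) hτ _

lemma measurable_snoc {n : ℕ} :
    Measurable fun q : (Fin n → S) × S => (Fin.snoc (α := fun _ => S) q.1 q.2 : Fin (n + 1) → S) := by
  refine measurable_pi_lambda _ fun i => ?_
  refine Fin.lastCases ?_ (fun j => ?_) i
  · simpa using measurable_snd
  · simp only [Fin.snoc_castSucc]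
    exact (measurable_pi_apply j).comp measurable_fst

variable {Ω Ω' : Type*} [MeasurableSpace Ω] [MeasurableSpace Ω']

/-- The law of the first `n` states. -/
def prefixLaw (P : Measure Ω) (Z : ℕ → Ω → S) (n : ℕ) : Measure (Fin n → S) :=
  P.map fun ω (i : Fin n) => Z i ω


lemma snoc_prefix {T U : Type*} (Z : ℕ → U → T) (n : ℕ) (ω : U) :
    (Fin.snoc (α := fun _ => T) (fun i : Fin n => Z i ω) (Z n ω) : Fin (n + 1) → T) =
      fun i : Fin (n + 1) => Z i ω := by
  ext i
  refine Fin.lastCases ?_ (fun j => ?_) i <;> simp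

section

variable {Q : Kernel S S} {π : Measure S} {P : Measure Ω} {Z : ℕ → Ω → S} {τ : ℕ}

lemma IsMixingChain.measurable_prefix (h : IsMixingChain Q π P Z τ) (n : ℕ) :
    Measurable fun ω => fun i : Fin n => Z i ω :=
  measurable_pi_lambda _ fun i => h.measurable i

lemma IsMixingChain.prefixLaw_succ (h : IsMixingChain Q π P Z τ) (n : ℕ) :
    prefixLaw P Z (n + 2) = ((prefixLaw P Z (n + 1)) ⊗ₘ
      (Q.comap (fun h : Fin (n + 1) → S => h (Fin.last n)) (measurable_pi_apply _))).map
        fun q => (Fin.snoc (α := fun _ => S) q.1 q.2 : Fin (n + 2) → S) := by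
  unfold prefixLaw
  rw [← h.markov n, Measure.map_map measurable_snoc
    ((h.measurable_prefix (n + 1)).prodMk (h.measurable (n + 1)))]
  congr 1
  ext1 ω
  exact (snoc_prefix Z (n + 1) ω).symm

lemma IsMixingChain.prefixLaw_one (h : IsMixingChain Q π P Z τ) :
    prefixLaw P Z 1 = π.map fun z (_ : Fin 1) => z := by
  unfold prefixLaw
  have hm : Measurable fun (z : S) (_ : Fin 1) => z := measurable_pi_lambda _ fun _ => measurable_id
  rw [← h.law_zero, Measure.map_map hm (h.measurable 0)]
  congr 1
  ext ω i
  simp [Fin.fin_one_eq_zero i]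

/-- If the kernel ignores the current state, the next state is independent of the past. -/
lemma IsMixingChain.map_prefix_prod [IsProbabilityMeasure π] [IsProbabilityMeasure P]
    (h : IsMixingChain (stickyKernel π 1) π P Z τ) (n : ℕ) :
    P.map (fun ω => ((fun i : Fin n => Z i ω), Z n ω)) = (prefixLaw P Z n).prod π := by
  cases n with
  | zero =>
    have hc : (fun ω => ((fun i : Fin 0 => Z i ω), Z 0 ω)) =
        Prod.mk (fun i : Fin 0 => i.elim0) ∘ Z 0 := by
      ext ω : 1
      exact Prod.ext (Subsingleton.elim _ _) rfl
    have hd : prefixLaw P Z 0 = Measure.dirac fun i : Fin 0 => i.elim0 := by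
      unfold prefixLaw
      have : (fun ω => fun i : Fin 0 => Z i ω) = fun _ => fun i : Fin 0 => i.elim0 := by
        ext ω i; exact i.elim0
      rw [this, Measure.map_const, measure_univ, one_smul]
    rw [hc, ← Measure.map_map measurable_prodMk_left (h.measurable 0), h.law_zero, hd,
      Measure.dirac_prod]
  | succ n =>
    have hs : SFinite (prefixLaw P Z (n + 1)) := by unfold prefixLaw; infer_instance
    rw [h.markov n, ← Measure.compProd_const]
    unfold prefixLaw
    congr 1
    rw [stickyKernel_one]
    rfl

end

/-- A transition is the second component of a pair: a hidden bit deciding whether to refresh, then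
the new state. Revealing the bit can only increase the divergence, and only the refresh branch, of
probability `p`, then contributes. -/
lemma klDiv_stickyKernel_le [MeasurableSpace.CountablyGenerated S] (π π' : Measure S)
    [IsProbabilityMeasure π] [IsProbabilityMeasure π'] (hac : π ≪ π') (p : unitInterval) (z : S) :
    klDiv (stickyKernel π p z) (stickyKernel π' p z) ≤
      ENNReal.ofReal (p : ℝ) * klDiv π π' := by
  let m : Measure Bool := ENNReal.ofReal (1 - (p : ℝ)) • Measure.dirac false +
    ENNReal.ofReal (p : ℝ) • Measure.dirac true
  have hm : IsProbabilityMeasure m :=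
    ⟨by simp [m, ofReal_one_sub_add p.2.1 p.2.2]⟩
  let κ : Measure S → Kernel Bool S := fun ρ =>
    ⟨fun b => if b then ρ else Measure.dirac z, measurable_of_countable _⟩
  have hκ : ∀ ρ : Measure S, IsProbabilityMeasure ρ → IsMarkovKernel (κ ρ) := by
    intro ρ hρ
    refine ⟨fun b => ?_⟩
    cases b
    · change IsProbabilityMeasure (Measure.dirac z); infer_instance
    · exact hρ
  have hsnd : ∀ ρ : Measure S, IsProbabilityMeasure ρ →
      stickyKernel ρ p z = (m ⊗ₘ κ ρ).map Prod.snd := by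
    intro ρ hρ
    have := hκ ρ hρ
    ext s hs
    rw [Measure.map_apply measurable_snd hs, Measure.compProd_apply (measurable_snd hs),
      stickyKernel_apply]
    simp only [m]
    rw [lintegral_add_measure, lintegral_smul_measure, lintegral_smul_measure, lintegral_dirac,
      lintegral_dirac]
    rfl
  have i1 := hκ π inferInstance
  have i2 := hκ π' inferInstance
  have hac' : ∀ b, κ π b ≪ κ π' b := by
    intro b
    cases b
    · exact Measure.AbsolutelyContinuous.rfl
    · exact hac
  rw [hsnd π inferInstance, hsnd π' inferInstance]
  refine (klDiv_map_le _ _ measurable_snd).trans ?_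
  rw [klDiv_compProd_right m hac']
  simp only [m]
  rw [lintegral_add_measure, lintegral_smul_measure, lintegral_smul_measure, lintegral_dirac,
    lintegral_dirac]
  have h1 : klDiv (κ π false) (κ π' false) = 0 := klDiv_self _
  rw [h1, smul_zero, zero_add]
  rfl

/-- The information on the transition law contained in the first `N` states. -/
lemma klDiv_prefixLaw_le [MeasurableSpace.CountablyGenerated S] {π π' : Measure S}
    [IsProbabilityMeasure π] [IsProbabilityMeasure π'] (hac : π ≪ π') {p : unitInterval}
    {P : Measure Ω} {P' : Measure Ω'} [IsProbabilityMeasure P] [IsProbabilityMeasure P']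
    {Z : ℕ → Ω → S} {Z' : ℕ → Ω' → S} {τ τ' : ℕ}
    (h : IsMixingChain (stickyKernel π p) π P Z τ)
    (h' : IsMixingChain (stickyKernel π' p) π' P' Z' τ') (N : ℕ) :
    klDiv (prefixLaw P Z N) (prefixLaw P' Z' N) ≤
      ENNReal.ofReal (1 + N * (p : ℝ)) * klDiv π π' := by
  have hprob : ∀ n, IsProbabilityMeasure (prefixLaw P Z n) := fun n =>
    Measure.isProbabilityMeasure_map (h.measurable_prefix n).aemeasurable
  have hprob' : ∀ n, IsProbabilityMeasure (prefixLaw P' Z' n) := fun n =>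
    Measure.isProbabilityMeasure_map (h'.measurable_prefix n).aemeasurable
  have hp : 0 ≤ (p : ℝ) := p.2.1
  -- Among `n + 1` states the initial draw costs one full divergence and each of the `n` transitions
  -- at most a fraction `p` of it. The stated bound for `N = n + 1` states rounds `n` up to `N`.
  have hsucc : ∀ n, klDiv (prefixLaw P Z (n + 1)) (prefixLaw P' Z' (n + 1)) ≤
      ENNReal.ofReal (1 + n * (p : ℝ)) * klDiv π π' := by
    intro n
    induction n with
    | zero =>
      rw [h.prefixLaw_one, h'.prefixLaw_one]
      simpa using klDiv_map_le π π' (measurable_pi_lambda _ fun _ => measurable_id)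
    | succ n ih =>
      rw [h.prefixLaw_succ, h'.prefixLaw_succ]
      refine (klDiv_map_le _ _ measurable_snoc).trans ?_
      have hac' : ∀ z : S, stickyKernel π p z ≪ stickyKernel π' p z := by
        intro z
        rw [stickyKernel_apply, stickyKernel_apply]
        refine Measure.AbsolutelyContinuous.mk fun s _ hs => ?_
        simp only [Measure.coe_add, Measure.coe_smul, Pi.add_apply, Pi.smul_apply, smul_eq_mul,
          add_eq_zero, mul_eq_zero] at hs ⊢
        exact ⟨hs.1, hs.2.imp_right fun h => hac h⟩
      rw [klDiv_compProd_eq_add_lintegral _ _ (fun w => by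
        rw [Kernel.comap_apply, Kernel.comap_apply]; exact hac' _)]
      calc _ ≤ ENNReal.ofReal (1 + n * (p : ℝ)) * klDiv π π' +
            ∫⁻ _, ENNReal.ofReal (p : ℝ) * klDiv π π' ∂(prefixLaw P Z (n + 1)) := by
            gcongr with w
            rw [Kernel.comap_apply, Kernel.comap_apply]
            exact klDiv_stickyKernel_le π π' hac p _
        _ = ENNReal.ofReal (1 + (n + 1 : ℕ) * (p : ℝ)) * klDiv π π' := by
            rw [lintegral_const, measure_univ, mul_one, ← add_mul,
              ← ENNReal.ofReal_add (by positivity) hp]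
            congr 2
            push_cast; ring
  cases N with
  | zero =>
    have : prefixLaw P Z 0 = prefixLaw P' Z' 0 := by
      have h0 : ∀ μ : Measure (Fin 0 → S), IsProbabilityMeasure μ →
          μ = Measure.dirac fun i => i.elim0 := by
        intro μ hμ
        ext s hs
        rcases Set.eq_empty_or_nonempty s with rfl | hne
        · simp
        · rw [Subsingleton.eq_univ_of_nonempty hne]; simp
      rw [h0 _ (hprob 0), h0 _ (hprob' 0)]
    rw [this, klDiv_self]
    exact zero_le
  | succ n =>
    refine (hsucc n).trans ?_
    gcongr
    simp

end StickyChain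

/-! ### Interaction of an algorithm with the noise -/

section Transcripts

open InformationTheory

/-- A single round of interaction: when the noise is independent of the history, appending the
answer is composition with a kernel that sees the history only through the query. This is the form
to which the chain rule applies. -/
lemma map_prod_eq_compProd_comap {H A B S : Type*} [MeasurableSpace H] [MeasurableSpace A]
    [MeasurableSpace B] [MeasurableSpace S] (ν : Measure H) (π : Measure S) [SFinite ν]
    [SFinite π] {O : A → S → B} (hO : Measurable (Function.uncurry O)) (K : Kernel A B)
    [IsSFiniteKernel K] (hK : ∀ x, K x = π.map (O x)) {q : H → A} (hq : Measurable q) :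
    (ν.prod π).map (fun w => (w.1, O (q w.1) w.2)) = ν ⊗ₘ K.comap q hq := by
  have hm : Measurable fun w : H × S => (w.1, O (q w.1) w.2) :=
    measurable_fst.prodMk (hO.comp ((hq.comp measurable_fst).prodMk measurable_snd))
  ext s hs
  rw [Measure.map_apply hm hs, Measure.prod_apply (hm hs), Measure.compProd_apply hs]
  refine lintegral_congr fun h => ?_
  have hOh : Measurable (O (q h)) := hO.comp measurable_prodMk_left
  rw [Kernel.comap_apply, hK, Measure.map_apply hOh (measurable_prodMk_left hs)]
  rfl

namespace Algorithm

variable {A B : Type} [MeasurableSpace A] [MeasurableSpace B] {d : ℕ}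

section

variable {S : Type} (a : Algorithm.{u} A B d) (O : A → S → B)

lemma answers_congr (r : a.Seed) {z z' : ℕ → S} (n : ℕ) (h : ∀ i < n, z i = z' i) :
    a.answers O r z n = a.answers O r z' n := by
  induction n with
  | zero => rfl
  | succ n ih =>
    have hn := ih fun i hi => h i (Nat.lt_succ_of_lt hi)
    simp only [answers, hn, h n (Nat.lt_succ_self n)]

lemma measurable_answers [MeasurableSpace S] {O : A → S → B}
    (hO : Measurable (Function.uncurry O)) (n : ℕ) :
    Measurable fun q : a.Seed × (ℕ → S) => a.answers O q.1 q.2 n := by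
  induction n with
  | zero => exact measurable_const
  | succ n ih =>
    have hq : Measurable fun q : a.Seed × (ℕ → S) => a.query n q.1 (a.answers O q.1 q.2 n) :=
      (a.measurable_query n).comp (measurable_fst.prodMk ih)
    exact measurable_snoc.comp (ih.prodMk (hO.comp
      (hq.prodMk ((measurable_pi_apply n).comp measurable_snd))))

/-- The first `n` answers as a function of the first `n` states. -/
def prefixAnswers (z₀ : S) (n : ℕ) (q : a.Seed × (Fin n → S)) : Fin n → B :=
  a.answers O q.1 (fun i => if h : i < n then q.2 ⟨i, h⟩ else z₀) n

/-- The filler `z₀` is never read, because the first `n` answers involve only the states of index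
below `n`. -/
lemma prefixAnswers_eq (z₀ : S) (n : ℕ) (r : a.Seed) (z : ℕ → S) :
    a.prefixAnswers O z₀ n (r, fun i : Fin n => z i) = a.answers O r z n :=
  a.answers_congr O r n fun i hi => by simp [hi]

lemma measurable_prefixAnswers [MeasurableSpace S] {O : A → S → B}
    (hO : Measurable (Function.uncurry O)) (z₀ : S) (n : ℕ) :
    Measurable (a.prefixAnswers O z₀ n) := by
  refine (a.measurable_answers hO n).comp (measurable_fst.prodMk ?_)
  refine measurable_pi_lambda _ fun i => ?_
  change Measurable fun q : a.Seed × (Fin n → S) => if h : i < n then q.2 ⟨i, h⟩ else z₀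
  by_cases h : i < n
  · have e : (fun q : a.Seed × (Fin n → S) => if h : i < n then q.2 ⟨i, h⟩ else z₀) =
        fun q => q.2 ⟨i, h⟩ := funext fun q => dif_pos h
    rw [e]
    exact (measurable_pi_apply (X := fun _ : Fin n => S) ⟨i, h⟩).comp measurable_snd
  · have e : (fun q : a.Seed × (Fin n → S) => if h : i < n then q.2 ⟨i, h⟩ else z₀) =
        fun _ => z₀ := funext fun q => dif_neg h
    rw [e]
    exact measurable_const

end

/-- The joint law of the seed and the first `n` answers, when a query `x` is answered according
to the law `K x` independently of the past. -/
def transcript (a : Algorithm.{u} A B d) (K : Kernel A B) : (n : ℕ) → Measure (a.Seed × (Fin n → B))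
  | 0 => a.law.map fun r => (r, Fin.elim0)
  | n + 1 => ((a.transcript K n) ⊗ₘ
      K.comap (fun q => a.query n q.1 q.2) (a.measurable_query n)).map
        fun q => (q.1.1, (Fin.snoc (α := fun _ => B) q.1.2 q.2 : Fin (n + 1) → B))

variable (a : Algorithm.{u} A B d)

lemma measurable_append {H : Type*} [MeasurableSpace H] (n : ℕ) :
    Measurable fun q : (H × (Fin n → B)) × B =>
      (q.1.1, (Fin.snoc (α := fun _ => B) q.1.2 q.2 : Fin (n + 1) → B)) :=
  (measurable_fst.comp measurable_fst).prodMk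
    (measurable_snoc.comp ((measurable_snd.comp measurable_fst).prodMk measurable_snd))

instance (K : Kernel A B) [IsMarkovKernel K] (n : ℕ) :
    IsProbabilityMeasure (a.transcript K n) := by
  induction n with
  | zero =>
    have hm : Measurable fun r : a.Seed => (r, (Fin.elim0 : Fin 0 → B)) :=
      measurable_id.prodMk measurable_const
    exact Measure.isProbabilityMeasure_map hm.aemeasurable
  | succ n ih => exact Measure.isProbabilityMeasure_map (measurable_append n).aemeasurable

/-- With independent noise the seed and the answers are distributed as a transcript. -/
lemma map_answers_eq_transcript {S Ω : Type} [MeasurableSpace S] [MeasurableSpace Ω]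
    {π : Measure S} [IsProbabilityMeasure π] {P : Measure Ω} [IsProbabilityMeasure P]
    {Z : ℕ → Ω → S} {τ : ℕ} (hZ : IsMixingChain (stickyKernel π 1) π P Z τ) {O : A → S → B}
    (hO : Measurable (Function.uncurry O)) (K : Kernel A B) [IsMarkovKernel K]
    (hK : ∀ x, K x = π.map (O x)) (n : ℕ) :
    (a.law.prod P).map (fun q => (q.1, a.answers O q.1 (fun i => Z i q.2) n)) =
      a.transcript K n := by
  induction n with
  | zero =>
    have : (fun q : a.Seed × Ω => (q.1, a.answers O q.1 (fun i => Z i q.2) 0)) =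
        (fun r => (r, (Fin.elim0 : Fin 0 → B))) ∘ Prod.fst := rfl
    have hm : Measurable fun r : a.Seed => (r, (Fin.elim0 : Fin 0 → B)) :=
      measurable_id.prodMk measurable_const
    rw [this, ← Measure.map_map hm measurable_fst, Measure.map_fst_prod, measure_univ, one_smul]
    rfl
  | succ n ih =>
    obtain ⟨z₀⟩ : Nonempty S := nonempty_of_isProbabilityMeasure π
    have hpre := hZ.measurable_prefix n
    have hG := a.measurable_prefixAnswers hO z₀ n
    have hPL : IsProbabilityMeasure (prefixLaw P Z n) :=
      Measure.isProbabilityMeasure_map hpre.aemeasurable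
    -- the joint law of seed, past states and current state
    have h1 : (a.law.prod P).map (fun q => ((q.1, fun i : Fin n => Z i q.2), Z n q.2)) =
        (a.law.prod (prefixLaw P Z n)).prod π := by
      rw [← (measurePreserving_prodAssoc a.law (prefixLaw P Z n) π).symm.map_eq,
        ← hZ.map_prefix_prod n]
      conv_rhs => rw [← Measure.map_id (μ := a.law)]
      rw [Measure.map_prod_map _ _ measurable_id (hpre.prodMk (hZ.measurable n)),
        Measure.map_map (MeasurableEquiv.measurable _)
          (measurable_id.prodMap (hpre.prodMk (hZ.measurable n)))]
      rfl
    have hfst : Measurable fun w : a.Seed × (Fin n → S) => (w.1, a.prefixAnswers O z₀ n w) :=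
      measurable_fst.prodMk hG
    have hnu : (a.law.prod (prefixLaw P Z n)).map (fun w => (w.1, a.prefixAnswers O z₀ n w)) =
        a.transcript K n := by
      rw [← ih]
      unfold prefixLaw
      conv_lhs => rw [← Measure.map_id (μ := a.law)]
      rw [Measure.map_prod_map _ _ measurable_id hpre, Measure.map_map hfst
        (measurable_id.prodMap hpre)]
      congr 1
      ext1 q
      exact Prod.ext rfl (a.prefixAnswers_eq O z₀ n q.1 fun i => Z i q.2)
    have h2 : (a.law.prod P).map
        (fun q => ((q.1, a.answers O q.1 (fun i => Z i q.2) n), Z n q.2)) =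
        (a.transcript K n).prod π := by
      have hm : Measurable fun q : a.Seed × Ω => ((q.1, fun i : Fin n => Z i q.2), Z n q.2) :=
        (measurable_fst.prodMk (hpre.comp measurable_snd)).prodMk
          ((hZ.measurable n).comp measurable_snd)
      conv_rhs => rw [← hnu, ← Measure.map_id (μ := π)]
      rw [Measure.map_prod_map _ _ hfst measurable_id, ← h1,
        Measure.map_map (hfst.prodMap measurable_id) hm]
      congr 1
      ext1 q
      exact Prod.ext (Prod.ext rfl (a.prefixAnswers_eq O z₀ n q.1 fun i => Z i q.2).symm) rfl
    have hq := a.measurable_query n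
    have hZm : Measurable fun q : a.Seed × Ω => fun i => Z i q.2 :=
      measurable_pi_lambda _ fun i => (hZ.measurable i).comp measurable_snd
    have hans : Measurable fun q : a.Seed × Ω =>
        ((q.1, a.answers O q.1 (fun i => Z i q.2) n), Z n q.2) :=
      (measurable_fst.prodMk ((a.measurable_answers hO n).comp
        (measurable_fst.prodMk hZm))).prodMk ((hZ.measurable n).comp measurable_snd)
    have hstep : Measurable fun w : (a.Seed × (Fin n → B)) × S =>
        (w.1, O (a.query n w.1.1 w.1.2) w.2) :=
      measurable_fst.prodMk (hO.comp ((hq.comp measurable_fst).prodMk measurable_snd))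
    rw [transcript, ← map_prod_eq_compProd_comap _ π hO K hK hq, ← h2,
      Measure.map_map hstep hans, Measure.map_map (measurable_append n) (hstep.comp hans)]
    rfl

lemma error_eq_lintegral_transcript (p : MarkovProblem d) {π : Measure p.State}
    [IsProbabilityMeasure π] {τ : ℕ} (hZ : IsMixingChain (stickyKernel π 1) π p.P p.Z τ)
    {O : A → p.State → B} (hO : Measurable (Function.uncurry O)) (K : Kernel A B)
    [IsMarkovKernel K] (hK : ∀ x, K x = π.map (O x)) (N : ℕ) (y : Euc d) :
    a.error p O N y =
      ∫⁻ q, ENNReal.ofReal (‖a.output N q.1 q.2 - y‖ ^ 2) ∂(a.transcript K N) := by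
  have hZm : Measurable fun q : a.Seed × p.Ω => fun i => p.Z i q.2 :=
    measurable_pi_lambda _ fun i => (hZ.measurable i).comp measurable_snd
  rw [← a.map_answers_eq_transcript hZ hO K hK N, lintegral_map]
  · rfl
  · exact (((a.measurable_output N).sub_const y).norm.pow_const 2).ennreal_ofReal
  · exact measurable_fst.prodMk ((a.measurable_answers hO N).comp (measurable_fst.prodMk hZm))

lemma error_eq_lintegral_prefixLaw (p : MarkovProblem d) (hZ : ∀ n, Measurable (p.Z n))
    {O : A → p.State → B} (hO : Measurable (Function.uncurry O)) (z₀ : p.State) (N : ℕ)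
    (y : Euc d) :
    a.error p O N y =
      ∫⁻ q, ENNReal.ofReal (‖a.output N q.1 (a.prefixAnswers O z₀ N q) - y‖ ^ 2)
        ∂(a.law.prod (prefixLaw p.P p.Z N)) := by
  have hpre : Measurable fun ω => fun i : Fin N => p.Z i ω :=
    measurable_pi_lambda _ fun i => hZ i
  unfold prefixLaw
  conv_rhs => rw [← Measure.map_id (μ := a.law)]
  rw [Measure.map_prod_map _ _ measurable_id hpre, lintegral_map]
  · refine lintegral_congr fun q => ?_
    rw [← a.prefixAnswers_eq O z₀ N q.1 fun i => p.Z i q.2]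
    rfl
  · exact ((((a.measurable_output N).comp (measurable_fst.prodMk
      (a.measurable_prefixAnswers hO z₀ N))).sub_const y).norm.pow_const 2).ennreal_ofReal
  · exact measurable_id.prodMap hpre

/-- The chain rule integrates the divergence of the next answer against the same law for every `i`,
namely the transcript under `K`. The sum over `i` can therefore be taken inside the integral and
bounded for one query at a time, which covers adaptive choices as well. Bounding each `i` separately
by its worst query would lose a factor up to the number of alternatives. -/
lemma sum_klDiv_transcript_le [MeasurableSpace.CountablyGenerated B] {ι : Type*} [Fintype ι]
    (K : Kernel A B) (K' : ι → Kernel A B) [IsMarkovKernel K] [∀ i, IsMarkovKernel (K' i)]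
    {C : ℝ≥0∞} (hC : C ≠ ∞) (h : ∀ x, ∑ i, klDiv (K x) (K' i x) ≤ C) (N : ℕ) :
    ∑ i, klDiv (a.transcript K N) (a.transcript (K' i) N) ≤ N * C := by
  have hac : ∀ i x, K x ≪ K' i x := fun i x =>
    absolutelyContinuous_of_klDiv_ne_top (ne_top_of_le_ne_top hC
      ((Finset.single_le_sum (f := fun i => klDiv (K x) (K' i x)) (fun _ _ => zero_le)
        (Finset.mem_univ i)).trans (h x)))
  induction N with
  | zero =>
    have hz : ∀ i, klDiv (a.transcript K 0) (a.transcript (K' i) 0) = 0 := fun i =>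
      klDiv_self (a.transcript K 0)
    simp [hz]
  | succ n ih =>
    let κ := K.comap (fun q : a.Seed × (Fin n → B) => a.query n q.1 q.2) (a.measurable_query n)
    let κ' := fun i => (K' i).comap (fun q : a.Seed × (Fin n → B) => a.query n q.1 q.2)
      (a.measurable_query n)
    have hκ : ∀ i q, κ q ≪ κ' i q := fun i q => hac i _
    have hstep : ∀ i, klDiv (a.transcript K (n + 1)) (a.transcript (K' i) (n + 1)) ≤
        klDiv (a.transcript K n) (a.transcript (K' i) n) +
          ∫⁻ q, klDiv (κ q) (κ' i q) ∂(a.transcript K n) := by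
      intro i
      rw [← klDiv_compProd_eq_add_lintegral _ _ (hκ i)]
      exact klDiv_map_le _ _ (measurable_append n)
    calc ∑ i, klDiv (a.transcript K (n + 1)) (a.transcript (K' i) (n + 1))
        ≤ ∑ i, (klDiv (a.transcript K n) (a.transcript (K' i) n) +
          ∫⁻ q, klDiv (κ q) (κ' i q) ∂(a.transcript K n)) :=
          Finset.sum_le_sum fun i _ => hstep i
      _ = ∑ i, klDiv (a.transcript K n) (a.transcript (K' i) n) +
          ∫⁻ q, ∑ i, klDiv (κ q) (κ' i q) ∂(a.transcript K n) := by
          rw [Finset.sum_add_distrib,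
            lintegral_finsetSum _ fun i _ => measurable_klDiv_kernel (hκ i)]
      _ ≤ n * C + ∫⁻ _, C ∂(a.transcript K n) := by
          gcongr with q
          exact h _
      _ = (n + 1 : ℕ) * C := by
          rw [lintegral_const, measure_univ, mul_one]
          push_cast
          ring

end Algorithm

end Transcripts

/-! ### Assouad's lemma on the sign cube -/

section Assouad

open InformationTheory

/-- The sign attached to a Boolean. -/
def boolSign (b : Bool) : ℝ := if b then 1 else -1

lemma boolSign_not (b : Bool) : boolSign (!b) = -boolSign b := by cases b <;> simp [boolSign]

lemma boolSign_sq (b : Bool) : boolSign b ^ 2 = 1 := by cases b <;> simp [boolSign]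

lemma abs_boolSign (b : Bool) : |boolSign b| = 1 := by cases b <;> simp [boolSign]

/-- The vertex of the cube `{-1, 1}^d` with given signs. -/
def signVec {d : ℕ} (s : Fin d → Bool) : Euc d := WithLp.toLp 2 fun i => boolSign (s i)

@[simp] lemma signVec_apply {d : ℕ} (s : Fin d → Bool) (i : Fin d) :
    signVec s i = boolSign (s i) := rfl

/-- Reverse the `i`-th sign. -/
def flipSign {d : ℕ} (s : Fin d → Bool) (i : Fin d) : Fin d → Bool := Function.update s i (!s i)

lemma flipSign_self {d : ℕ} (s : Fin d → Bool) (i : Fin d) : flipSign s i i = !s i := by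
  simp [flipSign]

lemma flipSign_of_ne {d : ℕ} (s : Fin d → Bool) {i j : Fin d} (h : j ≠ i) :
    flipSign s i j = s j := by
  simp [flipSign, h]

lemma flipSign_flipSign {d : ℕ} (s : Fin d → Bool) (i : Fin d) :
    flipSign (flipSign s i) i = s := by
  ext j
  by_cases h : j = i
  · subst h; simp [flipSign_self]
  · simp [flipSign_of_ne _ h]

lemma sum_flipSign {d : ℕ} (i : Fin d) (g : (Fin d → Bool) → ℝ) :
    ∑ s, g (flipSign s i) = ∑ s, g s :=
  Equiv.sum_comp (Function.Involutive.toPerm (fun s => flipSign s i)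
    fun s => flipSign_flipSign s i) g

/-- Assouad's lemma for the mean square error, with Kullback-Leibler divergences. -/
lemma exists_le_lintegral_of_sum_klDiv_le {X : Type*} [MeasurableSpace X] {d : ℕ}
    (P : (Fin d → Bool) → Measure X) [∀ s, IsProbabilityMeasure (P s)] {T : X → Euc d}
    (hT : Measurable T) {ρ : ℝ} (hρ : 0 ≤ ρ)
    (h : ∀ s, ∑ i, klDiv (P s) (P (flipSign s i)) ≤ ENNReal.ofReal (d / 4)) :
    ∃ s, ENNReal.ofReal (ρ ^ 2 * d / 8) ≤
      ∫⁻ x, ENNReal.ofReal (‖T x - ρ • signVec s‖ ^ 2) ∂(P s) := by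
  have hcoord : ∀ i, Measurable fun x => T x i := fun i =>
    (EuclideanSpace.proj (𝕜 := ℝ) i).continuous.measurable.comp hT
  -- On `W s i` the estimate lies on the wrong side of zero (or at zero) in coordinate `i`, so that
  -- this coordinate alone contributes at least `ρ²` to the squared error. Being right for `s` means
  -- being wrong for the flipped sign, which makes `W s i` the error event of a test between
  -- neighbours.
  let W : (Fin d → Bool) → Fin d → Set X := fun s i => {x | boolSign (s i) * T x i ≤ 0}
  have hW : ∀ s i, MeasurableSet (W s i) := fun s i =>
    measurableSet_le ((hcoord i).const_mul _) measurable_const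
  have hsub : ∀ s i, (W s i)ᶜ ⊆ W (flipSign s i) i := by
    intro s i x hx
    simp only [W, Set.mem_compl_iff, Set.mem_ofPred_eq, not_le, flipSign_self, boolSign_not] at hx ⊢
    linarith
  have hfin : ∀ s i, klDiv (P s) (P (flipSign s i)) ≠ ∞ := fun s i =>
    ne_top_of_le_ne_top ENNReal.ofReal_ne_top
      ((Finset.single_le_sum (f := fun i => klDiv (P s) (P (flipSign s i)))
        (fun _ _ => zero_le) (Finset.mem_univ i)).trans (h s))
  have hpair : ∀ s i, (1 / 2 : ℝ) ≤ (P s).real (W s i) +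
      (P (flipSign s i)).real (W (flipSign s i) i) + (klDiv (P s) (P (flipSign s i))).toReal := by
    intro s i
    have h1 := (half_le_add_klDiv (P s) (P (flipSign s i)) (hW s i)).trans
      (add_le_add_left (add_le_add_right (measure_mono (hsub s i)) _) _)
    have h2 := ENNReal.toReal_mono (by simp [hfin s i]) h1
    rw [ENNReal.toReal_add (by simp) (hfin s i), ENNReal.toReal_add (by simp) (by simp)] at h2
    simpa [Measure.real] using h2
  have hkl : ∀ s, ∑ i, (klDiv (P s) (P (flipSign s i))).toReal ≤ d / 4 := by
    intro s
    rw [← ENNReal.toReal_sum fun i _ => hfin s i]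
    exact ENNReal.toReal_le_of_le_ofReal (by positivity) (h s)
  -- Flipping sign `i` permutes the cube, so over all `s` the two error probabilities in `hpair`
  -- have the same total. Twice that total is thus at least the number of vertices times `d / 2 - d
  -- / 4`.
  have htotal : ∑ _s : Fin d → Bool, (d / 8 : ℝ) ≤ ∑ s, ∑ i, (P s).real (W s i) := by
    have hswap : ∑ s, ∑ i, (P (flipSign s i)).real (W (flipSign s i) i) =
        ∑ s, ∑ i, (P s).real (W s i) := by
      rw [Finset.sum_comm, Finset.sum_comm (f := fun s i => (P s).real (W s i))]
      exact Finset.sum_congr rfl fun i _ => sum_flipSign i fun s => (P s).real (W s i)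
    have h1 : ∑ _s : Fin d → Bool, ∑ _i : Fin d, (1 / 2 : ℝ) ≤ ∑ s, ∑ i, ((P s).real (W s i) +
        (P (flipSign s i)).real (W (flipSign s i) i) +
          (klDiv (P s) (P (flipSign s i))).toReal) :=
      Finset.sum_le_sum fun s _ => Finset.sum_le_sum fun i _ => hpair s i
    simp only [Finset.sum_add_distrib] at h1
    rw [hswap] at h1
    have h2 : ∑ s, ∑ i, (klDiv (P s) (P (flipSign s i))).toReal ≤
        ∑ _s : Fin d → Bool, (d / 4 : ℝ) := Finset.sum_le_sum fun s _ => hkl s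
    simp only [Finset.sum_const, nsmul_eq_mul, Finset.card_univ, Fintype.card_fin] at h1 h2 ⊢
    linarith
  obtain ⟨s, -, hs⟩ := Finset.exists_le_of_sum_le Finset.univ_nonempty htotal
  refine ⟨s, ?_⟩
  calc ENNReal.ofReal (ρ ^ 2 * d / 8)
      ≤ ENNReal.ofReal (ρ ^ 2 * ∑ i, (P s).real (W s i)) := by
        refine ENNReal.ofReal_le_ofReal ?_
        rw [mul_div_assoc]
        gcongr
    _ = ∑ i, ENNReal.ofReal (ρ ^ 2) * P s (W s i) := by
        rw [ENNReal.ofReal_mul (by positivity),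
          ENNReal.ofReal_sum_of_nonneg fun _ _ => measureReal_nonneg, Finset.mul_sum]
        simp
    _ = ∫⁻ x, ∑ i, (W s i).indicator (fun _ => ENNReal.ofReal (ρ ^ 2)) x ∂(P s) := by
        rw [lintegral_finsetSum _ fun i _ => measurable_const.indicator (hW s i)]
        exact Finset.sum_congr rfl fun i _ => (lintegral_indicator_const (hW s i) _).symm
    _ ≤ ∫⁻ x, ENNReal.ofReal (‖T x - ρ • signVec s‖ ^ 2) ∂(P s) := by
        refine lintegral_mono fun x => ?_
        rw [EuclideanSpace.norm_sq_eq, ENNReal.ofReal_sum_of_nonneg fun _ _ => sq_nonneg _]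
        refine Finset.sum_le_sum fun i _ => ?_
        by_cases hx : x ∈ W s i
        · rw [Set.indicator_of_mem hx]
          refine ENNReal.ofReal_le_ofReal ?_
          have hx' : boolSign (s i) * T x i ≤ 0 := hx
          have hn : ‖(T x - ρ • signVec s) i‖ ^ 2 =
              T x i ^ 2 - 2 * ρ * (boolSign (s i) * T x i) + ρ ^ 2 * boolSign (s i) ^ 2 := by
            simp only [PiLp.sub_apply, PiLp.smul_apply, signVec_apply, smul_eq_mul,
              Real.norm_eq_abs, sq_abs]
            ring
          rw [hn, boolSign_sq]
          nlinarith [sq_nonneg (T x i), mul_nonneg hρ (neg_nonneg.2 hx')]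
        · rw [Set.indicator_of_notMem hx]
          exact zero_le

end Assouad

/-! ### Separable objectives: quadratics and oscillating quadratics -/

section Objectives

variable {d : ℕ}

/-- The sum of the functions `φ i` of the separate coordinates. -/
def separable (φ : Fin d → ℝ → ℝ) (x : Euc d) : ℝ := ∑ i, φ i (x i)

variable {φ φ' : Fin d → ℝ → ℝ}

lemma hasGradientAt_separable (hφ : ∀ i t, HasDerivAt (φ i) (φ' i t) t) (x : Euc d) :
    HasGradientAt (separable φ) (WithLp.toLp 2 fun i => φ' i (x i)) x := by
  rw [hasGradientAt_iff_hasFDerivAt]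
  have h : HasFDerivAt (separable φ)
      (∑ i, φ' i (x i) • (EuclideanSpace.proj (𝕜 := ℝ) i : Euc d →L[ℝ] ℝ)) x :=
    HasFDerivAt.fun_sum fun i _ =>
      (hφ i (x i)).comp_hasFDerivAt x (EuclideanSpace.proj (𝕜 := ℝ) i).hasFDerivAt
  have e : InnerProductSpace.toDual ℝ (Euc d) (WithLp.toLp 2 fun i => φ' i (x i)) =
      ∑ i, φ' i (x i) • (EuclideanSpace.proj (𝕜 := ℝ) i : Euc d →L[ℝ] ℝ) := by
    ext1 y
    simp [PiLp.inner_apply, mul_comm]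
  rw [e]
  exact h

lemma gradient_separable (hφ : ∀ i t, HasDerivAt (φ i) (φ' i t) t) (x : Euc d) :
    ∇ (separable φ) x = WithLp.toLp 2 fun i => φ' i (x i) :=
  (hasGradientAt_separable hφ x).gradient

lemma isLSmooth_separable {L : ℝ} (hL : 0 ≤ L) (hφ : ∀ i t, HasDerivAt (φ i) (φ' i t) t)
    (h : ∀ i a b, |φ' i a - φ' i b| ≤ L * |a - b|) : IsLSmooth L (separable φ) := by
  refine ⟨fun x => (hasGradientAt_separable hφ x).differentiableAt, fun x y => ?_⟩
  rw [gradient_separable hφ, gradient_separable hφ]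
  refine abs_le_of_sq_le_sq' ?_ (by positivity) |>.2
  rw [mul_pow, EuclideanSpace.real_norm_sq_eq, EuclideanSpace.real_norm_sq_eq, Finset.mul_sum]
  refine Finset.sum_le_sum fun i _ => ?_
  have hi := h i (x i) (y i)
  have := pow_le_pow_left₀ (abs_nonneg _) hi 2
  rwa [mul_pow, sq_abs, sq_abs] at this

lemma contDiff_separable (hφ : ∀ i, ContDiff ℝ 1 (φ i)) : ContDiff ℝ 1 (separable φ) :=
  ContDiff.sum fun i _ => (hφ i).comp (EuclideanSpace.proj (𝕜 := ℝ) i).contDiff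

lemma isStronglyConvex_separable {μ : ℝ} (hc : ∀ i, ContDiff ℝ 1 (φ i))
    (hφ : ∀ i t, HasDerivAt (φ i) (φ' i t) t)
    (h : ∀ i a b, μ / 2 * (a - b) ^ 2 ≤ φ i a - φ i b - φ' i b * (a - b)) :
    IsStronglyConvex μ (separable φ) := by
  refine ⟨contDiff_separable hc, fun x y => ?_⟩
  rw [gradient_separable hφ, EuclideanSpace.real_norm_sq_eq, PiLp.inner_apply, Finset.mul_sum]
  simp only [separable, ← Finset.sum_sub_distrib]
  refine Finset.sum_le_sum fun i _ => ?_
  have := h i (x i) (y i)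
  simpa [mul_comm] using this

lemma separable_le_of_deriv_eq_zero {μ : ℝ} (hμ : 0 ≤ μ)
    (h : ∀ i a b, μ / 2 * (a - b) ^ 2 ≤ φ i a - φ i b - φ' i b * (a - b)) {y : Euc d}
    (hy : ∀ i, φ' i (y i) = 0) (x : Euc d) : separable φ y ≤ separable φ x := by
  refine Finset.sum_le_sum fun i _ => ?_
  have h1 := h i (x i) (y i)
  rw [hy i] at h1
  have : 0 ≤ μ / 2 * (x i - y i) ^ 2 := by positivity
  linarith

/-- Since the cosine is 1-Lipschitz, `t² / 2 ∓ sin t` is convex. Its tangent-line inequality at `v`,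
for both signs, is the claim. -/
lemma abs_sin_sub_sub_le (u v : ℝ) :
    |Real.sin u - Real.sin v - Real.cos v * (u - v)| ≤ (u - v) ^ 2 / 2 := by
  have key : ∀ σ : ℝ, |σ| = 1 →
      σ * (Real.sin u - Real.sin v - Real.cos v * (u - v)) ≤ (u - v) ^ 2 / 2 := by
    intro σ hσ
    have hd : ∀ t, HasDerivAt (fun t => t ^ 2 / 2 - σ * Real.sin t) (t - σ * Real.cos t) t := by
      intro t
      have := ((hasDerivAt_pow 2 t).div_const 2).sub ((Real.hasDerivAt_sin t).const_mul σ)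
      refine this.congr_deriv ?_
      simp
    have hmono : Monotone (deriv fun t => t ^ 2 / 2 - σ * Real.sin t) := by
      intro a b hab
      rw [(hd a).deriv, (hd b).deriv]
      have h1 : |σ * (Real.cos b - Real.cos a)| ≤ b - a := by
        rw [abs_mul, hσ, one_mul, ← abs_of_nonneg (sub_nonneg.2 hab)]
        exact Real.abs_cos_sub_cos_le b a
      have := (abs_le.1 h1).2
      linarith
    have hconv := hmono.convexOn_univ_of_deriv fun t => (hd t).differentiableAt
    rcases lt_trichotomy v u with h | h | h
    · have := hconv.le_slope_of_hasDerivAt (Set.mem_univ v) (Set.mem_univ u) h (hd v)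
      rw [slope_def_field, le_div_iff₀ (by linarith)] at this
      nlinarith
    · subst h; simp
    · have := hconv.slope_le_of_hasDerivAt (Set.mem_univ u) (Set.mem_univ v) h (hd v)
      rw [slope_def_field, div_le_iff₀ (by linarith)] at this
      nlinarith
  rw [abs_le]
  have h1 := key 1 (by simp)
  have h2 := key (-1) (by simp)
  constructor <;> linarith

/-- The quadratic function with curvature `μ` and slope `-θ` at the origin. -/
def quad (μ θ t : ℝ) : ℝ := μ / 2 * t ^ 2 - θ * t

lemma hasDerivAt_quad (μ θ t : ℝ) : HasDerivAt (quad μ θ) (μ * t - θ) t := by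
  have := ((hasDerivAt_pow 2 t).const_mul (μ / 2)).sub ((hasDerivAt_id t).const_mul θ)
  refine this.congr_deriv ?_
  simp
  ring

lemma contDiff_quad (μ θ : ℝ) : ContDiff ℝ 1 (quad μ θ) := by
  unfold quad; fun_prop

lemma quad_convex (μ θ a b : ℝ) :
    μ / 2 * (a - b) ^ 2 ≤ quad μ θ a - quad μ θ b - (μ * b - θ) * (a - b) := by
  unfold quad
  apply le_of_eq
  ring

/-- A quadratic function with a small oscillating perturbation. -/
def sinQuad (μ e σ t : ℝ) : ℝ := μ * t ^ 2 - μ * e ^ 2 * (σ * Real.sin (t / e))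

lemma hasDerivAt_sinQuad (μ e σ t : ℝ) :
    HasDerivAt (sinQuad μ e σ) (2 * μ * t - μ * e * (σ * Real.cos (t / e))) t := by
  have h1 : HasDerivAt (fun t : ℝ => Real.sin (t / e)) (Real.cos (t / e) * (1 / e)) t :=
    (Real.hasDerivAt_sin _).comp t ((hasDerivAt_id t).div_const e)
  have := ((hasDerivAt_pow 2 t).const_mul μ).sub ((h1.const_mul σ).const_mul (μ * e ^ 2))
  refine this.congr_deriv ?_
  field_simp
  norm_num
  exact Or.inl (mul_comm _ _)

lemma contDiff_sinQuad (μ e σ : ℝ) : ContDiff ℝ 1 (sinQuad μ e σ) := by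
  unfold sinQuad; fun_prop

/-- The perturbation has height `μ e²`, slope at most `μ e` and curvature at most `μ`, the last
whatever `e` is. With the curvature `2 μ` of the quadratic part this gives `3 μ`, the reason for
requiring `3 μ ≤ L`. -/
lemma sinQuad_lipschitz {μ e σ : ℝ} (hμ : 0 < μ) (he : 0 < e) (hσ : |σ| = 1) (a b : ℝ) :
    |(2 * μ * a - μ * e * (σ * Real.cos (a / e))) - (2 * μ * b - μ * e * (σ * Real.cos (b / e)))|
      ≤ 3 * μ * |a - b| := by
  have h1 : |Real.cos (a / e) - Real.cos (b / e)| ≤ |a - b| / e := by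
    refine (Real.abs_cos_sub_cos_le _ _).trans (le_of_eq ?_)
    rw [← sub_div, abs_div, abs_of_pos he]
  have h2 : |μ * e * (σ * (Real.cos (a / e) - Real.cos (b / e)))| ≤ μ * |a - b| := by
    rw [abs_mul, abs_mul σ, hσ, one_mul, abs_of_pos (mul_pos hμ he)]
    calc μ * e * |Real.cos (a / e) - Real.cos (b / e)| ≤ μ * e * (|a - b| / e) := by gcongr
      _ = μ * |a - b| := by field_simp
  calc _ = |2 * μ * (a - b) - μ * e * (σ * (Real.cos (a / e) - Real.cos (b / e)))| := by
        congr 1; ring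
    _ ≤ |2 * μ * (a - b)| + |μ * e * (σ * (Real.cos (a / e) - Real.cos (b / e)))| := abs_sub _ _
    _ ≤ 3 * μ * |a - b| := by
        rw [abs_mul, abs_of_pos (by positivity : 0 < 2 * μ)]
        linarith

/-- The quadratic part contributes `μ (a - b)²`, twice what is needed, and the Taylor remainder of
the rescaled sine costs at most half of it. -/
lemma sinQuad_convex {μ e σ : ℝ} (hμ : 0 < μ) (he : 0 < e) (hσ : |σ| = 1) (a b : ℝ) :
    μ / 2 * (a - b) ^ 2 ≤ sinQuad μ e σ a - sinQuad μ e σ b -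
      (2 * μ * b - μ * e * (σ * Real.cos (b / e))) * (a - b) := by
  have h1 : μ * e ^ 2 * (σ * (Real.sin (a / e) - Real.sin (b / e) -
      Real.cos (b / e) * (a / e - b / e))) ≤ μ / 2 * (a - b) ^ 2 := by
    refine (le_abs_self _).trans ?_
    rw [abs_mul, abs_mul σ, hσ, one_mul, abs_of_pos (by positivity : 0 < μ * e ^ 2)]
    calc _ ≤ μ * e ^ 2 * ((a / e - b / e) ^ 2 / 2) := by gcongr; exact abs_sin_sub_sub_le _ _
      _ = μ / 2 * (a - b) ^ 2 := by field_simp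
  have h2 : sinQuad μ e σ a - sinQuad μ e σ b -
      (2 * μ * b - μ * e * (σ * Real.cos (b / e))) * (a - b) = μ * (a - b) ^ 2 -
      μ * e ^ 2 * (σ * (Real.sin (a / e) - Real.sin (b / e) -
        Real.cos (b / e) * (a / e - b / e))) := by
    unfold sinQuad
    field_simp
    ring
  rw [h2]
  linarith

/-- The point `± e r` is the zero of the derivative of `sinQuad` with sign `± 1`. The strict bound
`1 / 3 < r` gives `73 r² > 8`, which is where the constant 73 of the one-point instances comes from.
-/
lemma exists_two_mul_eq_cos : ∃ r : ℝ, 1 / 3 < r ∧ r ≤ 1 / 2 ∧ 2 * r = Real.cos r := by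
  have hc : ContinuousOn (fun r : ℝ => 2 * r - Real.cos r) (Set.Icc (1 / 3) (1 / 2)) := by
    fun_prop
  have h1 : 2 * (1 / 3 : ℝ) - Real.cos (1 / 3) < 0 := by
    have := Real.one_sub_sq_div_two_le_cos (x := 1 / 3)
    norm_num at this ⊢
    linarith
  have h2 : 0 ≤ 2 * (1 / 2 : ℝ) - Real.cos (1 / 2) := by
    have := Real.cos_le_one (1 / 2)
    linarith
  obtain ⟨r, hr, hr0⟩ := intermediate_value_Icc (by norm_num) hc ⟨h1.le, h2⟩
  have hr0' : 2 * r - Real.cos r = 0 := hr0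
  refine ⟨r, lt_of_le_of_ne hr.1 ?_, hr.2, by linarith⟩
  rintro rfl
  linarith

lemma sinQuad_deriv_eq_zero {μ e r : ℝ} (he : 0 < e) (hr : 2 * r = Real.cos r) (b : Bool) :
    2 * μ * (e * r * boolSign b) - μ * e * (boolSign b * Real.cos (e * r * boolSign b / e)) = 0 := by
  have h1 : e * r * boolSign b / e = r * boolSign b := by field_simp
  have h2 : Real.cos (r * boolSign b) = Real.cos r := by cases b <;> simp [boolSign]
  rw [h1, h2, ← hr]
  ring

lemma norm_signVec_sq (s : Fin d → Bool) : ‖signVec s‖ ^ 2 = d := by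
  rw [EuclideanSpace.real_norm_sq_eq]
  simp [boolSign_sq]

lemma norm_smul_signVec_le {ρ : ℝ} (hρ : ρ ^ 2 * d ≤ 1) (s : Fin d → Bool) :
    ‖ρ • signVec s‖ ≤ 1 := by
  have h : ‖ρ • signVec s‖ ^ 2 ≤ 1 ^ 2 := by
    rw [norm_smul, mul_pow, norm_signVec_sq, Real.norm_eq_abs, sq_abs]
    simpa using hρ
  exact abs_le_of_sq_le_sq' h zero_le_one |>.2

end Objectives

/-! ### Noise laws: biased coins and Gaussian vectors -/

section NoiseLaws

open InformationTheory

/-- Comparison with the chi-square divergence: `log x ≤ x - 1` gives `klFun x ≤ (x - 1)²`. -/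
lemma klDiv_withDensity_le {X : Type*} [MeasurableSpace X] (ν : Measure X) [IsFiniteMeasure ν]
    {g : X → ℝ} (hg : Measurable g) (hg0 : ∀ x, 0 ≤ g x)
    [IsFiniteMeasure (ν.withDensity fun x => ENNReal.ofReal (g x))] :
    klDiv (ν.withDensity fun x => ENNReal.ofReal (g x)) ν ≤
      ∫⁻ x, ENNReal.ofReal ((g x - 1) ^ 2) ∂ν := by
  rw [klDiv_eq_lintegral_klFun_of_ac (withDensity_absolutelyContinuous _ _)]
  refine lintegral_mono_ae ?_
  filter_upwards [Measure.rnDeriv_withDensity ν hg.ennreal_ofReal] with x hx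
  rw [hx, ENNReal.toReal_ofReal (hg0 x), klFun_apply]
  refine ENNReal.ofReal_le_ofReal ?_
  rcases (hg0 x).eq_or_lt with h | h
  · rw [← h]; norm_num
  · nlinarith [Real.log_le_sub_one_of_pos h]

/-- The law of a coin with bias `η` in the direction of `b`. -/
def coin (η : unitInterval) (b : Bool) : Measure Bool :=
  ENNReal.ofReal ((1 + η * boolSign b) / 2) • Measure.dirac true +
    ENNReal.ofReal ((1 - η * boolSign b) / 2) • Measure.dirac false

lemma coin_weights_nonneg (η : unitInterval) (b : Bool) :
    0 ≤ (1 + η * boolSign b) / 2 ∧ 0 ≤ (1 - η * boolSign b) / 2 := by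
  have h0 : (0 : ℝ) ≤ η := η.2.1
  have h1 : (η : ℝ) ≤ 1 := η.2.2
  cases b <;> simp [boolSign] <;> constructor <;> linarith

instance (η : unitInterval) (b : Bool) : IsProbabilityMeasure (coin η b) := by
  refine ⟨?_⟩
  have h := coin_weights_nonneg η b
  simp only [coin, Measure.coe_add, Measure.coe_smul, Pi.add_apply, Pi.smul_apply, measure_univ,
    smul_eq_mul, mul_one]
  rw [← ENNReal.ofReal_add h.1 h.2]
  ring_nf
  simp

lemma lintegral_coin (η : unitInterval) (b : Bool) (g : Bool → ℝ≥0∞) :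
    ∫⁻ x, g x ∂(coin η b) = ENNReal.ofReal ((1 + η * boolSign b) / 2) * g true +
      ENNReal.ofReal ((1 - η * boolSign b) / 2) * g false := by
  rw [coin, lintegral_add_measure, lintegral_smul_measure, lintegral_smul_measure,
    lintegral_dirac, lintegral_dirac]
  rfl

lemma integral_coin (η : unitInterval) (b : Bool) (g : Bool → ℝ) :
    ∫ x, g x ∂(coin η b) = (1 + η * boolSign b) / 2 * g true +
      (1 - η * boolSign b) / 2 * g false := by
  have h := coin_weights_nonneg η b
  have hi : ∀ (c : ℝ) (x : Bool), Integrable g (ENNReal.ofReal c • Measure.dirac x) :=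
    fun c x => Integrable.smul_measure .of_finite ENNReal.ofReal_ne_top
  rw [coin, integral_add_measure (hi _ _) (hi _ _), integral_smul_measure, integral_smul_measure,
    integral_dirac, integral_dirac, ENNReal.toReal_ofReal h.1, ENNReal.toReal_ofReal h.2]
  rfl

lemma integral_boolSign_coin (η : unitInterval) (b : Bool) :
    ∫ x, boolSign x ∂(coin η b) = η * boolSign b := by
  rw [integral_coin]
  simp [boolSign]
  ring

/-- The chi-square divergence between opposite coins is `4 η² / (1 - η²)`, at most `16 η² / 3` when
`η ≤ 1 / 2`. -/
lemma klDiv_coin_le (η : unitInterval) (hη : (η : ℝ) ≤ 1 / 2) (b : Bool) :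
    klDiv (coin η b) (coin η (!b)) ≤ ENNReal.ofReal (6 * (η : ℝ) ^ 2) := by
  have h0 : (0 : ℝ) ≤ η := η.2.1
  have ht : ∀ x : Bool, |(η : ℝ) * boolSign b * boolSign x| ≤ 1 / 2 := fun x => by
    rw [abs_mul, abs_mul, abs_boolSign, abs_boolSign, abs_of_nonneg h0]; linarith
  let g : Bool → ℝ := fun x =>
    (1 + η * boolSign b * boolSign x) / (1 - η * boolSign b * boolSign x)
  have hg0 : ∀ x, 0 ≤ g x := fun x => by
    have := abs_le.1 (ht x)
    exact div_nonneg (by linarith) (by linarith)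
  have hdens : coin η b = (coin η (!b)).withDensity fun x => ENNReal.ofReal (g x) := by
    have h1 := abs_le.1 (ht true)
    have hgT : (1 - η * boolSign b) / 2 * g true = (1 + η * boolSign b) / 2 := by
      simp only [g, boolSign, if_true, mul_one] at h1 ⊢
      have : (1 - (η : ℝ) * (if b then 1 else -1)) ≠ 0 := by linarith
      field_simp
    have hgF : (1 + η * boolSign b) / 2 * g false = (1 - η * boolSign b) / 2 := by
      simp only [g, boolSign, if_true, Bool.false_eq_true, if_false, mul_one, mul_neg,
        sub_neg_eq_add] at h1 ⊢
      have : (1 + (η : ℝ) * (if b then 1 else -1)) ≠ 0 := by linarith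
      field_simp
      ring
    have hw := coin_weights_nonneg η b
    ext s hs
    rw [withDensity_apply _ hs, ← lintegral_indicator hs, lintegral_coin, boolSign_not]
    simp only [coin, Measure.coe_add, Measure.coe_smul, Pi.add_apply, Pi.smul_apply, smul_eq_mul,
      mul_neg, ← sub_eq_add_neg, sub_neg_eq_add]
    rw [Measure.dirac_apply' _ hs, Measure.dirac_apply' _ hs]
    congr 1
    · by_cases h : true ∈ s
      · simp only [Set.indicator_of_mem h, Pi.one_apply, mul_one]
        rw [← ENNReal.ofReal_mul hw.2, hgT]
      · simp [Set.indicator_of_notMem h]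
    · by_cases h : false ∈ s
      · simp only [Set.indicator_of_mem h, Pi.one_apply, mul_one]
        rw [← ENNReal.ofReal_mul hw.1, hgF]
      · simp [Set.indicator_of_notMem h]
  have hfin : IsFiniteMeasure ((coin η (!b)).withDensity fun x => ENNReal.ofReal (g x)) := by
    rw [← hdens]; infer_instance
  rw [hdens]
  refine (klDiv_withDensity_le _ (measurable_of_countable g) hg0).trans ?_
  have hw := coin_weights_nonneg η (!b)
  rw [lintegral_coin, ← ENNReal.ofReal_mul hw.1, ← ENNReal.ofReal_mul hw.2,
    ← ENNReal.ofReal_add (mul_nonneg hw.1 (sq_nonneg _)) (mul_nonneg hw.2 (sq_nonneg _))]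
  refine ENNReal.ofReal_le_ofReal ?_
  have key : ∀ t : ℝ, |t| ≤ 1 / 2 → (1 - t) / 2 * ((1 + t) / (1 - t) - 1) ^ 2 +
      (1 + t) / 2 * ((1 - t) / (1 + t) - 1) ^ 2 ≤ 6 * t ^ 2 := by
    intro t ht
    have h1 := (abs_le.1 ht).1
    have h2 := (abs_le.1 ht).2
    have e : (1 - t) / 2 * ((1 + t) / (1 - t) - 1) ^ 2 +
        (1 + t) / 2 * ((1 - t) / (1 + t) - 1) ^ 2 = 4 * t ^ 2 / (1 - t ^ 2) := by
      have h3 : 1 - t ≠ 0 := by linarith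
      have h4 : 1 + t ≠ 0 := by linarith
      have h5 : 1 - t ^ 2 ≠ 0 := by
        rw [show 1 - t ^ 2 = (1 - t) * (1 + t) by ring]; positivity
      field_simp
      ring
    have hsq : t ^ 2 ≤ 1 / 4 := by nlinarith
    rw [e, div_le_iff₀ (by linarith)]
    nlinarith [sq_nonneg t]
  have hk := key (η * boolSign b) (by simpa [boolSign] using ht true)
  rw [mul_pow, boolSign_sq, mul_one] at hk
  refine le_trans (le_of_eq ?_) hk
  simp only [g, boolSign_not]
  simp [boolSign]
  ring

variable {d : ℕ}

/-- Independent coins with biases in the directions `s`. -/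
def coinLaw (η : unitInterval) (s : Fin d → Bool) : Measure (Fin d → Bool) :=
  Measure.pi fun i => coin η (s i)

instance (η : unitInterval) (s : Fin d → Bool) : IsProbabilityMeasure (coinLaw η s) := by
  unfold coinLaw; infer_instance

lemma klDiv_coinLaw_flipSign_le (η : unitInterval) (hη : (η : ℝ) ≤ 1 / 2) (s : Fin d → Bool)
    (i : Fin d) :
    klDiv (coinLaw η s) (coinLaw η (flipSign s i)) ≤ ENNReal.ofReal (6 * (η : ℝ) ^ 2) := by
  refine (klDiv_pi_le _ _).trans ?_
  rw [Finset.sum_eq_single i]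
  · rw [flipSign_self]
    exact klDiv_coin_le η hη (s i)
  · intro j _ hj
    rw [flipSign_of_ne s hj, klDiv_self]
  · simp

lemma integral_boolSign_coinLaw (η : unitInterval) (s : Fin d → Bool) (i : Fin d) :
    ∫ z, boolSign (z i) ∂(coinLaw η s) = η * boolSign (s i) := by
  unfold coinLaw
  rw [integral_comp_eval (μ := fun i => coin η (s i)) (i := i) (f := boolSign)
    (measurable_of_countable _).aestronglyMeasurable, integral_boolSign_coin]

/-- Variances of independent coins add, so for equal coefficients the second moment grows like `d`,
whereas the largest squared value grows like `d²`. This is the factor `d` by which the one-point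
moment bound is less restrictive than the uniform one. -/
lemma variance_sum_coinLaw_le (η : unitInterval) (s : Fin d → Bool) (c : Fin d → ℝ) :
    Var[fun z : Fin d → Bool => ∑ i, c i * boolSign (z i); coinLaw η s] ≤ ∑ i, c i ^ 2 := by
  have hmeas : ∀ i, Measurable fun z : Fin d → Bool => c i * boolSign (z i) := fun i =>
    measurable_of_countable _
  have hind : iIndepFun (fun i (z : Fin d → Bool) => c i * boolSign (z i)) (coinLaw η s) :=
    iIndepFun_pi (μ := fun i => coin η (s i)) (X := fun i b => c i * boolSign b)
      fun i => (measurable_of_countable _).aemeasurable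
  have hL : ∀ i, MemLp (fun z : Fin d → Bool => c i * boolSign (z i)) 2 (coinLaw η s) := fun i =>
    MemLp.of_bound (hmeas i).aestronglyMeasurable |c i| (ae_of_all _ fun z => by
      rw [Real.norm_eq_abs, abs_mul, abs_boolSign, mul_one])
  have hsum : (fun z : Fin d → Bool => ∑ i, c i * boolSign (z i)) =
      ∑ i, fun z : Fin d → Bool => c i * boolSign (z i) := by
    ext z; simp
  rw [hsum, IndepFun.variance_sum (fun i _ => hL i) fun i _ j _ hij => hind.indepFun hij]
  refine Finset.sum_le_sum fun i _ => ?_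
  refine (variance_le_expectation_sq (hmeas i).aestronglyMeasurable).trans (le_of_eq ?_)
  have : ((fun z : Fin d → Bool => c i * boolSign (z i)) ^ 2) = fun _ => c i ^ 2 := by
    ext z
    simp [mul_pow, boolSign_sq]
  rw [this]
  simp

/-- Independent Gaussian variables with means `θ` and variance `v`. -/
def gaussLaw (v : NNReal) (θ : Fin d → ℝ) : Measure (Fin d → ℝ) :=
  Measure.pi fun i => gaussianReal (θ i) v

instance (v : NNReal) (θ : Fin d → ℝ) : IsProbabilityMeasure (gaussLaw v θ) := by
  unfold gaussLaw; infer_instance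

lemma klDiv_gaussLaw_le {v : NNReal} (hv : v ≠ 0) (θ θ' : Fin d → ℝ) :
    klDiv (gaussLaw v θ) (gaussLaw v θ') ≤
      ENNReal.ofReal ((∑ i, (θ i - θ' i) ^ 2) / (2 * v)) := by
  refine (klDiv_pi_le _ _).trans ?_
  rw [Finset.sum_div, ENNReal.ofReal_sum_of_nonneg fun i _ => by positivity]
  exact Finset.sum_le_sum fun i _ => klDiv_gaussianReal_le _ _ hv

lemma gaussLaw_eq_map (v : NNReal) (θ : Fin d → ℝ) :
    gaussLaw v θ = (gaussLaw v 0).map fun z i => z i + θ i := by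
  unfold gaussLaw
  have h : ∀ i : Fin d, (gaussianReal ((0 : Fin d → ℝ) i) v).map (fun t => t + θ i) =
      gaussianReal (θ i) v := by
    intro i
    rw [gaussianReal_map_add_const]
    simp
  have hs : ∀ i : Fin d, SigmaFinite
      ((gaussianReal ((0 : Fin d → ℝ) i) v).map (fun t => t + θ i)) := by
    intro i; rw [h i]; infer_instance
  rw [Measure.pi_map_pi (f := fun i t => t + θ i) fun i => by fun_prop]
  congr 1
  ext1 i
  exact (h i).symm

lemma integrable_gaussLaw (v : NNReal) (θ : Fin d → ℝ) (i : Fin d) :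
    Integrable (fun z => z i) (gaussLaw v θ) :=
  (measurePreserving_eval (fun i => gaussianReal (θ i) v) i).integrable_comp_of_integrable
    (g := fun t => t) ((memLp_id_gaussianReal 1).integrable le_rfl)

lemma integral_gaussLaw (v : NNReal) (θ : Fin d → ℝ) (i : Fin d) :
    ∫ z, z i ∂(gaussLaw v θ) = θ i := by
  unfold gaussLaw
  rw [integral_comp_eval (μ := fun i => gaussianReal (θ i) v) (i := i) (f := fun t => t)
    (by fun_prop), integral_id_gaussianReal]

lemma lintegral_gaussianReal_sub_sq (m : ℝ) (v : NNReal) :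
    ∫⁻ t, ENNReal.ofReal ((t - m) ^ 2) ∂(gaussianReal m v) = v := by
  have h := evariance_eq_lintegral_ofReal (fun t : ℝ => t) (gaussianReal m v)
  rw [integral_id_gaussianReal] at h
  rw [← h]
  change eVar[id; gaussianReal m v] = v
  rw [← ofReal_variance (memLp_id_gaussianReal 2), variance_id_gaussianReal]
  simp

lemma lintegral_gaussLaw_sub_sq (v : NNReal) (θ : Fin d → ℝ) (i : Fin d) :
    ∫⁻ z, ENNReal.ofReal ((z i - θ i) ^ 2) ∂(gaussLaw v θ) = v := by
  rw [← lintegral_gaussianReal_sub_sq (θ i) v]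
  exact (measurePreserving_eval (fun i => gaussianReal (θ i) v) i).lintegral_comp
    (f := fun t => ENNReal.ofReal ((t - θ i) ^ 2)) (by fun_prop)

/-- Projections of the standard basis vectors onto a plane are short on average. -/
lemma sum_norm_starProjection_single_le (x y : Euc d) :
    ∑ i, ‖(Submodule.span ℝ {x, y}).starProjection (EuclideanSpace.single i (1 : ℝ))‖ ^ 2 ≤ 2 := by
  classical
  set V := Submodule.span ℝ ({x, y} : Set (Euc d)) with hV
  let b := stdOrthonormalBasis ℝ V
  have hrank : Module.finrank ℝ V ≤ 2 := by
    have h := finrank_span_finset_le_card (R := ℝ) ({x, y} : Finset (Euc d))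
    have hc : (({x, y} : Finset (Euc d)) : Set (Euc d)) = {x, y} := by simp
    rw [Set.finrank, hc] at h
    exact h.trans Finset.card_le_two
  have hproj : ∀ w : Euc d, ‖V.starProjection w‖ ^ 2 = ∑ j, ⟪(b j : Euc d), w⟫_ℝ ^ 2 := by
    intro w
    have h := b.sum_sq_norm_inner_right (V.orthogonalProjectionOnto w)
    have h1 : ‖V.starProjection w‖ = ‖V.orthogonalProjectionOnto w‖ := rfl
    rw [h1, ← h]
    refine Finset.sum_congr rfl fun j _ => ?_
    rw [Real.norm_eq_abs, sq_abs]
    congr 1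
    rw [Submodule.coe_inner]
    change ⟪(b j : Euc d), V.starProjection w⟫_ℝ = _
    rw [← Submodule.inner_starProjection_left_eq_right,
      Submodule.starProjection_eq_self_iff.2 (b j).2]
  simp_rw [hproj]
  rw [Finset.sum_comm]
  -- The double sum is the trace of the projection. Summing over `i` first gives the squared norm of
  -- each basis vector of the span, and there are at most two of these.
  have hone : ∀ j, ∑ i, ⟪(b j : Euc d), EuclideanSpace.single i (1 : ℝ)⟫_ℝ ^ 2 = 1 := by
    intro j
    have h1 : ‖(b j : Euc d)‖ ^ 2 = 1 := by
      have : ‖(b j : Euc d)‖ = ‖b j‖ := rfl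
      rw [this, b.norm_eq_one]; norm_num
    rw [EuclideanSpace.real_norm_sq_eq] at h1
    refine Eq.trans ?_ h1
    refine Finset.sum_congr rfl fun i _ => ?_
    simp [EuclideanSpace.inner_single_right]
  simp_rw [hone]
  simpa using hrank

end NoiseLaws

/-! ### From information bounds to error bounds -/

section HardInstances

open InformationTheory

variable {d : ℕ}

/-- The law of the answer to a query when the noise is distributed according to `π`. -/
def obsKernel {A B S : Type*} [MeasurableSpace A] [MeasurableSpace B] [MeasurableSpace S]
    (π : Measure S) [IsProbabilityMeasure π] (O : A → S → B)
    (hO : Measurable (Function.uncurry O)) : Kernel A B where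
  toFun x := π.map (O x)
  measurable' := by
    refine Measure.measurable_of_measurable_coe _ fun s hs => ?_
    have h : ∀ x, π.map (O x) s = π (Prod.mk x ⁻¹' (Function.uncurry O ⁻¹' s)) := fun x =>
      Measure.map_apply (hO.comp measurable_prodMk_left) hs
    simp_rw [h]
    exact measurable_measure_prodMk_left (hO hs)

instance {A B S : Type*} [MeasurableSpace A] [MeasurableSpace B] [MeasurableSpace S]
    (π : Measure S) [IsProbabilityMeasure π] (O : A → S → B)
    (hO : Measurable (Function.uncurry O)) : IsMarkovKernel (obsKernel π O hO) :=
  ⟨fun x => Measure.isProbabilityMeasure_map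
    (hO.comp (measurable_prodMk_left (x := x))).aemeasurable⟩

variable {S : Type} [TopologicalSpace S] [PolishSpace S] [MeasurableSpace S] [BorelSpace S]

/-- The problem with oracle `F` whose noise is the sticky chain with stationary law `π`. -/
abbrev stickyProblem (π : Measure S) [IsProbabilityMeasure π] (p : unitInterval)
    (F : Euc d → S → ℝ) : MarkovProblem d where
  State := S
  Q := stickyKernel π p
  stat := π
  Ω := ℕ → S
  P := chainLaw π (stickyKernel π p)
  Z n ω := ω n
  F := F

/-- The power is at most `exp (-2)`, and `exp 1 ≥ 2`. For `τ ≤ 2` the minimum is 1 and the power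
vanishes. -/
lemma one_sub_min_pow_le {τ : ℕ} (hτ : 1 ≤ τ) : (1 - min 1 (2 / (τ : ℝ))) ^ τ ≤ 1 / 4 := by
  have hτ0 : (0 : ℝ) < τ := by exact_mod_cast hτ
  rcases le_total (1 : ℝ) (2 / τ) with h1 | h1
  · rw [min_eq_left h1, sub_self, zero_pow (by omega)]
    norm_num
  · rw [min_eq_right h1]
    have h2 : 1 - 2 / (τ : ℝ) ≤ Real.exp (-(2 / τ)) := by
      linarith [Real.add_one_le_exp (-(2 / (τ : ℝ)))]
    calc (1 - 2 / (τ : ℝ)) ^ τ ≤ Real.exp (-(2 / τ)) ^ τ :=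
          pow_le_pow_left₀ (by linarith) h2 τ
      _ = Real.exp (-2) := by
          rw [← Real.exp_nat_mul]
          congr 1
          field_simp
      _ ≤ 1 / 4 := by
          rw [Real.exp_neg, one_div]
          refine inv_anti₀ (by norm_num) ?_
          have h3 := Real.add_one_le_exp (1 : ℝ)
          have h4 : Real.exp 2 = Real.exp 1 * Real.exp 1 := by rw [← Real.exp_add]; norm_num
          rw [h4]
          nlinarith

/-- A refresh probability for which the sticky chain has mixing time `τ`. -/
lemma exists_refresh_probability {τ : ℕ} (hτ : 1 ≤ τ) :
    ∃ p : unitInterval, 0 < p ∧ (p : ℝ) ≤ 2 / τ ∧ (1 - (p : ℝ)) ^ τ ≤ 1 / 4 := by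
  have hτ' : (0 : ℝ) < τ := by exact_mod_cast hτ
  have h2 : (0 : ℝ) < 2 / (τ : ℝ) := by positivity
  have h0 : (0 : ℝ) < min 1 (2 / (τ : ℝ)) := lt_min one_pos h2
  refine ⟨⟨min 1 (2 / τ), h0.le, min_le_left _ _⟩, h0, min_le_right _ _, ?_⟩
  exact one_sub_min_pow_le hτ

lemma isMixingChain_stickyProblem (π : Measure S) [IsProbabilityMeasure π] {p : unitInterval}
    (F : Euc d → S → ℝ) {τ : ℕ} (hp : 0 < p) (hτ : (1 - (p : ℝ)) ^ τ ≤ 1 / 4) :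
    IsMixingChain (stickyProblem π p F).Q (stickyProblem π p F).stat (stickyProblem π p F).P
      (stickyProblem π p F).Z τ :=
  isMixingChain_sticky π p τ hp hτ

section LowerBounds

variable {A B : Type} [MeasurableSpace A] [MeasurableSpace B]

/-- A lower bound for independent noise in terms of the information in a single answer. -/
lemma exists_le_error_of_sum_klDiv_obs_le [MeasurableSpace.CountablyGenerated B]
    (a : Algorithm.{u} A B d) (N : ℕ) (π : (Fin d → Bool) → Measure S)
    [∀ s, IsProbabilityMeasure (π s)] (F : (Fin d → Bool) → Euc d → S → ℝ)
    (O : (Fin d → Bool) → A → S → B) (hO : ∀ s, Measurable (Function.uncurry (O s)))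
    {C ρ : ℝ} (hC : N * C ≤ d / 4) (hρ : 0 ≤ ρ)
    (h : ∀ s x, ∑ i, klDiv ((π s).map (O s x)) ((π (flipSign s i)).map (O (flipSign s i) x)) ≤
      ENNReal.ofReal C) :
    ∃ s, ENNReal.ofReal (ρ ^ 2 * d / 8) ≤
      a.error (stickyProblem (π s) 1 (F s)) (O s) N (ρ • signVec s) := by
  have hkl : ∀ s, ∑ i, klDiv (a.transcript (obsKernel (π s) (O s) (hO s)) N)
      (a.transcript (obsKernel (π (flipSign s i)) (O (flipSign s i)) (hO _)) N) ≤
        ENNReal.ofReal (d / 4) := by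
    intro s
    refine (a.sum_klDiv_transcript_le _ (fun i => obsKernel _ _ (hO (flipSign s i)))
      ENNReal.ofReal_ne_top (h s) N).trans ?_
    rw [← ENNReal.ofReal_natCast, ← ENNReal.ofReal_mul (Nat.cast_nonneg N)]
    exact ENNReal.ofReal_le_ofReal hC
  obtain ⟨s, hs⟩ := exists_le_lintegral_of_sum_klDiv_le
    (fun s => a.transcript (obsKernel (π s) (O s) (hO s)) N) (a.measurable_output N) hρ hkl
  refine ⟨s, hs.trans (le_of_eq ?_)⟩
  -- With refresh probability 1 the states are independent. The chain property is needed only for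
  -- this, so mixing time 1 will do.
  have hch : IsMixingChain (stickyKernel (π s) 1) (π s) (stickyProblem (π s) 1 (F s)).P
      (stickyProblem (π s) 1 (F s)).Z 1 :=
    isMixingChain_sticky (π s) 1 1 zero_lt_one (by norm_num)
  exact (a.error_eq_lintegral_transcript (stickyProblem (π s) 1 (F s)) hch (hO s) _
    (fun x => rfl) N (ρ • signVec s)).symm

/-- A lower bound for sticky coins: the oracle is the same for all biases. -/
lemma exists_le_error_coin (a : Algorithm.{u} A B d) (N : ℕ) (p η : unitInterval)
    (hη : 24 * (η : ℝ) ^ 2 * (1 + N * p) ≤ 1) (F : Euc d → (Fin d → Bool) → ℝ)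
    {O : A → (Fin d → Bool) → B} (hO : Measurable (Function.uncurry O)) (hp : 0 < p)
    {ρ : ℝ} (hρ : 0 ≤ ρ) :
    ∃ s, ENNReal.ofReal (ρ ^ 2 * d / 8) ≤
      a.error (stickyProblem (coinLaw η s) p F) O N (ρ • signVec s) := by
  have hp0 : (0 : ℝ) ≤ p := p.2.1
  have hη2 : (η : ℝ) ≤ 1 / 2 := by
    have h1 : 0 ≤ (N : ℝ) * p := by positivity
    have h2 : 0 ≤ (η : ℝ) ^ 2 * (N * p) := by positivity
    nlinarith [η.2.1]
  have hch : ∀ s : Fin d → Bool, ∃ τ, IsMixingChain (stickyKernel (coinLaw η s) p) (coinLaw η s)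
      (chainLaw (coinLaw η s) (stickyKernel (coinLaw η s) p)) (fun n ω => ω n) τ := by
    have hlt : 1 - (p : ℝ) < 1 := by
      have : (0 : ℝ) < p := hp
      linarith
    obtain ⟨τ, hτ⟩ := exists_pow_lt_of_lt_one (by norm_num : (0 : ℝ) < 1 / 4) hlt
    exact fun s => ⟨τ, isMixingChain_sticky _ p τ hp hτ.le⟩
  have hprob : ∀ s : Fin d → Bool, IsProbabilityMeasure (prefixLaw
      (chainLaw (coinLaw η s) (stickyKernel (coinLaw η s) p)) (fun n ω => ω n) N) := by
    intro s
    obtain ⟨τ, hτ⟩ := hch s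
    exact Measure.isProbabilityMeasure_map (hτ.measurable_prefix N).aemeasurable
  -- Since the oracle does not depend on `s`, the output is one fixed function of the seed and the
  -- first `N` states. It suffices to compare the laws of these: the seed is common, and each
  -- neighbour costs at most `6 η² (1 + N p) ≤ 1 / 4`.
  have hkl : ∀ s : Fin d → Bool, ∑ i, klDiv
      (a.law.prod (prefixLaw (chainLaw (coinLaw η s) (stickyKernel (coinLaw η s) p))
        (fun n ω => ω n) N))
      (a.law.prod (prefixLaw (chainLaw (coinLaw η (flipSign s i))
        (stickyKernel (coinLaw η (flipSign s i)) p)) (fun n ω => ω n) N)) ≤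
        ENNReal.ofReal (d / 4) := by
    intro s
    obtain ⟨τ, hτ⟩ := hch s
    calc _ ≤ ∑ _i : Fin d, ENNReal.ofReal ((1 + N * p) * (6 * (η : ℝ) ^ 2)) := by
          refine Finset.sum_le_sum fun i _ => ?_
          obtain ⟨τ', hτ'⟩ := hch (flipSign s i)
          have h1 := klDiv_coinLaw_flipSign_le η hη2 s i
          have hac := absolutelyContinuous_of_klDiv_ne_top
            (ne_top_of_le_ne_top ENNReal.ofReal_ne_top h1)
          refine (klDiv_prod_le _ _ _ _).trans ?_
          rw [klDiv_self, zero_add, ENNReal.ofReal_mul (by positivity)]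
          refine (klDiv_prefixLaw_le hac hτ hτ' N).trans ?_
          gcongr
      _ ≤ ENNReal.ofReal (d / 4) := by
          rw [Finset.sum_const, nsmul_eq_mul, Finset.card_univ, Fintype.card_fin,
            ← ENNReal.ofReal_natCast, ← ENNReal.ofReal_mul (Nat.cast_nonneg d)]
          refine ENNReal.ofReal_le_ofReal ?_
          have : (0 : ℝ) ≤ d := Nat.cast_nonneg d
          nlinarith
  obtain ⟨s, hs⟩ := exists_le_lintegral_of_sum_klDiv_le _ ((a.measurable_output N).comp
    (measurable_fst.prodMk (a.measurable_prefixAnswers hO (fun _ => false) N))) hρ hkl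
  refine ⟨s, hs.trans (le_of_eq ?_)⟩
  exact (a.error_eq_lintegral_prefixLaw (stickyProblem (coinLaw η s) p F)
    (fun n => measurable_pi_apply n) hO _ N _).symm

end LowerBounds

/-! ### The quadratic problem with a random linear term -/

section Quadratic

variable {μ : ℝ} {π : Measure S} [IsProbabilityMeasure π] {Y : S → Fin d → ℝ} {θ : Fin d → ℝ}

/-- The quadratic oracle with random linear part `Y`. -/
def quadOracle (μ : ℝ) (Y : S → Fin d → ℝ) (x : Euc d) (z : S) : ℝ :=
  separable (fun i => quad μ (Y z i)) x

lemma measurable_coord (i : Fin d) : Measurable fun x : Euc d => x i :=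
  (EuclideanSpace.proj (𝕜 := ℝ) i).continuous.measurable

omit [TopologicalSpace S] [PolishSpace S] [BorelSpace S] in
lemma measurable_quadOracle (hY : ∀ i, Measurable fun z => Y z i) :
    Measurable (Function.uncurry (quadOracle μ Y)) := by
  change Measurable fun q : Euc d × S => ∑ i, quad μ (Y q.2 i) (q.1 i)
  refine Finset.measurable_fun_sum _ fun i _ => ?_
  have hx : Measurable fun q : Euc d × S => q.1 i := (measurable_coord i).comp measurable_fst
  have hz : Measurable fun q : Euc d × S => Y q.2 i := (hY i).comp measurable_snd
  exact ((hx.pow_const 2).const_mul (μ / 2)).sub (hz.mul hx)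

omit [TopologicalSpace S] [PolishSpace S] [BorelSpace S] in
lemma integrable_quadOracle (hint : ∀ i, Integrable (fun z => Y z i) π) (x : Euc d) :
    Integrable (quadOracle μ Y x) π := by
  change Integrable (fun z => ∑ i, quad μ (Y z i) (x i)) π
  exact integrable_finsetSum _ fun i _ => (integrable_const _).sub ((hint i).mul_const _)

lemma f_quadProblem (hint : ∀ i, Integrable (fun z => Y z i) π)
    (hmean : ∀ i, ∫ z, Y z i ∂π = θ i) (p : unitInterval) :
    (stickyProblem π p (quadOracle μ Y)).f = separable fun i => quad μ (θ i) := by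
  ext x
  change ∫ z, ∑ i, quad μ (Y z i) (x i) ∂π = ∑ i, quad μ (θ i) (x i)
  have hi : ∀ i, Integrable (fun z => quad μ (Y z i) (x i)) π := fun i =>
    (integrable_const _).sub ((hint i).mul_const _)
  rw [integral_finsetSum _ fun i _ => hi i]
  refine Finset.sum_congr rfl fun i _ => ?_
  unfold quad
  rw [integral_sub (integrable_const _) ((hint i).mul_const _), integral_mul_const (x i), hmean i]
  simp

omit [TopologicalSpace S] [PolishSpace S] [MeasurableSpace S] [BorelSpace S] in
lemma gradient_quadOracle (x : Euc d) (z : S) :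
    ∇ (fun y => quadOracle μ Y y z) x = WithLp.toLp 2 fun i => μ * x i - Y z i :=
  gradient_separable (fun i t => hasDerivAt_quad μ (Y z i) t) x

lemma isLSmooth_quad {L : ℝ} (hμ : 0 < μ) (hL : μ ≤ L) (θ : Fin d → ℝ) :
    IsLSmooth L (separable fun i => quad μ (θ i)) := by
  refine isLSmooth_separable (hμ.le.trans hL) (fun i t => hasDerivAt_quad μ (θ i) t)
    fun i a b => ?_
  rw [show μ * a - θ i - (μ * b - θ i) = μ * (a - b) by ring, abs_mul, abs_of_pos hμ]
  gcongr

lemma isStronglyConvex_quad (μ : ℝ) (θ : Fin d → ℝ) :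
    IsStronglyConvex μ (separable fun i => quad μ (θ i)) :=
  isStronglyConvex_separable (fun i => contDiff_quad μ (θ i))
    (fun i t => hasDerivAt_quad μ (θ i) t) fun i a b => quad_convex μ (θ i) a b

lemma twoPoint_quadProblem {L : ℝ} (hμ : 0 < μ) (hL : μ ≤ L) (hY : ∀ i, Measurable fun z => Y z i)
    (hint : ∀ i, Integrable (fun z => Y z i) π) {p : unitInterval} {τ : ℕ} (hp : 0 < p)
    (hτ : (1 - (p : ℝ)) ^ τ ≤ 1 / 4) :
    (stickyProblem π p (quadOracle μ Y)).TwoPoint L μ τ := by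
  have hf := f_quadProblem (μ := μ) hint (fun i => rfl) p
  have hgi : ∀ (x : Euc d) (i : Fin d), Integrable (fun z =>
      (WithLp.toLp 2 (fun i => μ * x i - Y z i) : Euc d) i) π := fun x i =>
    (integrable_const _).sub (hint i)
  have hg : ∀ x : Euc d, Integrable (fun z =>
      (WithLp.toLp 2 (fun i => μ * x i - Y z i) : Euc d)) π := fun x =>
    integrable_piLp_iff.2 (hgi x)
  refine ⟨isMixingChain_stickyProblem π _ hp hτ, measurable_quadOracle hY,
    fun x => integrable_quadOracle hint x, fun z => isLSmooth_quad hμ hL _, ?_, fun x => ?_,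
    fun x => ?_⟩
  · rw [hf]
    exact isStronglyConvex_quad μ _
  · change Integrable (fun z : S => ∇ (fun y => quadOracle μ Y y z) x) π
    simp_rw [gradient_quadOracle]
    exact hg x
  · rw [hf, gradient_separable fun i t => hasDerivAt_quad μ _ t]
    change ∫ z : S, ∇ (fun y => quadOracle μ Y y z) x ∂π = _
    simp_rw [gradient_quadOracle]
    ext i
    rw [eval_integral_piLp (hgi x)]
    change ∫ z, (μ * x i - Y z i) ∂π = _
    rw [integral_sub (integrable_const _) (hint i)]
    simp

lemma gradNoise_quadProblem (hint : ∀ i, Integrable (fun z => Y z i) π)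
    (hmean : ∀ i, ∫ z, Y z i ∂π = θ i) (p : unitInterval) (x : Euc d) (z : S) :
    ‖∇ (fun y => (stickyProblem π p (quadOracle μ Y)).F y z) x -
      ∇ (stickyProblem π p (quadOracle μ Y)).f x‖ ^ 2 = ∑ i, (Y z i - θ i) ^ 2 := by
  rw [f_quadProblem hint hmean, gradient_separable fun i t => hasDerivAt_quad μ _ t]
  have h := gradient_quadOracle (μ := μ) (Y := Y) x z
  rw [show (stickyProblem π p (quadOracle μ Y)).F = quadOracle μ Y from rfl, h,
    EuclideanSpace.real_norm_sq_eq]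
  refine Finset.sum_congr rfl fun i _ => ?_
  simp only [PiLp.sub_apply]
  ring

lemma quad_minimizer {ρ : ℝ} (hμ : 0 < μ) (s : Fin d → Bool) (x : Euc d) :
    separable (fun i => quad μ (μ * ρ * boolSign (s i))) (ρ • signVec s) ≤
      separable (fun i => quad μ (μ * ρ * boolSign (s i))) x := by
  refine separable_le_of_deriv_eq_zero (φ' := fun i t => μ * t - μ * ρ * boolSign (s i)) hμ.le
    (fun i a b => quad_convex μ _ a b) (fun i => ?_) x
  simp only [PiLp.smul_apply, signVec_apply, smul_eq_mul]
  ring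

end Quadratic

end HardInstances

/-! ### Two-point instances -/

section ErrorBounds

open InformationTheory

variable {d : ℕ}

lemma exists_variance {σ : ℝ} (hσ : 0 < σ) {m : ℕ} (hm : 1 ≤ m) :
    ∃ v : NNReal, v ≠ 0 ∧ (v : ℝ) = σ ^ 2 / (2 * m) := by
  have hm' : (0 : ℝ) < m := by exact_mod_cast hm
  have h : 0 < σ ^ 2 / (2 * m) := by positivity
  exact ⟨⟨_, h.le⟩, fun h0 => h.ne' (congrArg NNReal.toReal h0), rfl⟩

/-- Translations of Gaussian noise are hard to detect from two values of a linear function. -/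
lemma sum_klDiv_quad_gauss_le {v : NNReal} (hv : v ≠ 0) (μ δ : ℝ) (s : Fin d → Bool)
    (q : Euc d × Euc d) :
    ∑ i, klDiv
      ((gaussLaw v fun j => δ * boolSign (s j)).map fun z =>
        (quadOracle μ (fun z : Fin d → ℝ => z) q.1 z, quadOracle μ (fun z : Fin d → ℝ => z) q.2 z))
      ((gaussLaw v fun j => δ * boolSign (flipSign s i j)).map fun z =>
        (quadOracle μ (fun z : Fin d → ℝ => z) q.1 z, quadOracle μ (fun z : Fin d → ℝ => z) q.2 z))
      ≤ ENNReal.ofReal (4 * δ ^ 2 / v) := by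
  have hv' : (0 : ℝ) < v := by positivity
  set V := Submodule.span ℝ ({q.1, q.2} : Set (Euc d)) with hV
  let o : (Fin d → ℝ) → ℝ × ℝ := fun z =>
    (quadOracle μ (fun z : Fin d → ℝ => z) q.1 z, quadOracle μ (fun z : Fin d → ℝ => z) q.2 z)
  have ho : Measurable o := by
    have h := measurable_quadOracle (μ := μ) (Y := fun z : Fin d → ℝ => z)
      fun i => measurable_pi_apply i
    exact (h.comp measurable_prodMk_left).prodMk (h.comp measurable_prodMk_left)
  -- only the projection of the mean to `V` matters
  have hquad : ∀ (x : Euc d) (z θ θ' : Fin d → ℝ),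
      ⟪(WithLp.toLp 2 θ : Euc d), x⟫_ℝ = ⟪(WithLp.toLp 2 θ' : Euc d), x⟫_ℝ →
      quadOracle μ (fun z : Fin d → ℝ => z) x (fun i => z i + θ i) =
        quadOracle μ (fun z : Fin d → ℝ => z) x (fun i => z i + θ' i) := by
    intro x z θ θ' h
    simp only [PiLp.inner_apply, RCLike.inner_apply, conj_trivial] at h
    have e : ∀ θ : Fin d → ℝ, quadOracle μ (fun z : Fin d → ℝ => z) x (fun i => z i + θ i) =
        quadOracle μ (fun z : Fin d → ℝ => z) x z - ∑ i, x i * θ i := by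
      intro θ
      simp only [quadOracle, separable, quad, ← Finset.sum_sub_distrib]
      exact Finset.sum_congr rfl fun i _ => by ring
    rw [e θ, e θ', h]
  have hmap : ∀ θ θ' : Fin d → ℝ,
      (∀ x ∈ V, ⟪(WithLp.toLp 2 θ : Euc d), x⟫_ℝ = ⟪(WithLp.toLp 2 θ' : Euc d), x⟫_ℝ) →
      (gaussLaw v θ).map o = (gaussLaw v θ').map o := by
    intro θ θ' h
    have hm : ∀ θ : Fin d → ℝ, Measurable fun (z : Fin d → ℝ) i => z i + θ i := fun θ =>
      measurable_pi_lambda _ fun i => (measurable_pi_apply i).add_const _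
    rw [gaussLaw_eq_map v θ, gaussLaw_eq_map v θ', Measure.map_map ho (hm θ),
      Measure.map_map ho (hm θ')]
    congr 1
    ext1 z
    exact Prod.ext (hquad _ z θ θ' (h _ (Submodule.subset_span (by simp))))
      (hquad _ z θ θ' (h _ (Submodule.subset_span (by simp))))
  let e : Fin d → Euc d := fun i => EuclideanSpace.single i (1 : ℝ)
  have hstep : ∀ i, klDiv ((gaussLaw v fun j => δ * boolSign (s j)).map o)
      ((gaussLaw v fun j => δ * boolSign (flipSign s i j)).map o) ≤
        ENNReal.ofReal (2 * δ ^ 2 / v * ‖V.starProjection (e i)‖ ^ 2) := by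
    intro i
    let c : ℝ := 2 * δ * boolSign (s i)
    let θ : Fin d → ℝ := fun j => δ * boolSign (s j)
    -- The flip moves the mean by `c • e i`. Keeping only the part of this shift in `V` leaves the
    -- law of the answers unchanged and shrinks the Gaussian divergence to `2 δ² / v` times the
    -- squared length of the projection. These squared lengths sum to at most 2, so no factor `d`
    -- appears.
    let θ' : Fin d → ℝ := fun j => θ j - (c • V.starProjection (e i)) j
    have hflip : (WithLp.toLp 2 (fun j => δ * boolSign (flipSign s i j)) : Euc d) =
        WithLp.toLp 2 θ - c • e i := by
      ext j
      by_cases hj : j = i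
      · subst hj
        simp [flipSign_self, boolSign_not, θ, c, e]
        ring
      · simp [flipSign_of_ne s hj, θ, e, hj]
    have hθ' : (WithLp.toLp 2 θ' : Euc d) = WithLp.toLp 2 θ - c • V.starProjection (e i) := by
      ext j; simp [θ']
    rw [hmap (fun j => δ * boolSign (flipSign s i j)) θ' fun x hx => by
      rw [hflip, hθ', inner_sub_left, inner_sub_left, inner_smul_left, inner_smul_left,
        Submodule.inner_starProjection_left_eq_right, Submodule.starProjection_eq_self_iff.2 hx]]
    refine (klDiv_map_le _ _ ho).trans ((klDiv_gaussLaw_le hv _ _).trans ?_)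
    refine ENNReal.ofReal_le_ofReal (le_of_eq ?_)
    have h1 : ∑ j, (θ j - θ' j) ^ 2 = ‖c • V.starProjection (e i)‖ ^ 2 := by
      rw [EuclideanSpace.real_norm_sq_eq]
      simp [θ']
    change (∑ j, (θ j - θ' j) ^ 2) / (2 * v) = _
    rw [h1, norm_smul, mul_pow, Real.norm_eq_abs, sq_abs]
    simp only [c]
    rw [mul_pow, boolSign_sq, mul_one]
    field_simp
  calc _ ≤ ∑ i, ENNReal.ofReal (2 * δ ^ 2 / v * ‖V.starProjection (e i)‖ ^ 2) :=
        Finset.sum_le_sum fun i _ => hstep i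
    _ ≤ ENNReal.ofReal (4 * δ ^ 2 / v) := by
        rw [← ENNReal.ofReal_sum_of_nonneg fun i _ => by positivity, ← Finset.mul_sum]
        refine ENNReal.ofReal_le_ofReal ?_
        have h2 := sum_norm_starProjection_single_le q.1 q.2
        calc 2 * δ ^ 2 / v * ∑ i, ‖V.starProjection (e i)‖ ^ 2 ≤ 2 * δ ^ 2 / v * 2 := by gcongr
          _ = 4 * δ ^ 2 / v := by ring

/-- The hard quadratic instance with independent Gaussian noise. -/
lemma exists_twoPoint_gauss {τ : ℕ} {L μ σ ε : ℝ} (hd : 1 ≤ d) (hτ : 1 ≤ τ) (hμ : 0 < μ)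
    (hσ : 0 < σ) (hL : μ ≤ L) (hε : 0 < ε) (hε1 : ε ≤ 1 / 9) (a : TwoPointAlgorithm.{u} d) (N : ℕ)
    (hN : 288 * (N * ε * μ ^ 2) ≤ d * σ ^ 2) :
    ∃ p : MarkovProblem d, p.TwoPoint L μ τ ∧ p.GradNoiseMoment σ ∧
      ∃ xs : Euc d, (∀ x, p.f xs ≤ p.f x) ∧ ‖xs‖ ≤ 1 ∧
        ENNReal.ofReal ε < a.error p p.oracle₂ N xs := by
  have hd' : (0 : ℝ) < d := by exact_mod_cast hd
  obtain ⟨v, hv, hvσ⟩ := exists_variance hσ hd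
  have hv' : (0 : ℝ) < v := by positivity
  -- Assouad's bound becomes `9 ε / 8 > ε`, and the minimizer has squared norm `9 ε ≤ 1`. The
  -- variance `v = σ² / (2 d)` makes the total gradient noise `σ² / 2`. The information per query is
  -- then `72 ε μ² / σ²`, and `N` times this is at most `d / 4` by `hN`.
  let ρ : ℝ := Real.sqrt (9 * ε / d)
  have hρ2 : ρ ^ 2 = 9 * ε / d := Real.sq_sqrt (by positivity)
  have hρ : 0 ≤ ρ := Real.sqrt_nonneg _
  let θ : (Fin d → Bool) → Fin d → ℝ := fun s i => μ * ρ * boolSign (s i)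
  let F : Euc d → (Fin d → ℝ) → ℝ := quadOracle μ fun z => z
  let O : Euc d × Euc d → (Fin d → ℝ) → ℝ × ℝ := fun q z => (F q.1 z, F q.2 z)
  have hF : Measurable (Function.uncurry F) := measurable_quadOracle fun i => measurable_pi_apply i
  have hO : Measurable (Function.uncurry O) :=
    (hF.comp ((measurable_fst.comp measurable_fst).prodMk measurable_snd)).prodMk
      (hF.comp ((measurable_snd.comp measurable_fst).prodMk measurable_snd))
  have hint : ∀ s i, Integrable (fun z : Fin d → ℝ => z i) (gaussLaw v (θ s)) := fun s i =>
    integrable_gaussLaw v (θ s) i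
  have hmean : ∀ s i, ∫ z, z i ∂(gaussLaw v (θ s)) = θ s i := fun s i =>
    integral_gaussLaw v (θ s) i
  obtain ⟨s, hs⟩ := exists_le_error_of_sum_klDiv_obs_le a N (fun s => gaussLaw v (θ s))
    (fun _ => F) (fun _ => O) (fun _ => hO) (C := 4 * (μ * ρ) ^ 2 / v) (ρ := ρ) (by
      rw [mul_pow, hρ2, hvσ]
      field_simp
      nlinarith) hρ (fun s q => sum_klDiv_quad_gauss_le hv μ (μ * ρ) s q)
  refine ⟨stickyProblem (gaussLaw v (θ s)) 1 F, ?_, ?_, ρ • signVec s, ?_, ?_, ?_⟩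
  · refine twoPoint_quadProblem hμ hL (fun i => measurable_pi_apply i) (hint s) zero_lt_one ?_
    simp only [Set.Icc.coe_one, sub_self]
    rw [zero_pow (by omega)]
    norm_num
  · intro x
    change ∫⁻ z : Fin d → ℝ, ENNReal.ofReal (‖∇ (fun y => quadOracle μ (fun z => z) y z) x -
      ∇ (stickyProblem (gaussLaw v (θ s)) 1 (quadOracle μ fun z => z)).f x‖ ^ 2)
        ∂(gaussLaw v (θ s)) < _
    have h1 : ∀ z : Fin d → ℝ, ENNReal.ofReal (‖∇ (fun y => quadOracle μ (fun z => z) y z) x -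
        ∇ (stickyProblem (gaussLaw v (θ s)) 1 (quadOracle μ fun z => z)).f x‖ ^ 2) =
        ∑ i, ENNReal.ofReal ((z i - θ s i) ^ 2) := fun z => by
      rw [gradNoise_quadProblem (hint s) (hmean s) 1 x z,
        ENNReal.ofReal_sum_of_nonneg fun i _ => sq_nonneg _]
    simp_rw [h1]
    rw [lintegral_finsetSum _ fun i _ => by fun_prop]
    simp_rw [lintegral_gaussLaw_sub_sq]
    rw [Finset.sum_const, nsmul_eq_mul, Finset.card_univ, Fintype.card_fin,
      ← ENNReal.ofReal_natCast, ← ENNReal.ofReal_coe_nnreal, ← ENNReal.ofReal_mul hd'.le, hvσ,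
      ENNReal.ofReal_lt_ofReal_iff (by positivity)]
    rw [show (d : ℝ) * (σ ^ 2 / (2 * d)) = σ ^ 2 / 2 by field_simp]
    have : 0 < σ ^ 2 := by positivity
    linarith
  · intro x
    rw [f_quadProblem (hint s) (hmean s) 1]
    exact quad_minimizer hμ s x
  · refine norm_smul_signVec_le ?_ s
    rw [hρ2]
    field_simp
    linarith
  · refine lt_of_lt_of_le ?_ hs
    rw [ENNReal.ofReal_lt_ofReal_iff_of_nonneg hε.le, hρ2]
    field_simp
    norm_num

/-- The hard quadratic instance with sticky coins. -/
lemma exists_twoPoint_coin {τ : ℕ} {L μ σ ε : ℝ} (hd : 1 ≤ d) (hτ : 1 ≤ τ) (hμ : 0 < μ)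
    (hσ : 0 < σ) (hL : μ ≤ L) (hε : 0 < ε) (hε1 : ε ≤ 1 / 9)
    (hεσ : 3456 * (ε * μ ^ 2) ≤ σ ^ 2) (a : TwoPointAlgorithm.{u} d) (N : ℕ)
    (hN : 6912 * (N * ε * μ ^ 2) ≤ τ * σ ^ 2) :
    ∃ p : MarkovProblem d, p.TwoPoint L μ τ ∧ p.GradNoiseMoment σ ∧ p.GradNoiseUniform σ ∧
      ∃ xs : Euc d, (∀ x, p.f xs ≤ p.f x) ∧ ‖xs‖ ≤ 1 ∧
        ENNReal.ofReal ε < a.error p p.oracle₂ N xs := by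
  have hd' : (0 : ℝ) < d := by exact_mod_cast hd
  have hτ' : (0 : ℝ) < τ := by exact_mod_cast hτ
  obtain ⟨p, hp, hp2, hpτ⟩ := exists_refresh_probability hτ
  let ρ : ℝ := Real.sqrt (9 * ε / d)
  have hρ2 : ρ ^ 2 = 9 * ε / d := Real.sq_sqrt (by positivity)
  have hρ : 0 < ρ := Real.sqrt_pos.2 (by positivity)
  -- The coins are scaled by `1 / η` to have means `± μ ρ`, so the squared gradient noise is at most
  -- `d (2 μ ρ / η)² = 36 ε μ² / η²`. This choice of `η` makes the bound equal to `σ² / 2`, meeting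
  -- the moment and the uniform condition at once.
  let ηr : ℝ := Real.sqrt (72 * (ε * μ ^ 2) / σ ^ 2)
  have hηr2 : ηr ^ 2 = 72 * (ε * μ ^ 2) / σ ^ 2 := Real.sq_sqrt (by positivity)
  have hηr : 0 < ηr := Real.sqrt_pos.2 (by positivity)
  have hηr1 : ηr ≤ 1 := by
    have : ηr ^ 2 ≤ 1 ^ 2 := by
      rw [hηr2, div_le_iff₀ (by positivity)]
      nlinarith [mul_pos hε (pow_pos hμ 2)]
    exact abs_le_of_sq_le_sq' this zero_le_one |>.2
  let η : unitInterval := ⟨ηr, hηr.le, hηr1⟩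
  let β : ℝ := ηr⁻¹
  have hβ1 : 1 ≤ β := (one_le_inv₀ hηr).2 hηr1
  have hcond : 24 * (η : ℝ) ^ 2 * (1 + N * p) ≤ 1 := by
    change 24 * ηr ^ 2 * (1 + N * p) ≤ 1
    have h1 : 24 * ηr ^ 2 ≤ 1 / 2 := by
      rw [hηr2, ← mul_div_assoc, div_le_iff₀ (by positivity)]
      linarith
    have h2 : 24 * ηr ^ 2 * (N * p) ≤ 1 / 2 := by
      calc 24 * ηr ^ 2 * (N * p) ≤ 24 * ηr ^ 2 * (N * (2 / τ)) := by gcongr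
        _ = 3456 * (N * ε * μ ^ 2) / (τ * σ ^ 2) := by
            rw [hηr2]; field_simp; ring
        _ ≤ 1 / 2 := by
            rw [div_le_iff₀ (by positivity)]
            linarith
    linarith
  let Y : (Fin d → Bool) → Fin d → ℝ := fun z i => μ * ρ * β * boolSign (z i)
  let θ : (Fin d → Bool) → Fin d → ℝ := fun s i => μ * ρ * boolSign (s i)
  let F : Euc d → (Fin d → Bool) → ℝ := quadOracle μ Y
  let O : Euc d × Euc d → (Fin d → Bool) → ℝ × ℝ := fun q z => (F q.1 z, F q.2 z)
  have hY : ∀ i, Measurable fun z => Y z i := fun i => measurable_of_countable _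
  have hF : Measurable (Function.uncurry F) := measurable_quadOracle hY
  have hO : Measurable (Function.uncurry O) :=
    (hF.comp ((measurable_fst.comp measurable_fst).prodMk measurable_snd)).prodMk
      (hF.comp ((measurable_snd.comp measurable_fst).prodMk measurable_snd))
  have hint : ∀ s i, Integrable (fun z => Y z i) (coinLaw η s) := fun s i => .of_finite
  have hmean : ∀ s i, ∫ z, Y z i ∂(coinLaw η s) = θ s i := by
    intro s i
    simp only [Y, θ]
    rw [integral_const_mul, integral_boolSign_coinLaw]
    change μ * ρ * ηr⁻¹ * (ηr * boolSign (s i)) = _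
    field_simp
  obtain ⟨s, hs⟩ := exists_le_error_coin a N p η hcond F hO hp hρ.le
  have hnoise : ∀ (x : Euc d) (z : Fin d → Bool),
      ‖∇ (fun y => (stickyProblem (coinLaw η s) p F).F y z) x -
        ∇ (stickyProblem (coinLaw η s) p F).f x‖ ^ 2 ≤ σ ^ 2 / 2 := by
    intro x z
    rw [gradNoise_quadProblem (hint s) (hmean s) p x z]
    calc ∑ i, (Y z i - θ s i) ^ 2 ≤ ∑ _i : Fin d, (2 * (μ * ρ * β)) ^ 2 := by
          refine Finset.sum_le_sum fun i _ => ?_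
          rw [← sq_abs]
          refine pow_le_pow_left₀ (abs_nonneg _) ?_ 2
          have h1 : |Y z i| = μ * ρ * β := by
            simp only [Y]
            rw [abs_mul, abs_boolSign, mul_one, abs_of_pos (by positivity)]
          have h2 : |θ s i| = μ * ρ := by
            simp only [θ]
            rw [abs_mul, abs_boolSign, mul_one, abs_of_pos (by positivity)]
          have h3 : μ * ρ ≤ μ * ρ * β := le_mul_of_one_le_right (by positivity) hβ1
          calc |Y z i - θ s i| ≤ |Y z i| + |θ s i| := abs_sub _ _
            _ ≤ 2 * (μ * ρ * β) := by rw [h1, h2]; linarith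
      _ = σ ^ 2 / 2 := by
          rw [Finset.sum_const, nsmul_eq_mul, Finset.card_univ, Fintype.card_fin]
          rw [show (d : ℝ) * (2 * (μ * ρ * β)) ^ 2 = d * (4 * μ ^ 2 * ρ ^ 2 * (ηr ^ 2)⁻¹) by
            simp only [β]; ring, hρ2, hηr2]
          field_simp
          norm_num
  refine ⟨stickyProblem (coinLaw η s) p F, twoPoint_quadProblem hμ hL hY (hint s) hp hpτ, ?_, ?_,
    ρ • signVec s, ?_, ?_, ?_⟩
  · intro x
    refine lt_of_le_of_lt (lintegral_mono fun z => ENNReal.ofReal_le_ofReal (hnoise x z)) ?_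
    rw [lintegral_const, measure_univ, mul_one, ENNReal.ofReal_lt_ofReal_iff (by positivity)]
    have : 0 < σ ^ 2 := by positivity
    linarith
  · intro x z
    refine (hnoise x z).trans ?_
    have : 0 < σ ^ 2 := by positivity
    linarith
  · intro x
    rw [f_quadProblem (hint s) (hmean s) p]
    exact quad_minimizer hμ s x
  · refine norm_smul_signVec_le ?_ s
    rw [hρ2]
    field_simp
    linarith
  · refine lt_of_lt_of_le ?_ hs
    rw [ENNReal.ofReal_lt_ofReal_iff_of_nonneg hε.le, hρ2]
    field_simp
    norm_num

end ErrorBounds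

/-! ### One-point instances -/

section OnePointInstances

open InformationTheory

variable {d : ℕ}

/-- A smooth strongly convex function whose minimizer depends on the coefficients `w` of its
oscillating part. -/
def sinObjective (μ e : ℝ) (w : Fin d → ℝ) : Euc d → ℝ :=
  separable fun i => sinQuad μ e (w i)

lemma sinObjective_sub (μ e : ℝ) (w w' : Fin d → ℝ) (x : Euc d) :
    sinObjective μ e w x - sinObjective μ e w' x =
      ∑ i, μ * e ^ 2 * ((w' i - w i) * Real.sin (x i / e)) := by
  simp only [sinObjective, separable, sinQuad, ← Finset.sum_sub_distrib]
  exact Finset.sum_congr rfl fun i _ => by ring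

lemma abs_sinObjective_sub_le {μ e : ℝ} (hμ : 0 ≤ μ) (w w' : Fin d → ℝ) (x : Euc d) :
    |sinObjective μ e w x - sinObjective μ e w' x| ≤ μ * e ^ 2 * ∑ i, |w' i - w i| := by
  rw [sinObjective_sub, Finset.mul_sum]
  refine (Finset.abs_sum_le_sum_abs _ _).trans (Finset.sum_le_sum fun i _ => ?_)
  rw [abs_mul (μ * e ^ 2), abs_mul (w' i - w i), abs_of_nonneg (by positivity : 0 ≤ μ * e ^ 2)]
  have := Real.abs_sin_le_one (x i / e)
  gcongr
  exact mul_le_of_le_one_right (abs_nonneg _) this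

lemma measurable_sinObjective {S : Type*} [MeasurableSpace S] (μ e : ℝ) {w : S → Fin d → ℝ}
    (hw : ∀ i, Measurable fun z => w z i) :
    Measurable (Function.uncurry fun (x : Euc d) z => sinObjective μ e (w z) x) := by
  change Measurable fun q : Euc d × S => ∑ i, sinQuad μ e (w q.2 i) (q.1 i)
  refine Finset.measurable_fun_sum _ fun i _ => ?_
  have hx : Measurable fun q : Euc d × S => q.1 i := (measurable_coord i).comp measurable_fst
  have hz : Measurable fun q : Euc d × S => w q.2 i := (hw i).comp measurable_snd
  unfold sinQuad
  fun_prop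

lemma isLSmooth_sinObjective {L μ e : ℝ} (hμ : 0 < μ) (he : 0 < e) (hL : 3 * μ ≤ L)
    (s : Fin d → Bool) : IsLSmooth L (sinObjective μ e fun i => boolSign (s i)) :=
  isLSmooth_separable ((by positivity : 0 ≤ 3 * μ).trans hL)
    (fun i t => hasDerivAt_sinQuad μ e (boolSign (s i)) t) fun i a b =>
      (sinQuad_lipschitz hμ he (abs_boolSign (s i)) a b).trans (by gcongr)

lemma isStronglyConvex_sinObjective {μ e : ℝ} (hμ : 0 < μ) (he : 0 < e) (s : Fin d → Bool) :
    IsStronglyConvex μ (sinObjective μ e fun i => boolSign (s i)) :=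
  isStronglyConvex_separable (fun _ => contDiff_sinQuad μ e _)
    (fun _ t => hasDerivAt_sinQuad μ e _ t) fun i a b =>
      sinQuad_convex hμ he (abs_boolSign (s i)) a b

lemma sinObjective_minimizer {μ e r : ℝ} (hμ : 0 < μ) (he : 0 < e) (hr : 2 * r = Real.cos r)
    (s : Fin d → Bool) (x : Euc d) :
    sinObjective μ e (fun i => boolSign (s i)) ((e * r) • signVec s) ≤
      sinObjective μ e (fun i => boolSign (s i)) x := by
  refine separable_le_of_deriv_eq_zero hμ.le
    (fun i a b => sinQuad_convex hμ he (abs_boolSign (s i)) a b) (fun i => ?_) x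
  simpa only [PiLp.smul_apply, signVec_apply, smul_eq_mul] using
    sinQuad_deriv_eq_zero he hr (s i)

/-- The hard oscillating instance with Gaussian noise. -/
lemma exists_onePoint_gauss {τ : ℕ} {L μ σ ε : ℝ} (hd : 1 ≤ d) (hτ : 1 ≤ τ) (hμ : 0 < μ)
    (hσ : 0 < σ) (hL : 3 * μ ≤ L) (hε : 0 < ε) (hε1 : ε ≤ 1 / 73) (a : OnePointAlgorithm.{u} d)
    (N : ℕ) (hN : 16 * 73 ^ 2 * (N * ε ^ 2 * μ ^ 2) ≤ d ^ 2 * σ ^ 2) :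
    ∃ p : MarkovProblem d, p.OnePoint L μ τ ∧ p.ValueNoiseMoment σ ∧
      ∃ xs : Euc d, (∀ x, p.f xs ≤ p.f x) ∧ ‖xs‖ ≤ 1 ∧
        ENNReal.ofReal ε < a.error p p.oracle₁ N xs := by
  have hd' : (0 : ℝ) < d := by exact_mod_cast hd
  obtain ⟨v, hv, hvσ⟩ := exists_variance hσ le_rfl
  have hv' : (0 : ℝ) < v := by positivity
  rw [Nat.cast_one, mul_one] at hvσ
  obtain ⟨r, hr3, hr2, hr⟩ := exists_two_mul_eq_cos
  -- The minimizer is `(e * r) • signVec s`, so Assouad's bound reads `73 r² ε / 8 > ε`. Here the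
  -- noise is a single Gaussian added to the value, with the same law for all `s`, and `s` enters
  -- through the objective. A flip shifts the mean of an answer by at most `2 μ e²`.
  let e : ℝ := Real.sqrt (73 * ε / d)
  have he2 : e ^ 2 = 73 * ε / d := Real.sq_sqrt (by positivity)
  have he : 0 < e := Real.sqrt_pos.2 (by positivity)
  let f : (Fin d → Bool) → Euc d → ℝ := fun s => sinObjective μ e fun i => boolSign (s i)
  let F : (Fin d → Bool) → Euc d → ℝ → ℝ := fun s x z => f s x + z
  have hfm : ∀ s, Measurable (f s) := fun s =>
    (measurable_sinObjective (S := Unit) μ e (w := fun _ i => boolSign (s i))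
      fun i => measurable_const).comp (measurable_id.prodMk (measurable_const (a := ())))
  have hF : ∀ s, Measurable (Function.uncurry (F s)) := fun s =>
    ((hfm s).comp measurable_fst).add measurable_snd
  have hid : Integrable (fun z : ℝ => z) (gaussianReal 0 v) :=
    (memLp_id_gaussianReal 1).integrable le_rfl
  have hf : ∀ s, (stickyProblem (gaussianReal 0 v) 1 (F s)).f = f s := by
    intro s
    ext x
    change ∫ z, (f s x + z) ∂(gaussianReal 0 v) = f s x
    rw [integral_add (integrable_const _) hid, integral_id_gaussianReal]
    simp
  have hkl : ∀ s x, ∑ i, klDiv ((gaussianReal 0 v).map (F s x))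
      ((gaussianReal 0 v).map (F (flipSign s i) x)) ≤
        ENNReal.ofReal (d * (4 * μ ^ 2 * e ^ 4 / σ ^ 2)) := by
    intro s x
    have h1 : ∀ s, (gaussianReal 0 v).map (F s x) = gaussianReal (f s x) v := by
      intro s
      have h := gaussianReal_map_const_add (μ := 0) (v := v) (f s x)
      rwa [zero_add] at h
    have h2 : ∀ i, klDiv ((gaussianReal 0 v).map (F s x))
        ((gaussianReal 0 v).map (F (flipSign s i) x)) ≤
          ENNReal.ofReal (4 * μ ^ 2 * e ^ 4 / σ ^ 2) := by
      intro i
      rw [h1, h1]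
      refine (klDiv_gaussianReal_le _ _ hv).trans (ENNReal.ofReal_le_ofReal ?_)
      have h3 : |f s x - f (flipSign s i) x| ≤ μ * e ^ 2 * 2 := by
        refine (abs_sinObjective_sub_le hμ.le _ _ x).trans ?_
        gcongr
        rw [Finset.sum_eq_single i]
        · rw [flipSign_self]
          refine (abs_sub _ _).trans ?_
          rw [abs_boolSign, abs_boolSign]
          norm_num
        · intro j _ hj
          rw [flipSign_of_ne s hj, sub_self, abs_zero]
        · simp
      have h4 := pow_le_pow_left₀ (abs_nonneg _) h3 2
      rw [sq_abs] at h4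
      rw [hvσ, show 2 * (σ ^ 2 / 2) = σ ^ 2 by ring]
      gcongr
      refine h4.trans (le_of_eq (by ring))
    refine (Finset.sum_le_sum fun i _ => h2 i).trans ?_
    rw [Finset.sum_const, nsmul_eq_mul, Finset.card_univ, Fintype.card_fin,
      ENNReal.ofReal_mul hd'.le, ENNReal.ofReal_natCast]
  obtain ⟨s, hs⟩ := exists_le_error_of_sum_klDiv_obs_le a N (fun _ => gaussianReal 0 v) F F hF
    (C := d * (4 * μ ^ 2 * e ^ 4 / σ ^ 2)) (ρ := e * r) (by
      rw [show e ^ 4 = (e ^ 2) ^ 2 by ring, he2]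
      rw [show (N : ℝ) * (d * (4 * μ ^ 2 * (73 * ε / d) ^ 2 / σ ^ 2)) =
        (16 * 73 ^ 2 * (N * ε ^ 2 * μ ^ 2)) / (4 * d * σ ^ 2) by field_simp; ring]
      rw [div_le_iff₀ (by positivity)]
      refine hN.trans (le_of_eq (by ring))) (by positivity) hkl
  have hp : (1 - ((1 : unitInterval) : ℝ)) ^ τ ≤ 1 / 4 := by
    rw [Set.Icc.coe_one, sub_self, zero_pow (by omega)]
    norm_num
  refine ⟨stickyProblem (gaussianReal 0 v) 1 (F s),
    ⟨isMixingChain_stickyProblem _ _ zero_lt_one hp, hF s, fun x => (integrable_const _).add hid,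
      ?_, ?_⟩, ?_, (e * r) • signVec s, ?_, ?_, ?_⟩
  · rw [hf s]
    exact isLSmooth_sinObjective hμ he hL s
  · rw [hf s]
    exact isStronglyConvex_sinObjective hμ he s
  · intro x
    rw [hf s]
    change ∫⁻ z, ENNReal.ofReal (|f s x + z - f s x| ^ 2) ∂(gaussianReal 0 v) < _
    have h := lintegral_gaussianReal_sub_sq 0 v
    simp_rw [add_sub_cancel_left, sq_abs]
    simp_rw [sub_zero] at h
    rw [h, ← ENNReal.ofReal_coe_nnreal, hvσ, ENNReal.ofReal_lt_ofReal_iff (by positivity)]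
    have : 0 < σ ^ 2 := by positivity
    linarith
  · intro x
    rw [hf s]
    exact sinObjective_minimizer hμ he hr s x
  · refine norm_smul_signVec_le ?_ s
    rw [mul_pow, he2, show 73 * ε / d * r ^ 2 * d = 73 * ε * r ^ 2 by field_simp]
    nlinarith
  · refine lt_of_lt_of_le ?_ hs
    rw [ENNReal.ofReal_lt_ofReal_iff_of_nonneg hε.le, mul_pow, he2,
      show 73 * ε / d * r ^ 2 * d / 8 = ε * (73 * r ^ 2 / 8) by field_simp]
    exact lt_mul_of_one_lt_right hε (by nlinarith)

/-- The hard oscillating instance with sticky coins of bias `η`. -/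
lemma exists_onePoint_coin {τ : ℕ} {L μ ε η : ℝ} (hd : 1 ≤ d) (hτ : 1 ≤ τ) (hμ : 0 < μ)
    (hL : 3 * μ ≤ L) (hε : 0 < ε) (hε1 : ε ≤ 1 / 73) (hη : 0 < η) (hη1 : 48 * η ^ 2 ≤ 1)
    (a : OnePointAlgorithm.{u} d) (N : ℕ) (hN : 96 * (N * η ^ 2) ≤ τ) :
    ∃ p : MarkovProblem d, p.OnePoint L μ τ ∧
      (∀ σ, (73 * μ * ε) ^ 2 < d * (η ^ 2 * σ ^ 2) → p.ValueNoiseMoment σ) ∧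
      (∀ σ, 146 * μ * ε ≤ η * σ → p.ValueNoiseUniform σ) ∧
      ∃ xs : Euc d, (∀ x, p.f xs ≤ p.f x) ∧ ‖xs‖ ≤ 1 ∧
        ENNReal.ofReal ε < a.error p p.oracle₁ N xs := by
  have hd' : (0 : ℝ) < d := by exact_mod_cast hd
  have hτ' : (0 : ℝ) < τ := by exact_mod_cast hτ
  obtain ⟨p, hp, hp2, hpτ⟩ := exists_refresh_probability hτ
  obtain ⟨r, hr3, hr2, hr⟩ := exists_two_mul_eq_cos
  let e : ℝ := Real.sqrt (73 * ε / d)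
  have he2 : e ^ 2 = 73 * ε / d := Real.sq_sqrt (by positivity)
  have he : 0 < e := Real.sqrt_pos.2 (by positivity)
  have hη1' : η ≤ 1 := by nlinarith
  let η' : unitInterval := ⟨η, hη.le, hη1'⟩
  have hcond : 24 * (η' : ℝ) ^ 2 * (1 + N * p) ≤ 1 := by
    change 24 * η ^ 2 * (1 + N * p) ≤ 1
    have h2 : 24 * η ^ 2 * (N * p) ≤ 1 / 2 := by
      calc 24 * η ^ 2 * (N * p) ≤ 24 * η ^ 2 * (N * (2 / τ)) := by gcongr
        _ = 48 * (N * η ^ 2) / τ := by ring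
        _ ≤ 1 / 2 := by
            rw [div_le_iff₀ hτ']
            linarith
    linarith
  -- Dividing the coins by their bias makes the mean coefficients equal to the signs `s`. The oracle
  -- is thus unbiased although it is the same for all `s`.
  let β : ℝ := η⁻¹
  have hβ : 0 < β := inv_pos.2 hη
  have hβ1 : 1 ≤ β := (one_le_inv₀ hη).2 hη1'
  let F : Euc d → (Fin d → Bool) → ℝ := fun x z => sinObjective μ e (fun i => β * boolSign (z i)) x
  have hF : Measurable (Function.uncurry F) :=
    measurable_sinObjective μ e (w := fun (z : Fin d → Bool) i => β * boolSign (z i))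
      fun i => measurable_of_countable _
  obtain ⟨s, hs⟩ := exists_le_error_coin a N p η' hcond F hF hp (ρ := e * r) (by positivity)
  let f : Euc d → ℝ := sinObjective μ e fun i => boolSign (s i)
  -- At fixed `x` the noise is a centred linear combination of independent coins with coefficients
  -- at most `μ e² / η`. Its variance is at most `(73 μ ε)² / (d η²)`, while its pointwise size is
  -- only bounded by `146 μ ε / η`.
  let c : Euc d → Fin d → ℝ := fun x i => -(μ * e ^ 2 * β * Real.sin (x i / e))
  let X : Euc d → (Fin d → Bool) → ℝ := fun x z => ∑ i, c x i * boolSign (z i)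
  have hXmean : ∀ x, ∫ z, X x z ∂(coinLaw η' s) = ∑ i, c x i * (η * boolSign (s i)) := by
    intro x
    simp only [X]
    rw [integral_finsetSum _ fun i _ => .of_finite]
    refine Finset.sum_congr rfl fun i _ => ?_
    rw [integral_const_mul, integral_boolSign_coinLaw]
  have hFX : ∀ x z, F x z = f x + (X x z - ∫ z, X x z ∂(coinLaw η' s)) := by
    intro x z
    rw [hXmean, ← sub_eq_iff_eq_add']
    change sinObjective μ e _ x - sinObjective μ e _ x = _
    rw [sinObjective_sub]
    simp only [X, ← Finset.sum_sub_distrib]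
    refine Finset.sum_congr rfl fun i _ => ?_
    simp only [c, β]
    field_simp
    ring
  have hf : (stickyProblem (coinLaw η' s) p F).f = f := by
    ext x
    change ∫ z, F x z ∂(coinLaw η' s) = f x
    simp_rw [hFX]
    rw [integral_add (integrable_const _) .of_finite, integral_sub .of_finite (integrable_const _)]
    simp
  refine ⟨stickyProblem (coinLaw η' s) p F,
    ⟨isMixingChain_stickyProblem _ _ hp hpτ, hF, fun x => .of_finite, ?_, ?_⟩, ?_, ?_,
      (e * r) • signVec s, ?_, ?_, ?_⟩
  · rw [hf]
    exact isLSmooth_sinObjective hμ he hL s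
  · rw [hf]
    exact isStronglyConvex_sinObjective hμ he s
  · intro σ hσ x
    rw [hf]
    change ∫⁻ z, ENNReal.ofReal (|F x z - f x| ^ 2) ∂(coinLaw η' s) < _
    simp_rw [hFX, add_sub_cancel_left, sq_abs]
    have hXm : MemLp (X x) 2 (coinLaw η' s) := .of_discrete
    rw [← evariance_eq_lintegral_ofReal, ← ofReal_variance hXm]
    have hσ0 : 0 < σ ^ 2 := by
      by_contra! h
      have : (d : ℝ) * (η ^ 2 * σ ^ 2) ≤ 0 := by
        have : η ^ 2 * σ ^ 2 ≤ 0 := mul_nonpos_of_nonneg_of_nonpos (sq_nonneg _) h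
        nlinarith
      nlinarith [sq_nonneg (73 * μ * ε)]
    rw [ENNReal.ofReal_lt_ofReal_iff hσ0]
    refine (variance_sum_coinLaw_le η' s (c x)).trans_lt ?_
    calc ∑ i, c x i ^ 2 ≤ ∑ _i : Fin d, (μ * e ^ 2 * β) ^ 2 := by
          refine Finset.sum_le_sum fun i _ => ?_
          simp only [c]
          rw [neg_sq, mul_pow _ (Real.sin _)]
          exact mul_le_of_le_one_right (by positivity) (Real.sin_sq_le_one _)
      _ = (73 * μ * ε) ^ 2 / (d * η ^ 2) := by
          rw [Finset.sum_const, nsmul_eq_mul, Finset.card_univ, Fintype.card_fin, he2]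
          simp only [β]
          field_simp
      _ < σ ^ 2 := by
          rw [div_lt_iff₀ (by positivity)]
          exact hσ.trans_eq (by ring)
  · intro σ hσ x z
    rw [hf]
    change |F x z - f x| ^ 2 ≤ σ ^ 2
    refine pow_le_pow_left₀ (abs_nonneg _) ((abs_sinObjective_sub_le hμ.le _ _ x).trans ?_) 2
    calc μ * e ^ 2 * ∑ i, |boolSign (s i) - β * boolSign (z i)|
        ≤ μ * e ^ 2 * ∑ _i : Fin d, 2 * β := by
          gcongr with i
          refine (abs_sub _ _).trans ?_
          rw [abs_mul, abs_boolSign, abs_boolSign, abs_of_pos hβ]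
          linarith
      _ = 146 * μ * ε / η := by
          rw [Finset.sum_const, nsmul_eq_mul, Finset.card_univ, Fintype.card_fin, he2]
          simp only [β]
          field_simp
          norm_num
      _ ≤ σ := by
          rw [div_le_iff₀ hη]
          linarith
  · intro x
    rw [hf]
    exact sinObjective_minimizer hμ he hr s x
  · refine norm_smul_signVec_le ?_ s
    rw [mul_pow, he2, show 73 * ε / d * r ^ 2 * d = 73 * ε * r ^ 2 by field_simp]
    nlinarith
  · refine lt_of_lt_of_le ?_ hs
    rw [ENNReal.ofReal_lt_ofReal_iff_of_nonneg hε.le, mul_pow, he2,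
      show 73 * ε / d * r ^ 2 * d / 8 = ε * (73 * r ^ 2 / 8) by field_simp]
    exact lt_mul_of_one_lt_right hε (by nlinarith)

end OnePointInstances

/-! ### Combination of the instances; rates and complexities -/

section Rates

variable {d τ : ℕ} {L μ σ : ℝ}

lemma eventually_nhdsGT_mul_pow_le (C : ℝ) {B : ℝ} (hB : 0 < B) {m : ℕ} (hm : m ≠ 0) :
    ∀ᶠ ε : ℝ in 𝓝[>] 0, C * ε ^ m ≤ B := by
  have h : Tendsto (fun ε : ℝ => C * ε ^ m) (𝓝[>] 0) (𝓝 0) := by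
    have h0 : Tendsto (fun ε : ℝ => C * ε ^ m) (𝓝 0) (𝓝 (C * 0 ^ m)) :=
      Continuous.tendsto (by fun_prop) 0
    rw [zero_pow hm, mul_zero] at h0
    exact h0.mono_left nhdsWithin_le_nhds
  exact (h.eventually_lt_const hB).mono fun ε hε => hε.le

/-- Gaussian noise serves when `τ ≤ d` and sticky coins otherwise, and `d + τ` is at most twice the
larger of the two. Smallness of `ε` keeps the minimizer in the unit ball and the bias of the coins
small. -/
lemma eventually_onePoint_moment (hd : 1 ≤ d) (hτ : 1 ≤ τ) (hμ : 0 < μ) (hσ : 0 < σ)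
    (hL : 3 * μ ≤ L) : ∀ᶠ ε : ℝ in 𝓝[>] 0, ∀ N : ℕ,
      384 * 73 ^ 2 * (N * ε ^ 2 * μ ^ 2) ≤ (d : ℝ) * ((d : ℝ) + τ) * σ ^ 2 →
        ∀ a : OnePointAlgorithm.{u} d, ∃ p : MarkovProblem d, p.OnePoint L μ τ ∧
          p.ValueNoiseMoment σ ∧ ∃ xs : Euc d, (∀ x, p.f xs ≤ p.f x) ∧ ‖xs‖ ≤ 1 ∧
            ENNReal.ofReal ε < a.error p p.oracle₁ N xs := by
  have hd' : (1 : ℝ) ≤ d := by exact_mod_cast hd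
  have hd0 : (0 : ℝ) < d := by linarith
  have hσ2 : 0 < σ ^ 2 := by positivity
  filter_upwards [self_mem_nhdsWithin, eventually_nhdsGT_mul_pow_le 73 one_pos one_ne_zero,
    eventually_nhdsGT_mul_pow_le (96 * 73 ^ 2 * μ ^ 2) hσ2 two_ne_zero] with ε hε hε1 hε2 N hN a
  replace hε : 0 < ε := hε
  rw [pow_one] at hε1
  rcases le_or_gt τ d with h | h
  · refine exists_onePoint_gauss hd hτ hμ hσ hL hε (by linarith) a N ?_
    have h' : (τ : ℝ) ≤ d := by exact_mod_cast h
    have h1 : (d : ℝ) * (d + τ) * σ ^ 2 ≤ 2 * (d ^ 2 * σ ^ 2) := by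
      rw [show 2 * ((d : ℝ) ^ 2 * σ ^ 2) = d * (d + d) * σ ^ 2 by ring]
      gcongr
    have h2 : 0 ≤ N * ε ^ 2 * μ ^ 2 := by positivity
    linarith
  · have h' : (d : ℝ) ≤ τ := by exact_mod_cast h.le
    -- This gives `d η² σ² = 2 (73 μ ε)²`, where the factor 2 makes the moment bound strict.
    let η : ℝ := Real.sqrt (2 * (73 * μ * ε) ^ 2 / (d * σ ^ 2))
    have hη2 : η ^ 2 = 2 * (73 * μ * ε) ^ 2 / (d * σ ^ 2) := Real.sq_sqrt (by positivity)
    have hη : 0 < η := Real.sqrt_pos.2 (by positivity)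
    obtain ⟨p, h1, h2, -, h3⟩ := exists_onePoint_coin (η := η) hd hτ hμ hL hε (by linarith) hη
      (by
        rw [hη2, ← mul_div_assoc, div_le_one (by positivity)]
        nlinarith) a N (by
        rw [hη2, ← mul_div_assoc, ← mul_div_assoc, div_le_iff₀ (by positivity)]
        have h1 : (d : ℝ) * (d + τ) * σ ^ 2 ≤ 2 * (τ * (d * σ ^ 2)) := by
          rw [show 2 * ((τ : ℝ) * (d * σ ^ 2)) = d * (τ + τ) * σ ^ 2 by ring]
          gcongr
        linarith)
    refine ⟨p, h1, h2 σ ?_, h3⟩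
    rw [hη2, show (d : ℝ) * (2 * (73 * μ * ε) ^ 2 / (d * σ ^ 2) * σ ^ 2) = 2 * (73 * μ * ε) ^ 2 by
      field_simp]
    have : 0 < (73 * μ * ε) ^ 2 := by positivity
    linarith

/-- No factor in `d` or `τ` is retained here, since the logarithm in the final bounds outgrows every
such factor. -/
lemma eventually_onePoint_uniform (hd : 1 ≤ d) (hτ : 1 ≤ τ) (hμ : 0 < μ) (hσ : 0 < σ)
    (hL : 3 * μ ≤ L) : ∀ᶠ ε : ℝ in 𝓝[>] 0, ∀ N : ℕ,
      384 * 73 ^ 2 * (N * ε ^ 2 * μ ^ 2) ≤ σ ^ 2 →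
        ∀ a : OnePointAlgorithm.{u} d, ∃ p : MarkovProblem d, p.OnePoint L μ τ ∧
          p.ValueNoiseUniform σ ∧ ∃ xs : Euc d, (∀ x, p.f xs ≤ p.f x) ∧ ‖xs‖ ≤ 1 ∧
            ENNReal.ofReal ε < a.error p p.oracle₁ N xs := by
  have hτ' : (1 : ℝ) ≤ τ := by exact_mod_cast hτ
  have hσ2 : 0 < σ ^ 2 := by positivity
  filter_upwards [self_mem_nhdsWithin, eventually_nhdsGT_mul_pow_le 73 one_pos one_ne_zero,
    eventually_nhdsGT_mul_pow_le (48 * 146 ^ 2 * μ ^ 2) hσ2 two_ne_zero] with ε hε hε1 hε2 N hN a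
  replace hε : 0 < ε := hε
  rw [pow_one] at hε1
  have hη2 : (146 * μ * ε / σ) ^ 2 = (146 * μ * ε) ^ 2 / σ ^ 2 := div_pow _ _ _
  obtain ⟨p, h1, -, h2, h3⟩ := exists_onePoint_coin (η := 146 * μ * ε / σ) hd hτ hμ hL hε
    (by linarith) (by positivity) (by
      rw [hη2, ← mul_div_assoc, div_le_one hσ2]
      linarith) a N (by
      rw [hη2, ← mul_div_assoc, ← mul_div_assoc, div_le_iff₀ hσ2]
      nlinarith)
  exact ⟨p, h1, h2 σ (by rw [div_mul_cancel₀ _ hσ.ne']), h3⟩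

lemma eventually_twoPoint_moment (hd : 1 ≤ d) (hτ : 1 ≤ τ) (hμ : 0 < μ) (hσ : 0 < σ)
    (hL : μ ≤ L) : ∀ᶠ ε : ℝ in 𝓝[>] 0, ∀ N : ℕ,
      13824 * (N * ε * μ ^ 2) ≤ ((d : ℝ) + τ) * σ ^ 2 →
        ∀ a : TwoPointAlgorithm.{u} d, ∃ p : MarkovProblem d, p.TwoPoint L μ τ ∧
          p.GradNoiseMoment σ ∧ ∃ xs : Euc d, (∀ x, p.f xs ≤ p.f x) ∧ ‖xs‖ ≤ 1 ∧
            ENNReal.ofReal ε < a.error p p.oracle₂ N xs := by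
  have hσ2 : 0 < σ ^ 2 := by positivity
  filter_upwards [self_mem_nhdsWithin, eventually_nhdsGT_mul_pow_le 9 one_pos one_ne_zero,
    eventually_nhdsGT_mul_pow_le (3456 * μ ^ 2) hσ2 one_ne_zero] with ε hε hε1 hε2 N hN a
  replace hε : 0 < ε := hε
  rw [pow_one] at hε1 hε2
  have h0 : 0 ≤ N * ε * μ ^ 2 := by positivity
  rcases le_or_gt τ d with h | h
  · refine exists_twoPoint_gauss hd hτ hμ hσ hL hε (by linarith) a N ?_
    have h' : (τ : ℝ) ≤ d := by exact_mod_cast h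
    have h1 : ((d : ℝ) + τ) * σ ^ 2 ≤ (d + d) * σ ^ 2 := by gcongr
    linarith
  · have h' : (d : ℝ) ≤ τ := by exact_mod_cast h.le
    have h1 : ((d : ℝ) + τ) * σ ^ 2 ≤ (τ + τ) * σ ^ 2 := by gcongr
    obtain ⟨p, h1, h2, -, h3⟩ := exists_twoPoint_coin hd hτ hμ hσ hL hε (by linarith)
      (by linarith) a N (by linarith)
    exact ⟨p, h1, h2, h3⟩

lemma eventually_twoPoint_uniform (hd : 1 ≤ d) (hτ : 1 ≤ τ) (hμ : 0 < μ) (hσ : 0 < σ)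
    (hL : μ ≤ L) : ∀ᶠ ε : ℝ in 𝓝[>] 0, ∀ N : ℕ,
      13824 * (N * ε * μ ^ 2) ≤ σ ^ 2 →
        ∀ a : TwoPointAlgorithm.{u} d, ∃ p : MarkovProblem d, p.TwoPoint L μ τ ∧
          p.GradNoiseUniform σ ∧ ∃ xs : Euc d, (∀ x, p.f xs ≤ p.f x) ∧ ‖xs‖ ≤ 1 ∧
            ENNReal.ofReal ε < a.error p p.oracle₂ N xs := by
  have hτ' : (1 : ℝ) ≤ τ := by exact_mod_cast hτ
  have hσ2 : 0 < σ ^ 2 := by positivity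
  filter_upwards [self_mem_nhdsWithin, eventually_nhdsGT_mul_pow_le 9 one_pos one_ne_zero,
    eventually_nhdsGT_mul_pow_le (3456 * μ ^ 2) hσ2 one_ne_zero] with ε hε hε1 hε2 N hN a
  replace hε : 0 < ε := hε
  rw [pow_one] at hε1 hε2
  have h0 : 0 ≤ N * ε * μ ^ 2 := by positivity
  have h1 : 1 * σ ^ 2 ≤ τ * σ ^ 2 := by gcongr
  obtain ⟨p, h1, -, h2, h3⟩ := exists_twoPoint_coin hd hτ hμ hσ hL hε (by linarith)
    (by linarith) a N (by linarith)
  exact ⟨p, h1, h2, h3⟩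

lemma tendsto_const_div_nhdsGT {u : ℕ → ℝ} (hu : Tendsto u atTop atTop) {A : ℝ} (hA : 0 < A) :
    Tendsto (fun N => A / u N) atTop (𝓝[>] 0) :=
  tendsto_nhdsWithin_iff.2 ⟨tendsto_const_nhds.div_atTop hu,
    (hu.eventually_gt_atTop 0).mono fun _ hN => div_pos hA hN⟩

lemma tendsto_sqrt_natCast : Tendsto (fun N : ℕ => Real.sqrt N) atTop atTop :=
  Real.tendsto_sqrt_atTop.comp tendsto_natCast_atTop_atTop

lemma tendsto_log_natCast : Tendsto (fun N : ℕ => Real.log N) atTop atTop :=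
  Real.tendsto_log_atTop.comp tendsto_natCast_atTop_atTop

lemma eventually_le_log_sq (B : ℝ) : ∀ᶠ N : ℕ in atTop, B ≤ Real.log N ^ 2 :=
  ((tendsto_pow_atTop two_ne_zero).comp tendsto_log_natCast).eventually_ge_atTop B

lemma eventually_le_log_inv_sq (B : ℝ) : ∀ᶠ ε : ℝ in 𝓝[>] 0, B ≤ Real.log (1 / ε) ^ 2 := by
  have h : Tendsto (fun ε : ℝ => Real.log (1 / ε) ^ 2) (𝓝[>] 0) atTop := by
    simp_rw [one_div]
    exact (tendsto_pow_atTop two_ne_zero).comp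
      (Real.tendsto_log_atTop.comp tendsto_inv_nhdsGT_zero)
  exact h.eventually_ge_atTop B

variable {G : ℝ → ℕ → Prop} {c K D : ℝ}

/-- Here `G ε N` stands for the failure of all algorithms at accuracy `ε` after `N` calls. The rate
in question, as a function of `N`, tends to 0 from the right and can be taken as `ε`. The condition
on `N` then reduces to `c² K ≤ 1`. -/
lemma rate_of_quadratic_complexity (hμ : 0 < μ) (hσ : 0 < σ) (hD : 0 < D) (hc : 0 < c)
    (hc1 : c ≤ 1) (hcK : c * K ≤ 1)
    (h : ∀ᶠ ε : ℝ in 𝓝[>] 0, ∀ N : ℕ, K * (N * ε ^ 2 * μ ^ 2) ≤ D * σ ^ 2 → G ε N) :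
    ∀ᶠ N : ℕ in atTop, G (c * (Real.sqrt (D * σ ^ 2) / (μ * Real.sqrt N))) N := by
  have hD' : 0 < D * σ ^ 2 := by positivity
  have ht := tendsto_const_div_nhdsGT (tendsto_sqrt_natCast.const_mul_atTop hμ)
    (mul_pos hc (Real.sqrt_pos.2 hD'))
  filter_upwards [ht.eventually h, eventually_gt_atTop 0] with N hN hN0
  have hN0' : (0 : ℝ) < N := by exact_mod_cast hN0
  rw [← mul_div_assoc]
  refine hN N ?_
  rw [div_pow, mul_pow, mul_pow, Real.sq_sqrt hD'.le, Real.sq_sqrt hN0'.le]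
  rw [show K * (N * (c ^ 2 * (D * σ ^ 2) / (μ ^ 2 * N)) * μ ^ 2) =
    (c * K) * c * (D * σ ^ 2) by field_simp]
  have : c * K * c ≤ 1 := by nlinarith
  nlinarith

/-- After the same substitution the condition reads `K c² D ≤ log² N`. It holds for large `N`
although `D` is absent from the hypothesis `h`. -/
lemma log_rate_of_quadratic_complexity (hμ : 0 < μ) (hσ : 0 < σ) (hD : 0 < D) (hc : 0 < c)
    (h : ∀ᶠ ε : ℝ in 𝓝[>] 0, ∀ N : ℕ, K * (N * ε ^ 2 * μ ^ 2) ≤ σ ^ 2 → G ε N) :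
    ∀ᶠ N : ℕ in atTop,
      G (c * (Real.sqrt (D * σ ^ 2) / (μ * Real.sqrt N * Real.log N))) N := by
  have hD' : 0 < D * σ ^ 2 := by positivity
  have ht := tendsto_const_div_nhdsGT ((tendsto_sqrt_natCast.const_mul_atTop hμ).atTop_mul_atTop₀
    tendsto_log_natCast) (mul_pos hc (Real.sqrt_pos.2 hD'))
  filter_upwards [ht.eventually h, eventually_gt_atTop 0, eventually_le_log_sq (K * c ^ 2 * D),
    eventually_le_log_sq 1] with N hN hN0 hlog hlog1
  have hN0' : (0 : ℝ) < N := by exact_mod_cast hN0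
  rw [← mul_div_assoc]
  refine hN N ?_
  rw [div_pow, mul_pow, mul_pow, mul_pow, Real.sq_sqrt hD'.le, Real.sq_sqrt hN0'.le]
  generalize Real.log N ^ 2 = ℓ at hlog hlog1
  have hℓ : 0 < ℓ := by linarith
  rw [show K * (N * (c ^ 2 * (D * σ ^ 2) / (μ ^ 2 * N * ℓ)) * μ ^ 2) =
    K * c ^ 2 * D * σ ^ 2 / ℓ by field_simp, div_le_iff₀ hℓ, mul_comm (σ ^ 2)]
  gcongr

lemma rate_of_linear_complexity (hμ : 0 < μ) (hσ : 0 < σ) (hD : 0 < D) (hc : 0 < c)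
    (hcK : c * K ≤ 1)
    (h : ∀ᶠ ε : ℝ in 𝓝[>] 0, ∀ N : ℕ, K * (N * ε * μ ^ 2) ≤ D * σ ^ 2 → G ε N) :
    ∀ᶠ N : ℕ in atTop, G (c * (D * σ ^ 2 / (μ ^ 2 * N))) N := by
  have hD' : 0 < D * σ ^ 2 := by positivity
  have ht := tendsto_const_div_nhdsGT ((tendsto_natCast_atTop_atTop (R := ℝ)).const_mul_atTop
    (pow_pos hμ 2)) (mul_pos hc hD')
  filter_upwards [ht.eventually h, eventually_gt_atTop 0] with N hN hN0
  have hN0' : (0 : ℝ) < N := by exact_mod_cast hN0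
  rw [← mul_div_assoc]
  refine hN N ?_
  rw [show K * (N * (c * (D * σ ^ 2) / (μ ^ 2 * N)) * μ ^ 2) = (c * K) * (D * σ ^ 2) by
    field_simp]
  exact mul_le_of_le_one_left hD'.le hcK

lemma log_rate_of_linear_complexity (hμ : 0 < μ) (hσ : 0 < σ) (hD : 0 < D) (hc : 0 < c)
    (h : ∀ᶠ ε : ℝ in 𝓝[>] 0, ∀ N : ℕ, K * (N * ε * μ ^ 2) ≤ σ ^ 2 → G ε N) :
    ∀ᶠ N : ℕ in atTop, G (c * (D * σ ^ 2 / (μ ^ 2 * N * Real.log N ^ 2))) N := by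
  have hD' : 0 < D * σ ^ 2 := by positivity
  have ht := tendsto_const_div_nhdsGT (((tendsto_natCast_atTop_atTop (R := ℝ)).const_mul_atTop
    (pow_pos hμ 2)).atTop_mul_atTop₀ ((tendsto_pow_atTop two_ne_zero).comp tendsto_log_natCast))
    (mul_pos hc hD')
  filter_upwards [ht.eventually h, eventually_gt_atTop 0, eventually_le_log_sq (K * c * D),
    eventually_le_log_sq 1] with N hN hN0 hlog hlog1
  have hN0' : (0 : ℝ) < N := by exact_mod_cast hN0
  rw [← mul_div_assoc]
  refine hN N ?_
  change K * (N * (c * (D * σ ^ 2) / (μ ^ 2 * N * Real.log N ^ 2)) * μ ^ 2) ≤ σ ^ 2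
  generalize Real.log N ^ 2 = ℓ at hlog hlog1
  have hℓ : 0 < ℓ := by linarith
  rw [show K * (N * (c * (D * σ ^ 2) / (μ ^ 2 * N * ℓ)) * μ ^ 2) =
    K * c * D * σ ^ 2 / ℓ by field_simp, div_le_iff₀ hℓ, mul_comm (σ ^ 2)]
  gcongr

/-- The number of calls below which the hypothesis of a lower bound holds. -/
lemma complexity_of_bound {ψ : ℝ → ℝ} (hμ : 0 < μ) (hψ : ∀ ε, 0 < ε → 0 < ψ ε) (hD : 0 < D)
    (hK : 0 < K) (hcK : c * K ≤ 1)
    (h : ∀ᶠ ε : ℝ in 𝓝[>] 0, ∀ N : ℕ, K * (N * ψ ε * μ ^ 2) ≤ D * σ ^ 2 → G ε N) :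
    ∀ᶠ ε : ℝ in 𝓝[>] 0, ∀ N : ℕ, (N : ℝ) < c * (D * σ ^ 2 / (μ ^ 2 * ψ ε)) → G ε N := by
  filter_upwards [h, self_mem_nhdsWithin] with ε hε hε0 N hN
  have hψε := hψ ε hε0
  refine hε N ?_
  rw [← mul_div_assoc, lt_div_iff₀ (by positivity)] at hN
  have hDσ : 0 ≤ D * σ ^ 2 := by positivity
  nlinarith

lemma log_complexity_of_bound {ψ : ℝ → ℝ} (hμ : 0 < μ) (hψ : ∀ ε, 0 < ε → 0 < ψ ε)
    (hK : 0 < K)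
    (h : ∀ᶠ ε : ℝ in 𝓝[>] 0, ∀ N : ℕ, K * (N * ψ ε * μ ^ 2) ≤ σ ^ 2 → G ε N) :
    ∀ᶠ ε : ℝ in 𝓝[>] 0, ∀ N : ℕ,
      (N : ℝ) < c * (D * σ ^ 2 / (μ ^ 2 * ψ ε * Real.log (1 / ε) ^ 2)) → G ε N := by
  filter_upwards [h, self_mem_nhdsWithin, eventually_le_log_inv_sq (K * c * D),
    eventually_le_log_inv_sq 1] with ε hε hε0 hlog hlog1 N hN
  have hψε := hψ ε hε0
  refine hε N ?_
  generalize Real.log (1 / ε) ^ 2 = ℓ at hlog hlog1 hN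
  have hℓ : 0 < ℓ := by linarith
  rw [← mul_div_assoc, lt_div_iff₀ (by positivity)] at hN
  refine le_of_mul_le_mul_right ?_ hℓ
  calc K * (N * ψ ε * μ ^ 2) * ℓ = K * (N * (μ ^ 2 * ψ ε * ℓ)) := by ring
    _ ≤ K * (c * (D * σ ^ 2)) := by gcongr
    _ = K * c * D * σ ^ 2 := by ring
    _ ≤ ℓ * σ ^ 2 := by gcongr
    _ = σ ^ 2 * ℓ := mul_comm _ _

end Rates

end

/-! ### The theorem -/

theorem mainTheorem5 :
    ∃ c : ℝ, 0 < c ∧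
      ∀ (d τ : ℕ) (L μ σ : ℝ), 1 ≤ d → 1 ≤ τ → 0 < μ → 0 < σ →
        -- one-point feedback
        (3 * μ ≤ L →
          -- second-moment noise bound: error rate and oracle complexity
          (∀ᶠ N : ℕ in atTop, ∀ a : OnePointAlgorithm.{u} d,
            ∃ p : MarkovProblem d, p.OnePoint L μ τ ∧ p.ValueNoiseMoment σ ∧
              ∃ xs : Euc d, (∀ x, p.f xs ≤ p.f x) ∧ ‖xs‖ ≤ 1 ∧
                ENNReal.ofReal
                    (c * (Real.sqrt ((d : ℝ) * ((d : ℝ) + τ) * σ ^ 2) / (μ * Real.sqrt N))) ≤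
                  a.error p p.oracle₁ N xs) ∧
          (∀ᶠ ε : ℝ in 𝓝[>] 0, ∀ (a : OnePointAlgorithm.{u} d) (N : ℕ),
            (N : ℝ) < c * ((d : ℝ) * ((d : ℝ) + τ) * σ ^ 2 / (μ ^ 2 * ε ^ 2)) →
            ∃ p : MarkovProblem d, p.OnePoint L μ τ ∧ p.ValueNoiseMoment σ ∧
              ∃ xs : Euc d, (∀ x, p.f xs ≤ p.f x) ∧ ‖xs‖ ≤ 1 ∧
                ENNReal.ofReal ε < a.error p p.oracle₁ N xs) ∧
          -- uniform noise bound: the same up to logarithmic factors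
          (∀ᶠ N : ℕ in atTop, ∀ a : OnePointAlgorithm.{u} d,
            ∃ p : MarkovProblem d, p.OnePoint L μ τ ∧ p.ValueNoiseUniform σ ∧
              ∃ xs : Euc d, (∀ x, p.f xs ≤ p.f x) ∧ ‖xs‖ ≤ 1 ∧
                ENNReal.ofReal
                    (c * (Real.sqrt ((d : ℝ) * ((d : ℝ) + τ) * σ ^ 2) /
                      (μ * Real.sqrt N * Real.log N))) ≤
                  a.error p p.oracle₁ N xs) ∧
          (∀ᶠ ε : ℝ in 𝓝[>] 0, ∀ (a : OnePointAlgorithm.{u} d) (N : ℕ),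
            (N : ℝ) < c * ((d : ℝ) * ((d : ℝ) + τ) * σ ^ 2 /
                (μ ^ 2 * ε ^ 2 * Real.log (1 / ε) ^ 2)) →
            ∃ p : MarkovProblem d, p.OnePoint L μ τ ∧ p.ValueNoiseUniform σ ∧
              ∃ xs : Euc d, (∀ x, p.f xs ≤ p.f x) ∧ ‖xs‖ ≤ 1 ∧
                ENNReal.ofReal ε < a.error p p.oracle₁ N xs)) ∧
        -- two-point feedback
        (μ ≤ L →
          -- second-moment noise bound: error rate and oracle complexity
          (∀ᶠ N : ℕ in atTop, ∀ a : TwoPointAlgorithm.{u} d,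
            ∃ p : MarkovProblem d, p.TwoPoint L μ τ ∧ p.GradNoiseMoment σ ∧
              ∃ xs : Euc d, (∀ x, p.f xs ≤ p.f x) ∧ ‖xs‖ ≤ 1 ∧
                ENNReal.ofReal (c * (((d : ℝ) + τ) * σ ^ 2 / (μ ^ 2 * N))) ≤
                  a.error p p.oracle₂ N xs) ∧
          (∀ᶠ ε : ℝ in 𝓝[>] 0, ∀ (a : TwoPointAlgorithm.{u} d) (N : ℕ),
            (N : ℝ) < c * (((d : ℝ) + τ) * σ ^ 2 / (μ ^ 2 * ε)) →
            ∃ p : MarkovProblem d, p.TwoPoint L μ τ ∧ p.GradNoiseMoment σ ∧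
              ∃ xs : Euc d, (∀ x, p.f xs ≤ p.f x) ∧ ‖xs‖ ≤ 1 ∧
                ENNReal.ofReal ε < a.error p p.oracle₂ N xs) ∧
          -- uniform noise bound: the same up to logarithmic factors
          (∀ᶠ N : ℕ in atTop, ∀ a : TwoPointAlgorithm.{u} d,
            ∃ p : MarkovProblem d, p.TwoPoint L μ τ ∧ p.GradNoiseUniform σ ∧
              ∃ xs : Euc d, (∀ x, p.f xs ≤ p.f x) ∧ ‖xs‖ ≤ 1 ∧
                ENNReal.ofReal
                    (c * (((d : ℝ) + τ) * σ ^ 2 / (μ ^ 2 * N * Real.log N ^ 2))) ≤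
                  a.error p p.oracle₂ N xs) ∧
          (∀ᶠ ε : ℝ in 𝓝[>] 0, ∀ (a : TwoPointAlgorithm.{u} d) (N : ℕ),
            (N : ℝ) < c * (((d : ℝ) + τ) * σ ^ 2 / (μ ^ 2 * ε * Real.log (1 / ε) ^ 2)) →
            ∃ p : MarkovProblem d, p.TwoPoint L μ τ ∧ p.GradNoiseUniform σ ∧
              ∃ xs : Euc d, (∀ x, p.f xs ≤ p.f x) ∧ ‖xs‖ ≤ 1 ∧
                ENNReal.ofReal ε < a.error p p.oracle₂ N xs)) := by
  -- The constant has to satisfy `c K ≤ 1` for `K = 384 * 73²`, about two million, and for `K =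
  -- 13824`.
  refine ⟨1 / 10 ^ 7, by norm_num, fun d τ L μ σ hd hτ hμ hσ => ?_⟩
  have hd' : (1 : ℝ) ≤ d := by exact_mod_cast hd
  have hD₁ : 0 < (d : ℝ) * ((d : ℝ) + τ) := by positivity
  have hD₂ : 0 < (d : ℝ) + τ := by positivity
  have hsq : ∀ ε : ℝ, 0 < ε → 0 < ε ^ 2 := fun ε hε => by positivity
  have hc : (0 : ℝ) < 1 / 10 ^ 7 := by norm_num
  refine ⟨fun hL => ⟨?_, ?_, ?_, ?_⟩, fun hL => ⟨?_, ?_, ?_, ?_⟩⟩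
  · filter_upwards [rate_of_quadratic_complexity hμ hσ hD₁ hc (by norm_num) (by norm_num)
      (eventually_onePoint_moment hd hτ hμ hσ hL)] with N hN a
    obtain ⟨p, h1, h2, xs, h3, h4, h5⟩ := hN a
    exact ⟨p, h1, h2, xs, h3, h4, h5.le⟩
  · filter_upwards [complexity_of_bound (c := 1 / 10 ^ 7) hμ hsq hD₁ (by norm_num) (by norm_num)
      (eventually_onePoint_moment hd hτ hμ hσ hL)] with ε hε a N hN
    exact hε N hN a
  · filter_upwards [log_rate_of_quadratic_complexity hμ hσ hD₁ hc
      (eventually_onePoint_uniform hd hτ hμ hσ hL)] with N hN a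
    obtain ⟨p, h1, h2, xs, h3, h4, h5⟩ := hN a
    exact ⟨p, h1, h2, xs, h3, h4, h5.le⟩
  · filter_upwards [log_complexity_of_bound (c := 1 / 10 ^ 7) (D := (d : ℝ) * ((d : ℝ) + τ)) hμ
      hsq (by norm_num) (eventually_onePoint_uniform hd hτ hμ hσ hL)] with ε hε a N hN
    exact hε N hN a
  · filter_upwards [rate_of_linear_complexity hμ hσ hD₂ hc (by norm_num)
      (eventually_twoPoint_moment hd hτ hμ hσ hL)] with N hN a
    obtain ⟨p, h1, h2, xs, h3, h4, h5⟩ := hN a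
    exact ⟨p, h1, h2, xs, h3, h4, h5.le⟩
  · filter_upwards [complexity_of_bound (c := 1 / 10 ^ 7) (ψ := id) hμ (fun _ h => h) hD₂
      (by norm_num) (by norm_num) (eventually_twoPoint_moment hd hτ hμ hσ hL)] with ε hε a N hN
    exact hε N hN a
  · filter_upwards [log_rate_of_linear_complexity hμ hσ hD₂ hc
      (eventually_twoPoint_uniform hd hτ hμ hσ hL)] with N hN a
    obtain ⟨p, h1, h2, xs, h3, h4, h5⟩ := hN a
    exact ⟨p, h1, h2, xs, h3, h4, h5.le⟩
  · filter_upwards [log_complexity_of_bound (c := 1 / 10 ^ 7) (ψ := id) (D := (d : ℝ) + τ) hμ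
      (fun _ h => h) (by norm_num) (eventually_twoPoint_uniform hd hτ hμ hσ hL)] with ε hε a N hN
    exact hε N hN a
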